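/- **Setting.** Let $d\ge 1$, let $\Omega\subset\mathbb R^d$ be open and bounded, partitioned into finitely many non-overlapping convex polytopes $K\in\Omega_h$ (their interiors are pairwise disjoint subsets of $\Omega$ and $\overline\Omega=\bigcup_K K$; hanging nodes are allowed). Let $h=\max_K \operatorname{diam}K$, $p\ge 0$ an integer, and let $0<c\le 1$ be such that every $K$ contains a ball of radius $ch$. Let $\kappa,\lambda,\varepsilon>0$; let $\beta:\overline\Omega\to\mathbb R^d$ be continuous, $C^1$ in the interior of every element, with $\nabla\cdot\beta\in L^1(\Omega)$, and $\nu\in L^1(\Omega)$, with $\nu-\tfrac12\nabla\cdot\beta\ge\lambda$ a.e. in $\Omega$. Consider the homogeneous system $\kappa^{-1}\sigma+\nabla u=0$, $\nabla\cdot\sigma+\beta\cdot\nabla u+\nu u=0$. On $\partial K$, with $n=n^-$ the outward unit normal of $K$ and $n^+=-n^-$, put $\alpha=\sqrt{|\beta\cdot n|^2+4}$ and $\tau^\pm=\frac12(\alpha-\beta\cdot n^\pm)$, $\tau=\tau^-$. For a piecewise field, $(\cdot)^-$ is the trace from $K$ and $(\cdot)^+$ the trace from the neighbouring element, with $(\cdot)^+=0$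 on $\partial\Omega$ (homogeneous boundary data). **Algorithm (iHDG-II).** $(\sigma^k,u^k)$, $k\ge0$, are piecewise polynomials of total degree $\le p$ (vector- and scalar-valued), $(\sigma^0,u^0)$ is arbitrary, and for all $k\ge0$, all $K$, and all polynomial test functions $\mathbf t$ (vector), $v$ (scalar) of degree $\le p$ on $K$, $$\kappa^{-1}(\sigma^{k+1},\mathbf t)_K-(u^{k+1},\nabla\cdot\mathbf t)_K+\langle\hat u^{k,k+1},\mathbf t\cdot n\rangle_{\partial K}=0,$$ $$-(\sigma^{k+1},\nabla v)_K-(u^{k+1},\nabla\cdot(\beta v)-\nu v)_K+\langle\beta\cdot n\,u^{k+1}+\sigma^{k+1}\cdot n+\tau(u^{k+1}-\hat u^{k,k+1}),v\rangle_{\partial K}=0,$$ $$\hat u^{k,k+1}=\frac{(\sigma^{k+1}\cdot n)^-+(\sigma^k\cdot n)^++\beta\cdot n^-(u^{k+1})^-+\beta\cdot n^+(u^k)^++\tau^-(u^{k+1})^-+\tau^+(u^k)^+}{\alpha}.$$ **Norms.** $\|(\sigma,u)\|_{\Omega_h}^2=\sum_K(\|\sigma\|_{L^2(K)}^2+\|u\|_{L^2(K)}^2)$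 and $\|(\sigma\cdot n,u)\|_{\mathcal E_h}^2=\sum_K(\|(\sigma\cdot n)^-\|_{L^2(\partial K)}^2+\|u^-\|_{L^2(\partial K)}^2)$. **Constants.** Let $\bar\beta,\bar\tau,\bar\alpha$ be the suprema of $|\beta\cdot n|,\tau,\alpha$ and $\alpha_*$ the infimum of $\alpha$ over all element boundaries, and $$\mathcal C_1=\frac{(\bar\beta+\bar\tau)(\bar\tau+1)}{2\varepsilon\alpha_*},\quad \mathcal C_2=\frac{\bar\tau+1}{2\varepsilon\alpha_*},\quad \mathcal C_3=\frac{\varepsilon\bar\tau(1+\bar\tau+\bar\beta)}{2\alpha_*},\quad \mathcal C_4=\frac{\varepsilon(1+\bar\tau+\bar\beta)}{2\alpha_*},$$ $$\mathcal B_1=\frac{2ch\kappa^{-1}}{d(p+1)(p+2)}+\frac1{2\bar\alpha}-\mathcal C_4,\quad \mathcal B_2=\frac{2ch\lambda}{d(p+1)(p+2)}+\frac1{\bar\alpha}-\mathcal C_3,\quad \mathcal B=\min\{\mathcal B_1,\mathcal B_2\},$$ $$\mathcal A=\max\{\mathcal C_1,\mathcal C_2\},\quad \mathcal D=\frac{\mathcal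 A}{\mathcal B},\quad \mathcal E=\frac{\max\{\mathcal C_3,\mathcal C_4\}}{\min\{\kappa^{-1},\lambda\}},\quad \mathcal F=\frac{\mathcal A}{\min\{\kappa^{-1},\lambda\}}.$$ **Theorem.** If $\mathcal B>0$ and $\mathcal D<1$, then $$\|(\sigma^k\cdot n,u^k)\|_{\mathcal E_h}^2\le\mathcal D^k\,\|(\sigma^0\cdot n,u^0)\|_{\mathcal E_h}^2\quad(k\ge0),$$ $$\|(\sigma^k,u^k)\|_{\Omega_h}^2\le(\mathcal E\mathcal D+\mathcal F)\,\mathcal D^{k-1}\,\|(\sigma^0\cdot n,u^0)\|_{\mathcal E_h}^2\quad(k\ge1);$$ in particular both norms converge to $0$ as $k\to\infty$. -/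

import Mathlib

open MeasureTheory Filter Topology

namespace IHDG

noncomputable section

/-- The Euclidean space `ℝ^d`. -/
abbrev Pt (d : ℕ) : Type := EuclideanSpace ℝ (Fin d)

/-! ### Elements and meshes -/

/-- A `d`-dimensional bounded convex polytope, presented irredundantly as the intersection of the
half-spaces `⟪n_i, x⟫ ≤ b_i`, where the `n_i` are the outward unit normals of its facets. -/
structure ConvexPolytope (d : ℕ) where
  numFacets : ℕ
  normal : Fin numFacets → Pt d
  offset : Fin numFacets → ℝ
  norm_normal : ∀ i, ‖normal i‖ = 1
  isBounded : Bornology.IsBounded {x : Pt d | ∀ i, inner ℝ (normal i) x ≤ offset i}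
  interior_nonempty : (interior {x : Pt d | ∀ i, inner ℝ (normal i) x ≤ offset i}).Nonempty
  facet_nondegenerate : ∀ i, ∃ x : Pt d, inner ℝ (normal i) x = offset i ∧
    ∀ j, j ≠ i → inner ℝ (normal j) x < offset j

/-- The (closed) point set of the polytope. -/
def ConvexPolytope.carrier {d : ℕ} (K : ConvexPolytope d) : Set (Pt d) :=
  {x | ∀ i, inner ℝ (K.normal i) x ≤ K.offset i}

/-- The `i`-th (closed) facet. The boundary of the polytope is the union of the facets, which
overlap only in sets of surface measure zero. -/
def ConvexPolytope.facet {d : ℕ} (K : ConvexPolytope d) (i : Fin K.numFacets) : Set (Pt d) :=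
  {x | x ∈ K.carrier ∧ inner ℝ (K.normal i) x = K.offset i}

/-- A partition of a bounded open set `Ω ⊆ ℝ^d` into finitely many non-overlapping convex
polytopes. Neighbouring elements need not share complete facets. -/
structure Mesh (d : ℕ) where
  Ω : Set (Pt d)
  isOpen_Ω : IsOpen Ω
  numElems : ℕ
  elem : Fin numElems → ConvexPolytope d
  interior_subset : ∀ j, interior (elem j).carrier ⊆ Ω
  nonoverlapping : ∀ j j', j ≠ j' →
    Disjoint (interior (elem j).carrier) (interior (elem j').carrier)
  closure_Ω : closure Ω = ⋃ j, (elem j).carrier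

/-- The mesh size, i.e. the largest diameter of an element. -/
def Mesh.h {d : ℕ} (M : Mesh d) : ℝ := ⨆ j, Metric.diam (M.elem j).carrier

/-- Surface measure on the facets: the `(d-1)`-dimensional Hausdorff measure, normalised to be
Lebesgue measure on hyperplanes (counting measure for `d = 1`). -/
def surf (d : ℕ) : Measure (Pt d) := μHE[d - 1]

/-- `∑_i ∫_{F_i} g i x dS(x)`: the integral over `∂K` of a function that may depend, besides the
point, on the facet (through its outward normal). -/
def ConvexPolytope.bdryIntegral {d : ℕ} (K : ConvexPolytope d)
    (g : Fin K.numFacets → Pt d → ℝ) : ℝ :=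
  ∑ i, ∫ x in K.facet i, g i x ∂(surf d)

/-! ### Discrete spaces and differential operators -/

/-- Real polynomial functions on `ℝ^d` of total degree at most `p`. -/
def IsPoly {d : ℕ} (p : ℕ) (f : Pt d → ℝ) : Prop :=
  ∃ q : MvPolynomial (Fin d) ℝ, q.totalDegree ≤ p ∧ ∀ x, f x = MvPolynomial.eval (fun i => x i) q

/-- Vector fields all of whose components are polynomials of degree at most `p`. -/
def IsVecPoly {d : ℕ} (p : ℕ) (F : Pt d → Pt d) : Prop :=
  ∀ i, IsPoly p (fun x => F x i)

/-- The divergence of a vector field. -/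
def divergence {d : ℕ} (F : Pt d → Pt d) (x : Pt d) : ℝ :=
  ∑ i, (fderiv ℝ F x (EuclideanSpace.single i 1)) i

/-- Discontinuous piecewise fields: one function per element (only its restriction to the element
matters). -/
abbrev Mesh.ScalarField {d : ℕ} (M : Mesh d) : Type := Fin M.numElems → Pt d → ℝ

/-- Discontinuous piecewise vector fields. -/
abbrev Mesh.VectorField {d : ℕ} (M : Mesh d) : Type := Fin M.numElems → Pt d → Pt d

open Classical in
/-- The exterior trace `w^+` of a piecewise field at a point `x` of `∂K_j`: the value from the
neighbouring element at interior points of `Ω`, and zero (homogeneous boundary data) on `∂Ω`.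
For almost every `x ∈ ∂K_j ∩ Ω` exactly one element other than `K_j` contains `x`, so that the sum
has a single term. -/
def Mesh.extTrace {d : ℕ} (M : Mesh d) {V : Type} [AddCommMonoid V]
    (w : Fin M.numElems → Pt d → V) (j : Fin M.numElems) (x : Pt d) : V :=
  if x ∈ M.Ω then ∑ j' with j' ≠ j ∧ x ∈ (M.elem j').carrier, w j' x else 0

/-! ### The upwind HDG flux and the iHDG-II iteration -/

/-- `α = √(|β·n|² + 4)`, as a function of the number `b = β·n`. -/
def alpha (b : ℝ) : ℝ := Real.sqrt (|b| ^ 2 + 4)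

/-- `τ = (α - β·n) / 2`, as a function of the number `b = β·n`. -/
def tau (b : ℝ) : ℝ := (1 / 2) * (alpha b - b)

/-- The trace `û^{k,k+1}` on facet `i` of element `j`, computed from the new interior values
`(σ', u')` on the element itself and the exterior values of the previous iterate `(σ, u)`. -/
def uHat {d : ℕ} (M : Mesh d) (β : Pt d → Pt d)
    (σ : M.VectorField) (u : M.ScalarField) (σ' : M.VectorField) (u' : M.ScalarField)
    (j : Fin M.numElems) (i : Fin (M.elem j).numFacets) (x : Pt d) : ℝ :=
  let nm : Pt d := (M.elem j).normal i
  let np : Pt d := -nm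
  ((inner ℝ (σ' j x) nm + inner ℝ (M.extTrace σ j x) np)
      + (inner ℝ (β x) nm * u' j x + inner ℝ (β x) np * M.extTrace u j x)) / alpha (inner ℝ (β x) nm)
    + (tau (inner ℝ (β x) nm) * u' j x + tau (inner ℝ (β x) np) * M.extTrace u j x)
      / alpha (inner ℝ (β x) nm)

/-- One step of the iHDG-II algorithm for the homogeneous problem
`κ⁻¹ σ + ∇u = 0`, `∇·σ + β·∇u + ν u = 0`: the new iterate `(σ', u')` is piecewise polynomial of
degree at most `p` and solves, on every element, the local problem driven by `(σ, u)`. -/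
structure IsIHDGStep {d : ℕ} (M : Mesh d) (p : ℕ) (κ : ℝ) (β : Pt d → Pt d) (ν : Pt d → ℝ)
    (σ : M.VectorField) (u : M.ScalarField) (σ' : M.VectorField) (u' : M.ScalarField) : Prop where
  poly_σ : ∀ j, IsVecPoly p (σ' j)
  poly_u : ∀ j, IsPoly p (u' j)
  eq_σ : ∀ j, ∀ t : Pt d → Pt d, IsVecPoly p t →
    κ⁻¹ * (∫ x in (M.elem j).carrier, inner ℝ (σ' j x) (t x))
      - (∫ x in (M.elem j).carrier, u' j x * divergence t x)
      + (M.elem j).bdryIntegral (fun i x =>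
          uHat M β σ u σ' u' j i x * inner ℝ (t x) ((M.elem j).normal i)) = 0
  eq_u : ∀ j, ∀ v : Pt d → ℝ, IsPoly p v →
    - (∫ x in (M.elem j).carrier, inner ℝ (σ' j x) (gradient v x))
      - (∫ x in (M.elem j).carrier, u' j x * (divergence (fun y => v y • β y) x - ν x * v x))
      + (M.elem j).bdryIntegral (fun i x =>
          (inner ℝ (β x) ((M.elem j).normal i) * u' j x + inner ℝ (σ' j x) ((M.elem j).normal i)
            + tau (inner ℝ (β x) ((M.elem j).normal i)) * (u' j x - uHat M β σ u σ' u' j i x))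
          * v x) = 0

/-! ### Norms -/

/-- `‖(σ, u)‖²_{Ω_h}`. -/
def volNormSq {d : ℕ} (M : Mesh d) (σ : M.VectorField) (u : M.ScalarField) : ℝ :=
  ∑ j, ((∫ x in (M.elem j).carrier, ‖σ j x‖ ^ 2) + ∫ x in (M.elem j).carrier, u j x ^ 2)

/-- `‖(σ·n, u)‖²` on the skeleton: the sum over all element boundaries of the squared `L²` norms of
the one-sided traces. -/
def skelNormSq {d : ℕ} (M : Mesh d) (σ : M.VectorField) (u : M.ScalarField) : ℝ :=
  ∑ j, ((M.elem j).bdryIntegral (fun i x => inner ℝ (σ j x) ((M.elem j).normal i) ^ 2)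
    + (M.elem j).bdryIntegral (fun _ x => u j x ^ 2))

/-! ### The constants -/

/-- All values of `g (β·n)` on the element boundaries `∂Ω_h`, `n` being the outward normal of the
element. -/
def traceValues {d : ℕ} (M : Mesh d) (β : Pt d → Pt d) (g : ℝ → ℝ) : Set ℝ :=
  {r | ∃ j, ∃ i, ∃ x ∈ (M.elem j).facet i, r = g (inner ℝ (β x) ((M.elem j).normal i))}

/-- `‖β·n‖_{L^∞(∂Ω_h)}` (for continuous `β`). -/
def betaBar {d : ℕ} (M : Mesh d) (β : Pt d → Pt d) : ℝ := sSup (traceValues M β fun b => |b|)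

/-- `‖τ‖_{L^∞(∂Ω_h)}`; note `τ > 0`. -/
def tauBar {d : ℕ} (M : Mesh d) (β : Pt d → Pt d) : ℝ := sSup (traceValues M β tau)

/-- `‖α‖_{L^∞(∂Ω_h)}`; note `α ≥ 2`. -/
def alphaBar {d : ℕ} (M : Mesh d) (β : Pt d → Pt d) : ℝ := sSup (traceValues M β alpha)

/-- The infimum of `α` over `∂Ω_h`. -/
def alphaStar {d : ℕ} (M : Mesh d) (β : Pt d → Pt d) : ℝ := sInf (traceValues M β alpha)

def constC1 {d : ℕ} (M : Mesh d) (β : Pt d → Pt d) (ε : ℝ) : ℝ :=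
  (betaBar M β + tauBar M β) * (tauBar M β + 1) / (2 * ε * alphaStar M β)

def constC2 {d : ℕ} (M : Mesh d) (β : Pt d → Pt d) (ε : ℝ) : ℝ :=
  (tauBar M β + 1) / (2 * ε * alphaStar M β)

def constC3 {d : ℕ} (M : Mesh d) (β : Pt d → Pt d) (ε : ℝ) : ℝ :=
  ε * tauBar M β * (1 + tauBar M β + betaBar M β) / (2 * alphaStar M β)

def constC4 {d : ℕ} (M : Mesh d) (β : Pt d → Pt d) (ε : ℝ) : ℝ :=
  ε * (1 + tauBar M β + betaBar M β) / (2 * alphaStar M β)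

def constB1 {d : ℕ} (M : Mesh d) (p : ℕ) (κ : ℝ) (β : Pt d → Pt d) (c ε : ℝ) : ℝ :=
  2 * c * M.h * κ⁻¹ / ((d : ℝ) * ((p : ℝ) + 1) * ((p : ℝ) + 2)) + 1 / (2 * alphaBar M β)
    - constC4 M β ε

def constB2 {d : ℕ} (M : Mesh d) (p : ℕ) (lam : ℝ) (β : Pt d → Pt d) (c ε : ℝ) : ℝ :=
  2 * c * M.h * lam / ((d : ℝ) * ((p : ℝ) + 1) * ((p : ℝ) + 2)) + 1 / alphaBar M β
    - constC3 M β ε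

def constA {d : ℕ} (M : Mesh d) (β : Pt d → Pt d) (ε : ℝ) : ℝ :=
  max (constC1 M β ε) (constC2 M β ε)

def constB {d : ℕ} (M : Mesh d) (p : ℕ) (κ lam : ℝ) (β : Pt d → Pt d) (c ε : ℝ) : ℝ :=
  min (constB1 M p κ β c ε) (constB2 M p lam β c ε)

def constD {d : ℕ} (M : Mesh d) (p : ℕ) (κ lam : ℝ) (β : Pt d → Pt d) (c ε : ℝ) : ℝ :=
  constA M β ε / constB M p κ lam β c ε

def constE {d : ℕ} (M : Mesh d) (κ lam : ℝ) (β : Pt d → Pt d) (ε : ℝ) : ℝ :=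
  max (constC3 M β ε) (constC4 M β ε) / min κ⁻¹ lam

def constF {d : ℕ} (M : Mesh d) (κ lam : ℝ) (β : Pt d → Pt d) (ε : ℝ) : ℝ :=
  constA M β ε / min κ⁻¹ lam

end

end IHDG

/-! The proof is an energy argument on each element, followed by a count of how often a trace occurs
on the skeleton. Testing the two local equations with the new iterate (σ', u') and integrating by
parts equates κ⁻¹‖σ'‖² + ∫(ν − ½∇·β)u'² with minus a boundary integral
(`IsIHDGStep.energy_identity`). The upwind choice of τ gives τ⁻τ⁺ = 1 and τ⁻ + τ⁺ = α. Hence, with b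
= β·n, q = σ'·n and old exterior traces s, w, the boundary integrand times α is ½(q + bu')² + ½q² +
u'² + (q − τu')(s + τw). Only the last product is indefinite, and Young's inequality with parameter
ε splits it (`neg_flux_le`); this is where 𝒞₁, …, 𝒞₄ come from.

Almost every skeleton point lies on at most two facets, each seeing the other as its exterior.
Summed over all elements, the old exterior traces therefore cost no more than the old skeleton norm
(`Mesh.sum_bdryIntegral_extSq_le`). A discrete trace inequality (`ConvexPolytope.trace_inequality`)
converts the volume terms into skeleton terms, so that 𝓑 · new ≤ 𝓐 · old. The volume bound comes
from the same energy estimate, with the negative skeleton terms moved to the right and controlled by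
the decay already proved.

Two analytic tools carry this. The divergence theorem on a polytope
(`ConvexPolytope.integral_divergence`) holds for fields that are continuous up to the boundary, C¹
only inside, with integrable divergence; it is obtained from smooth cut-offs whose gradients
concentrate on the facets. The trace inequality reduces to one variable along rays from the centre
of the inscribed ball (`sq_eval_one_le`), and for d = 1 to an inequality for both end points
(`sq_eval_add_sq_eval_le`). Both use the polynomial representing evaluation at an end point, whose
coefficients are residues of an explicit rational function. -/

namespace IHDG

/-! ### Hyperplanes and the surface measure -/

theorem hyperplane_eq_range {d : ℕ} {n : Pt d} (hn : ‖n‖ = 1) (b : ℝ) :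
    {x : Pt d | inner ℝ n x = b} = Set.range (fun z : (ℝ ∙ n)ᗮ => b • n + (z : Pt d)) := by
  ext x
  simp only [Set.mem_ofPred_eq, Set.mem_range]
  constructor
  · intro hx
    refine ⟨⟨x - b • n, ?_⟩, by simp⟩
    rw [Submodule.mem_orthogonal_singleton_iff_inner_right, inner_sub_right, inner_smul_right,
      real_inner_self_eq_norm_sq, hn, hx]
    ring
  · rintro ⟨z, rfl⟩
    have hz := (Submodule.mem_orthogonal_singleton_iff_inner_right).1 z.2
    rw [inner_add_right, inner_smul_right, real_inner_self_eq_norm_sq, hn, hz]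
    ring

theorem inner_normal_add {d : ℕ} {n : Pt d} (hn : ‖n‖ = 1) (t : ℝ) (z : (ℝ ∙ n)ᗮ) :
    inner ℝ n (t • n + (z : Pt d)) = t := by
  have hz := (Submodule.mem_orthogonal_singleton_iff_inner_right).1 z.2
  rw [inner_add_right, inner_smul_right, real_inner_self_eq_norm_sq, hn, hz]
  ring

theorem finrank_normal_orthogonal {d : ℕ} {n : Pt d} (hn : ‖n‖ = 1) :
    Module.finrank ℝ (ℝ ∙ n)ᗮ = d - 1 := by
  have h0 : n ≠ 0 := by rintro rfl; simp at hn
  have h1 : Module.finrank ℝ (ℝ ∙ n) = 1 := finrank_span_singleton h0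
  have h := (ℝ ∙ n).finrank_add_finrank_orthogonal
  rw [h1, finrank_euclideanSpace, Fintype.card_fin] at h
  omega

theorem isometry_hyperplaneChart {d : ℕ} (n : Pt d) (b : ℝ) :
    Isometry (fun z : (ℝ ∙ n)ᗮ => b • n + (z : Pt d)) :=
  Isometry.of_dist_eq fun _ _ => dist_add_left _ _ _

/-- An isometric chart transports Hausdorff measure, and on the (d − 1)-dimensional space n^⊥ the
normalised Hausdorff measure is Lebesgue measure. All facet integrals are computed through this
chart. -/
theorem surf_restrict_hyperplane {d : ℕ} {n : Pt d} (hn : ‖n‖ = 1) (b : ℝ) :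
    (surf d).restrict {x | inner ℝ n x = b}
      = Measure.map (fun z : (ℝ ∙ n)ᗮ => b • n + (z : Pt d)) volume := by
  rw [hyperplane_eq_range hn, surf, ← (isometry_hyperplaneChart n b).map_euclideanHausdorffMeasure,
    ← finrank_normal_orthogonal hn, InnerProductSpace.euclideanHausdorffMeasure_eq_volume]

theorem measurableEmbedding_hyperplaneChart {d : ℕ} (n : Pt d) (b : ℝ) :
    MeasurableEmbedding (fun z : (ℝ ∙ n)ᗮ => b • n + (z : Pt d)) :=
  (isometry_hyperplaneChart n b).isClosedEmbedding.measurableEmbedding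

theorem surf_restrict_of_subset_hyperplane {d : ℕ} {n : Pt d} (hn : ‖n‖ = 1) {b : ℝ}
    {S : Set (Pt d)} (hS : S ⊆ {x | inner ℝ n x = b}) :
    (surf d).restrict S = Measure.map (fun z : (ℝ ∙ n)ᗮ => b • n + (z : Pt d))
      (volume.restrict {z : (ℝ ∙ n)ᗮ | b • n + (z : Pt d) ∈ S}) := by
  rw [← Measure.restrict_restrict_of_subset hS, surf_restrict_hyperplane hn,
    (measurableEmbedding_hyperplaneChart n b).restrict_map]
  rfl

theorem surf_apply_of_subset_hyperplane {d : ℕ} {n : Pt d} (hn : ‖n‖ = 1) {b : ℝ}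
    {S : Set (Pt d)} (hS : S ⊆ {x | inner ℝ n x = b}) :
    surf d S = volume {z : (ℝ ∙ n)ᗮ | b • n + (z : Pt d) ∈ S} := by
  have h := congrArg (fun μ => μ Set.univ) (surf_restrict_of_subset_hyperplane hn hS)
  simp only [Measure.restrict_apply_univ] at h
  rw [h, (measurableEmbedding_hyperplaneChart n b).map_apply]
  simp

theorem setIntegral_surf {d : ℕ} {n : Pt d} (hn : ‖n‖ = 1) {b : ℝ}
    {S : Set (Pt d)} (hS : S ⊆ {x | inner ℝ n x = b}) (g : Pt d → ℝ) :
    ∫ x in S, g x ∂(surf d)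
      = ∫ z : (ℝ ∙ n)ᗮ in {z : (ℝ ∙ n)ᗮ | b • n + (z : Pt d) ∈ S}, g (b • n + (z : Pt d)) := by
  rw [surf_restrict_of_subset_hyperplane hn hS,
    (measurableEmbedding_hyperplaneChart n b).integral_map]

/-- The surface measure of a bounded subset of a hyperplane is finite. -/
theorem surf_lt_top {d : ℕ} {n : Pt d} (hn : ‖n‖ = 1) {b : ℝ}
    {S : Set (Pt d)} (hS : S ⊆ {x | inner ℝ n x = b}) (hb : Bornology.IsBounded S) :
    surf d S < ⊤ := by
  rw [surf_apply_of_subset_hyperplane hn hS]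
  refine Bornology.IsBounded.measure_lt_top ?_
  exact (isometry_hyperplaneChart n b).antilipschitz.isBounded_preimage hb

theorem eq_or_eq_neg_of_inner_eq_zero {d : ℕ} {n n' : Pt d} (hn : ‖n‖ = 1) (hn' : ‖n'‖ = 1)
    (h : ∀ z ∈ (ℝ ∙ n)ᗮ, inner ℝ n' z = 0) : n' = n ∨ n' = -n := by
  have hmem : n' ∈ (ℝ ∙ n) := by
    rw [← Submodule.orthogonal_orthogonal (ℝ ∙ n), Submodule.mem_orthogonal']
    exact h
  obtain ⟨a, rfl⟩ := Submodule.mem_span_singleton.1 hmem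
  rw [norm_smul, hn, mul_one, Real.norm_eq_abs] at hn'
  rcases (abs_eq zero_le_one).1 hn' with rfl | rfl
  · simp
  · simp

theorem volume_levelSet_eq_zero {E : Type*} [NormedAddCommGroup E] [InnerProductSpace ℝ E]
    [FiniteDimensional ℝ E] [MeasurableSpace E] [BorelSpace E] (f : E →ₗ[ℝ] ℝ) (hf : f ≠ 0)
    (a : ℝ) : volume {z | f z = a} = 0 := by
  have h := Measure.addHaar_affineSubspace (volume : Measure E)
    ((AffineSubspace.mk' a (⊥ : Submodule ℝ ℝ)).comap f.toAffineMap) (by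
      intro htop
      have h0 : ∀ z, f z = a := by
        intro z
        have : z ∈ ((AffineSubspace.mk' a (⊥ : Submodule ℝ ℝ)).comap f.toAffineMap) := by
          rw [htop]; trivial
        simpa [AffineSubspace.mem_mk', sub_eq_zero] using this
      have ha : a = 0 := by simpa using (h0 0).symm
      exact hf (LinearMap.ext fun z => by rw [h0 z, ha]; rfl))
  convert h using 2
  ext z
  simp [AffineSubspace.mem_mk', sub_eq_zero]

/-- Two non-parallel hyperplanes meet in a set of surface measure zero. -/
theorem surf_inter_hyperplane_eq_zero {d : ℕ} {n n' : Pt d} (hn : ‖n‖ = 1) (hn' : ‖n'‖ = 1)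
    (h1 : n' ≠ n) (h2 : n' ≠ -n) (b b' : ℝ) :
    surf d ({x | inner ℝ n x = b} ∩ {x | inner ℝ n' x = b'}) = 0 := by
  rw [surf_apply_of_subset_hyperplane hn Set.inter_subset_left]
  refine measure_mono_null ?_ (volume_levelSet_eq_zero
    ((innerSL ℝ n').toLinearMap ∘ₗ (ℝ ∙ n)ᗮ.subtype) ?_ (b' - b * inner ℝ n' n))
  · rintro z ⟨-, hz⟩
    simp only [Set.mem_ofPred_eq, inner_add_right, inner_smul_right] at hz
    simp only [Set.mem_ofPred_eq, LinearMap.comp_apply, Submodule.subtype_apply,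
      ContinuousLinearMap.coe_coe, innerSL_apply_apply]
    linarith
  · intro h0
    rcases eq_or_eq_neg_of_inner_eq_zero hn hn' (fun z hz => by
      simpa using LinearMap.congr_fun h0 ⟨z, hz⟩) with h | h
    exacts [h1 h, h2 h]

/-- Orthogonal coordinates adapted to a unit vector: `(t, z) ↦ t n + z` as a measurable
equivalence. -/
noncomputable def normalCoords {d : ℕ} (n : Pt d) (hn : ‖n‖ = 1) : ℝ × (ℝ ∙ n)ᗮ ≃ᵐ Pt d :=
  (MeasurableEquiv.prodCongr
    (LinearIsometryEquiv.toSpanUnitSingleton (𝕜 := ℝ) n hn).toHomeomorph.toMeasurableEquiv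
    (MeasurableEquiv.refl _)).trans ((ℝ ∙ n).measurableEquivProd (0 : Pt d)).symm

theorem normalCoords_apply {d : ℕ} (n : Pt d) (hn : ‖n‖ = 1) (q : ℝ × (ℝ ∙ n)ᗮ) :
    normalCoords n hn q = q.1 • n + (q.2 : Pt d) := by
  simp only [normalCoords, MeasurableEquiv.trans_apply, Submodule.measurableEquivProd_symm_apply,
    vadd_eq_add, add_zero]
  rfl

/-- Fubini in these coordinates separates the distance to a facet hyperplane from the position along
it. -/
theorem measurePreserving_normalCoords {d : ℕ} (n : Pt d) (hn : ‖n‖ = 1) :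
    MeasurePreserving (normalCoords n hn) := by
  have h := ((ℝ ∙ n).measurePreserving_measurableEquivProd (0 : Pt d)).symm
  rw [InnerProductSpace.euclideanHausdorffMeasure_eq_volume] at h
  refine MeasurePreserving.trans (MeasurePreserving.prod ?_ (MeasurePreserving.id _)) h
  exact (LinearIsometryEquiv.toSpanUnitSingleton (𝕜 := ℝ) n hn).measurePreserving

/-! ### Geometry of polytopes -/

namespace ConvexPolytope

variable {d : ℕ} (K : ConvexPolytope d)

theorem isClosed_carrier : IsClosed K.carrier := by
  have : K.carrier = ⋂ i, {x | inner ℝ (K.normal i) x ≤ K.offset i} := by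
    ext x; simp [carrier]
  rw [this]
  exact isClosed_iInter fun i => isClosed_le (by fun_prop) continuous_const

theorem isCompact_carrier : IsCompact K.carrier :=
  Metric.isCompact_of_isClosed_isBounded K.isClosed_carrier K.isBounded

theorem convex_carrier : Convex ℝ K.carrier := by
  intro x hx y hy a b ha hb hab i
  rw [inner_add_right, inner_smul_right, inner_smul_right]
  calc a * inner ℝ (K.normal i) x + b * inner ℝ (K.normal i) y
      ≤ a * K.offset i + b * K.offset i := by
        gcongr
        exacts [hx i, hy i]
    _ = K.offset i := by rw [← add_mul, hab, one_mul]

theorem inner_add_smul_normal (i : Fin K.numFacets) (x : Pt d) (s : ℝ) :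
    inner ℝ (K.normal i) (x + s • K.normal i) = inner ℝ (K.normal i) x + s := by
  rw [inner_add_right, inner_smul_right, real_inner_self_eq_norm_sq, K.norm_normal]
  ring

/-- A short move from an interior point along any normal stays in the polytope, so every constraint
is strict there. -/
theorem interior_carrier : interior K.carrier = {x | ∀ i, inner ℝ (K.normal i) x < K.offset i} := by
  apply Set.Subset.antisymm
  · intro x hx i
    obtain ⟨ε, hε, hball⟩ := Metric.isOpen_iff.1 isOpen_interior x hx
    have hmem : x + (ε / 2) • K.normal i ∈ K.carrier := by
      apply interior_subset
      apply hball
      rw [Metric.mem_ball, dist_eq_norm, add_sub_cancel_left, norm_smul, K.norm_normal, mul_one,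
        Real.norm_eq_abs, abs_of_pos (by positivity)]
      linarith
    have := hmem i
    rw [inner_add_smul_normal] at this
    linarith
  · apply interior_maximal
    · exact fun x hx i => (hx i).le
    · have : {x | ∀ i, inner ℝ (K.normal i) x < K.offset i}
          = ⋂ i, {x | inner ℝ (K.normal i) x < K.offset i} := by ext x; simp
      rw [this]
      exact isOpen_iInter_of_finite fun i => isOpen_lt (by fun_prop) continuous_const

theorem interior_carrier_nonempty : (interior K.carrier).Nonempty := K.interior_nonempty

theorem closure_interior : closure (interior K.carrier) = K.carrier := by
  rw [K.convex_carrier.closure_interior_eq_closure_of_nonempty_interior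
    K.interior_carrier_nonempty, K.isClosed_carrier.closure_eq]

theorem volume_frontier : volume (frontier K.carrier) = 0 :=
  K.convex_carrier.addHaar_frontier volume

theorem interior_ae_eq : (interior K.carrier : Set (Pt d)) =ᵐ[volume] K.carrier :=
  interior_ae_eq_of_null_frontier K.volume_frontier

theorem facet_subset_carrier (i : Fin K.numFacets) : K.facet i ⊆ K.carrier := fun _ hx => hx.1

theorem facet_subset_hyperplane (i : Fin K.numFacets) :
    K.facet i ⊆ {x | inner ℝ (K.normal i) x = K.offset i} := fun _ hx => hx.2

theorem isClosed_facet (i : Fin K.numFacets) : IsClosed (K.facet i) :=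
  K.isClosed_carrier.inter (isClosed_eq (by fun_prop) continuous_const)

theorem isCompact_facet (i : Fin K.numFacets) : IsCompact (K.facet i) :=
  K.isCompact_carrier.of_isClosed_subset (K.isClosed_facet i) (K.facet_subset_carrier i)

theorem measurableSet_facet (i : Fin K.numFacets) : MeasurableSet (K.facet i) :=
  (K.isClosed_facet i).measurableSet

theorem surf_facet_lt_top (i : Fin K.numFacets) : surf d (K.facet i) < ⊤ :=
  surf_lt_top (K.norm_normal i) (K.facet_subset_hyperplane i) (K.isCompact_facet i).isBounded

instance isFiniteMeasure_surf_facet (i : Fin K.numFacets) :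
    IsFiniteMeasure ((surf d).restrict (K.facet i)) :=
  ⟨by rw [Measure.restrict_apply_univ]; exact K.surf_facet_lt_top i⟩

theorem mem_facet_of_mem_carrier {x : Pt d} (hx : x ∈ K.carrier) (hx' : x ∉ interior K.carrier) :
    ∃ i, x ∈ K.facet i := by
  rw [interior_carrier] at hx'
  simp only [Set.mem_ofPred_eq, not_forall, not_lt] at hx'
  obtain ⟨i, hi⟩ := hx'
  exact ⟨i, hx, le_antisymm (hx i) hi⟩

theorem facet_nonempty (i : Fin K.numFacets) : (K.facet i).Nonempty := by
  obtain ⟨x, hx, h⟩ := K.facet_nondegenerate i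
  refine ⟨x, fun j => ?_, hx⟩
  by_cases hj : j = i
  · rw [hj, hx]
  · exact (h j hj).le

/-- Two different facets either have non-parallel normals or lie in disjoint hyperplanes. -/
theorem normal_ne_of_inner_eq {i j : Fin K.numFacets} (hij : j ≠ i) {x : Pt d}
    (hi : inner ℝ (K.normal i) x = K.offset i) (hj : inner ℝ (K.normal j) x = K.offset j) :
    K.normal j ≠ K.normal i ∧ K.normal j ≠ -K.normal i := by
  constructor
  -- Equal normals would force equal offsets, against a point of facet `i` strictly inside
  -- half-space `j`.
  · intro h
    obtain ⟨y, hy, hy'⟩ := K.facet_nondegenerate i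
    have h1 := hy' j hij
    rw [h, hy] at h1
    rw [h, hi] at hj
    linarith
  -- Opposite normals would confine the polytope to one hyperplane and leave it no interior.
  · intro h
    obtain ⟨y, hy⟩ := K.interior_carrier_nonempty
    rw [interior_carrier] at hy
    have h1 := hy i
    have h2 := hy j
    rw [h, inner_neg_left] at h2 hj
    linarith

theorem surf_inter_hyperplanes_eq_zero {i j : Fin K.numFacets} (hij : j ≠ i) :
    surf d ({x | inner ℝ (K.normal i) x = K.offset i}
      ∩ {x | inner ℝ (K.normal j) x = K.offset j}) = 0 := by
  rcases Set.eq_empty_or_nonempty ({x | inner ℝ (K.normal i) x = K.offset i}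
      ∩ {x | inner ℝ (K.normal j) x = K.offset j}) with h | ⟨x, hx, hx'⟩
  · rw [h, measure_empty]
  · obtain ⟨h1, h2⟩ := K.normal_ne_of_inner_eq hij hx hx'
    exact surf_inter_hyperplane_eq_zero (K.norm_normal i) (K.norm_normal j) h1 h2 _ _

end ConvexPolytope

/-! ### The divergence theorem on polytopes -/

/-- A smooth step function, equal to `0` on `(-∞, 1/2]` and to `1` on `[1, ∞)`. -/
noncomputable def step (s : ℝ) : ℝ := Real.smoothTransition (2 * s - 1)

theorem contDiff_step {n : ℕ∞} : ContDiff ℝ n step :=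
  Real.smoothTransition.contDiff.comp (by fun_prop)

theorem differentiable_step : Differentiable ℝ step :=
  (contDiff_step (n := 1)).differentiable (by simp)

theorem continuous_step : Continuous step := differentiable_step.continuous

theorem continuous_deriv_step : Continuous (deriv step) :=
  (contDiff_step (n := 1)).continuous_deriv (by simp)

theorem step_nonneg (s : ℝ) : 0 ≤ step s := Real.smoothTransition.nonneg _

theorem step_le_one (s : ℝ) : step s ≤ 1 := Real.smoothTransition.le_one _

theorem step_eq_zero {s : ℝ} (hs : s ≤ 1 / 2) : step s = 0 :=
  Real.smoothTransition.zero_of_nonpos (by linarith)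

theorem step_eq_one {s : ℝ} (hs : 1 ≤ s) : step s = 1 :=
  Real.smoothTransition.one_of_one_le (by linarith)

theorem deriv_step_eq_zero_of_lt {s : ℝ} (hs : s < 1 / 2) : deriv step s = 0 := by
  have : step =ᶠ[𝓝 s] fun _ => 0 := by
    filter_upwards [Iio_mem_nhds hs] with t ht using step_eq_zero (le_of_lt ht)
  rw [this.deriv_eq, deriv_const]

theorem deriv_step_eq_zero_of_gt {s : ℝ} (hs : 1 < s) : deriv step s = 0 := by
  have : step =ᶠ[𝓝 s] fun _ => 1 := by
    filter_upwards [Ioi_mem_nhds hs] with t ht using step_eq_one (le_of_lt ht)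
  rw [this.deriv_eq, deriv_const]

theorem support_deriv_step : Function.support (deriv step) ⊆ Set.Icc 0 1 := by
  intro s hs
  rw [Function.mem_support] at hs
  constructor
  · by_contra h
    exact hs (deriv_step_eq_zero_of_lt (by linarith))
  · by_contra h
    exact hs (deriv_step_eq_zero_of_gt (by linarith))

theorem exists_deriv_step_bound : ∃ C, 0 ≤ C ∧ ∀ s, |deriv step s| ≤ C := by
  obtain ⟨C, hC⟩ := isCompact_Icc.exists_bound_of_continuousOn (s := Set.Icc (0 : ℝ) 1)
    continuous_deriv_step.continuousOn
  refine ⟨max C 0, le_max_right _ _, fun s => ?_⟩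
  by_cases hs : s ∈ Set.Icc (0 : ℝ) 1
  · exact (hC s hs).trans (le_max_left _ _)
  · rw [Function.notMem_support.1 (fun h => hs (support_deriv_step h)), abs_zero]
    exact le_max_right _ _

/-- This total mass is the factor with which the boundary layers converge to surface measure. -/
theorem integral_deriv_step : ∫ s, deriv step s = 1 := by
  rw [← setIntegral_eq_integral_of_forall_compl_eq_zero (s := Set.Icc (0 : ℝ) 1)
    (fun s hs => Function.notMem_support.1 (fun h => hs (support_deriv_step h))),
    integral_Icc_eq_integral_Ioc, ← intervalIntegral.integral_of_le zero_le_one,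
    intervalIntegral.integral_deriv_eq_sub (fun x _ => differentiable_step x)
      (continuous_deriv_step.intervalIntegrable _ _),
    step_eq_one le_rfl, step_eq_zero (by norm_num)]
  norm_num

namespace ConvexPolytope

variable {d : ℕ} (K : ConvexPolytope d)

/-- The distance of `x` to the `i`-th facet hyperplane, counted positive inside. -/
noncomputable def slack (i : Fin K.numFacets) (x : Pt d) : ℝ := K.offset i - inner ℝ (K.normal i) x

@[fun_prop]
theorem continuous_slack (i : Fin K.numFacets) : Continuous (K.slack i) := by
  unfold slack; fun_prop

theorem hasFDerivAt_slack (i : Fin K.numFacets) (x : Pt d) :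
    HasFDerivAt (K.slack i) (-innerSL ℝ (K.normal i)) x :=
  ((innerSL ℝ (K.normal i)).hasFDerivAt).const_sub (K.offset i)

theorem mem_carrier_iff_slack {x : Pt d} : x ∈ K.carrier ↔ ∀ i, 0 ≤ K.slack i x := by
  simp [carrier, slack]

/-- A smooth cut-off function supported in the interior of the polytope. -/
noncomputable def cutoff (m : ℝ) (x : Pt d) : ℝ := ∏ i, step (m * K.slack i x)

/-- Minus the derivative of the cut-off function in direction of the `i`-th normal, as far as it
stems from the `i`-th facet. -/
noncomputable def layer (m : ℝ) (i : Fin K.numFacets) (x : Pt d) : ℝ :=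
  m * deriv step (m * K.slack i x) * ∏ j ∈ Finset.univ.erase i, step (m * K.slack j x)

theorem continuous_cutoff (m : ℝ) : Continuous (K.cutoff m) :=
  continuous_finsetProd _ fun _ _ => continuous_step.comp (by fun_prop)

theorem continuous_layer (m : ℝ) (i : Fin K.numFacets) : Continuous (K.layer m i) :=
  (continuous_const.mul (continuous_deriv_step.comp (by fun_prop))).mul
    (continuous_finsetProd _ fun _ _ => continuous_step.comp (by fun_prop))

theorem hasFDerivAt_cutoff (m : ℝ) (x : Pt d) :
    HasFDerivAt (K.cutoff m) (-∑ i, K.layer m i x • innerSL ℝ (K.normal i)) x := by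
  have h1 : ∀ i ∈ Finset.univ, HasFDerivAt (fun y => step (m * K.slack i y))
      (deriv step (m * K.slack i x) • (m • -innerSL ℝ (K.normal i))) x := fun i _ =>
    (differentiable_step _).hasDerivAt.comp_hasFDerivAt x ((K.hasFDerivAt_slack i x).const_mul m)
  have h2 := HasFDerivAt.finsetProd h1
  refine h2.congr_fderiv ?_
  rw [← Finset.sum_neg_distrib]
  refine Finset.sum_congr rfl fun i _ => ?_
  rw [layer]
  ext v
  simp only [smul_apply, neg_apply, smul_eq_mul]
  ring

/-- The compact subset of the interior that supports the cut-off function. -/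
def core (m : ℝ) : Set (Pt d) := {x | ∀ i, 1 / 2 ≤ m * K.slack i x}

theorem isClosed_core (m : ℝ) : IsClosed (K.core m) := by
  have : K.core m = ⋂ i, {x | 1 / 2 ≤ m * K.slack i x} := by ext x; simp [core]
  rw [this]
  exact isClosed_iInter fun i => isClosed_le continuous_const (by fun_prop)

theorem core_subset_interior {m : ℝ} (hm : 0 < m) : K.core m ⊆ interior K.carrier := by
  rw [interior_carrier]
  intro x hx i
  have h1 : 0 < m * K.slack i x := by linarith [hx i]
  have h2 := (pos_iff_pos_of_mul_pos h1).1 hm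
  rw [slack] at h2
  linarith

theorem isCompact_core {m : ℝ} (hm : 0 < m) : IsCompact (K.core m) :=
  K.isCompact_carrier.of_isClosed_subset (K.isClosed_core m)
    ((K.core_subset_interior hm).trans interior_subset)

theorem cutoff_eq_zero {m : ℝ} {x : Pt d} (hx : x ∉ K.core m) : K.cutoff m x = 0 := by
  simp only [core, Set.mem_ofPred_eq, not_forall, not_le] at hx
  obtain ⟨i, hi⟩ := hx
  exact Finset.prod_eq_zero (Finset.mem_univ i) (step_eq_zero hi.le)

theorem layer_eq_zero {m : ℝ} {i : Fin K.numFacets} {x : Pt d} (hx : x ∉ K.core m) :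
    K.layer m i x = 0 := by
  simp only [core, Set.mem_ofPred_eq, not_forall, not_le] at hx
  obtain ⟨j, hj⟩ := hx
  by_cases hij : j = i
  · rw [layer, ← hij, deriv_step_eq_zero_of_lt hj]
    ring
  · rw [layer, Finset.prod_eq_zero (Finset.mem_erase.2 ⟨hij, Finset.mem_univ j⟩)
      (step_eq_zero hj.le), mul_zero]

theorem cutoff_nonneg (m : ℝ) (x : Pt d) : 0 ≤ K.cutoff m x :=
  Finset.prod_nonneg fun _ _ => step_nonneg _

theorem cutoff_le_one (m : ℝ) (x : Pt d) : K.cutoff m x ≤ 1 :=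
  Finset.prod_le_one (fun _ _ => step_nonneg _) fun _ _ => step_le_one _

/-- The product is supported in a compact subset of the open polytope, so `g` needs no control near
the boundary. -/
theorem integrable_mul_of_core {m : ℝ} (hm : 0 < m) {f g : Pt d → ℝ} (hf : Continuous f)
    (hf0 : ∀ x, x ∉ K.core m → f x = 0) (hg : ContinuousOn g (interior K.carrier)) :
    Integrable (fun x => f x * g x) := by
  rw [← integrableOn_iff_integrable_of_support_subset (s := K.core m)]
  · exact (hf.continuousOn.mul (hg.mono (K.core_subset_interior hm))).integrableOn_compact
      (K.isCompact_core hm)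
  · intro x hx
    by_contra h
    exact hx (by simp [hf0 x h])

theorem tsupport_cutoff_subset {m : ℝ} (hm : 0 < m) :
    tsupport (K.cutoff m) ⊆ interior K.carrier := by
  refine subset_trans (closure_minimal ?_ (K.isClosed_core m)) (K.core_subset_interior hm)
  intro x hx
  by_contra h
  exact hx (K.cutoff_eq_zero h)

/-- Integration by parts over the whole space against a compactly supported cut-off has no boundary
term; the derivative of the cut-off supplies the layers. -/
theorem integral_cutoff_mul_divergence {m : ℝ} (hm : 0 < m) {F : Pt d → Pt d}
    (hF : ContDiffOn ℝ 1 F (interior K.carrier)) :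
    ∫ x, K.cutoff m x * divergence F x
      = ∑ i, ∫ x, K.layer m i x * inner ℝ (F x) (K.normal i) := by
  have hdiff : ∀ x ∈ interior K.carrier, DifferentiableAt ℝ F x := fun x hx =>
    (hF.differentiableOn (by simp)).differentiableAt (isOpen_interior.mem_nhds hx)
  have hcomp : ∀ e, ∀ x ∈ interior K.carrier, HasFDerivAt (fun y => F y e)
      ((EuclideanSpace.proj e : Pt d →L[ℝ] ℝ) ∘L fderiv ℝ F x) x := fun e x hx =>
    (EuclideanSpace.proj e : Pt d →L[ℝ] ℝ).hasFDerivAt.comp x (hdiff x hx).hasFDerivAt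
  have hcont : ∀ e, ContinuousOn (fun y => F y e) (interior K.carrier) := fun e x hx =>
    (hcomp e x hx).continuousAt.continuousWithinAt
  have hcont' : ∀ e : Fin d, ContinuousOn
      (fun x => fderiv ℝ F x (EuclideanSpace.single e 1) e) (interior K.carrier) := by
    intro e
    have h1 := hF.continuousOn_fderiv_of_isOpen isOpen_interior le_rfl
    exact (EuclideanSpace.proj e : Pt d →L[ℝ] ℝ).continuous.comp_continuousOn
      (h1.clm_apply continuousOn_const)
  have hint1 : ∀ e : Fin d, Integrable
      (fun x => K.cutoff m x * fderiv ℝ F x (EuclideanSpace.single e 1) e) := fun e =>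
    K.integrable_mul_of_core hm (K.continuous_cutoff m) (fun _ => K.cutoff_eq_zero) (hcont' e)
  have hint2 : ∀ i, ∀ e : Fin d, Integrable
      (fun x => K.layer m i x * K.normal i e * F x e) := fun i e =>
    K.integrable_mul_of_core hm ((K.continuous_layer m i).mul continuous_const)
      (fun x hx => by rw [K.layer_eq_zero hx, zero_mul]) (hcont e)
  have hfd : ∀ x, ∀ e : Fin d, (-∑ i, K.layer m i x • innerSL ℝ (K.normal i))
      (EuclideanSpace.single e (1 : ℝ)) = -∑ i, K.layer m i x * K.normal i e := by
    intro x e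
    simp [EuclideanSpace.inner_single_right]
  have hparts : ∀ e : Fin d, ∫ x, K.cutoff m x * fderiv ℝ F x (EuclideanSpace.single e 1) e
      = ∑ i, ∫ x, K.layer m i x * K.normal i e * F x e := by
    intro e
    have h := integral_bilinear_hasFDerivAt_right_eq_neg_left_of_integrable
      (μ := (volume : Measure (Pt d))) (B := ContinuousLinearMap.mul ℝ ℝ)
      (f := K.cutoff m) (f' := fun x => -∑ i, K.layer m i x • innerSL ℝ (K.normal i))
      (g := fun x => F x e)
      (g' := fun x => (EuclideanSpace.proj e : Pt d →L[ℝ] ℝ) ∘L fderiv ℝ F x)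
      (v := EuclideanSpace.single e 1) ?_ (hint1 e) ?_
      (fun x _ => K.hasFDerivAt_cutoff m x)
      (fun x hx => hcomp e x (K.tsupport_cutoff_subset hm hx))
    · refine h.trans ?_
      rw [← integral_neg, ← integral_finsetSum _ fun i _ => hint2 i e]
      refine integral_congr_ae (Eventually.of_forall fun x => ?_)
      simp only [hfd, ContinuousLinearMap.mul_apply', Finset.sum_mul, neg_mul, neg_neg]
    · simp only [hfd, ContinuousLinearMap.mul_apply', Finset.sum_mul, neg_mul]
      exact (integrable_finsetSum _ fun i _ => hint2 i e).neg
    · exact K.integrable_mul_of_core hm (K.continuous_cutoff m) (fun _ => K.cutoff_eq_zero)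
        (hcont e)
  simp only [divergence, Finset.mul_sum]
  rw [integral_finsetSum _ fun e _ => hint1 e, Finset.sum_congr rfl fun e _ => hparts e,
    Finset.sum_comm]
  refine Finset.sum_congr rfl fun i _ => ?_
  rw [← integral_finsetSum _ fun e _ => hint2 i e]
  refine integral_congr_ae (Eventually.of_forall fun x => ?_)
  simp only [PiLp.inner_apply, Finset.mul_sum]
  refine Finset.sum_congr rfl fun e _ => ?_
  simp only [RCLike.inner_apply, conj_trivial]
  ring

theorem tendsto_cutoff {x : Pt d} (hx : x ∈ interior K.carrier) :
    Tendsto (fun m : ℕ => K.cutoff (m + 1) x) atTop (𝓝 1) := by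
  rw [interior_carrier] at hx
  have h : ∀ i, ∀ᶠ m : ℕ in atTop, step (((m : ℝ) + 1) * K.slack i x) = 1 := by
    intro i
    have hpos : 0 < K.slack i x := sub_pos.2 (hx i)
    have ht : Tendsto (fun m : ℕ => ((m : ℝ) + 1) * K.slack i x) atTop atTop :=
      (tendsto_atTop_add_const_right _ _ tendsto_natCast_atTop_atTop).atTop_mul_const hpos
    filter_upwards [ht.eventually_ge_atTop 1] with m hm using step_eq_one hm
  refine tendsto_const_nhds.congr' ?_
  filter_upwards [eventually_all.2 h] with m hm
  exact (Finset.prod_eq_one fun i _ => hm i).symm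

/-- Dominated convergence with majorant |f|: the cut-offs tend to 1 in the interior, and the
frontier is null. -/
theorem tendsto_integral_cutoff_mul {f : Pt d → ℝ} (hf : IntegrableOn f K.carrier) :
    Tendsto (fun m : ℕ => ∫ x, K.cutoff (m + 1) x * f x) atTop (𝓝 (∫ x in K.carrier, f x)) := by
  have h1 : ∀ m : ℕ, ∫ x, K.cutoff (m + 1) x * f x
      = ∫ x in K.carrier, K.cutoff (m + 1) x * f x := by
    intro m
    refine (setIntegral_eq_integral_of_forall_compl_eq_zero fun x hx => ?_).symm
    rw [K.cutoff_eq_zero (fun h => hx (interior_subset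
      (K.core_subset_interior (by positivity) h))), zero_mul]
  simp only [h1]
  refine tendsto_integral_of_dominated_convergence (fun x => ‖f x‖)
    (fun m => (K.continuous_cutoff _).aestronglyMeasurable.mul hf.aestronglyMeasurable)
    hf.norm (fun m => Eventually.of_forall fun x => ?_) ?_
  · rw [norm_mul, Real.norm_eq_abs, abs_of_nonneg (K.cutoff_nonneg _ _)]
    exact mul_le_of_le_one_left (norm_nonneg _) (K.cutoff_le_one _ _)
  · have h2 : ∀ᵐ x ∂(volume.restrict K.carrier), x ∈ interior K.carrier := by
      rw [← Measure.restrict_congr_set K.interior_ae_eq]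
      exact ae_restrict_mem isOpen_interior.measurableSet
    filter_upwards [h2] with x hx
    simpa using (K.tendsto_cutoff hx).mul_const (f x)

end ConvexPolytope

/-! ### Convergence of the boundary layers to surface integrals -/

namespace ConvexPolytope

variable {d : ℕ} (K : ConvexPolytope d)

/-- The integrand of `∫ layer * g` in the rescaled normal coordinates of the `i`-th facet. -/
noncomputable def layerCoords (i : Fin K.numFacets) (g : Pt d → ℝ) (m : ℝ)
    (q : ℝ × (ℝ ∙ K.normal i)ᗮ) : ℝ :=
  deriv step q.1 * (∏ j ∈ Finset.univ.erase i,
      step (m * K.slack j ((K.offset i - m⁻¹ * q.1) • K.normal i + (q.2 : Pt d))))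
    * g ((K.offset i - m⁻¹ * q.1) • K.normal i + (q.2 : Pt d))

theorem slack_normalCoords (i : Fin K.numFacets) (t : ℝ) (z : (ℝ ∙ K.normal i)ᗮ) :
    K.slack i (t • K.normal i + (z : Pt d)) = K.offset i - t := by
  rw [slack, inner_normal_add (K.norm_normal i)]

theorem continuous_layerCoords (i : Fin K.numFacets) {g : Pt d → ℝ} (hg : Continuous g) (m : ℝ) :
    Continuous (K.layerCoords i g m) := by
  unfold layerCoords
  have hx : Continuous fun q : ℝ × (ℝ ∙ K.normal i)ᗮ =>
      (K.offset i - m⁻¹ * q.1) • K.normal i + (q.2 : Pt d) := by fun_prop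
  refine ((continuous_deriv_step.comp continuous_fst).mul ?_).mul (hg.comp hx)
  exact continuous_finsetProd _ fun j _ =>
    continuous_step.comp (continuous_const.mul ((K.continuous_slack j).comp hx))

/-- A nonzero integrand forces 0 ≤ s ≤ 1 and puts the point into the polytope, where `g` and the
tangential coordinate are bounded. Uniformity in `m` is what dominated convergence needs. -/
theorem exists_layerCoords_bound (i : Fin K.numFacets) {g : Pt d → ℝ} (hg : Continuous g) :
    ∃ C R : ℝ, ∀ m : ℝ, 0 < m → ∀ q, ‖K.layerCoords i g m q‖
      ≤ (Set.Icc (0 : ℝ) 1 ×ˢ Metric.closedBall (0 : (ℝ ∙ K.normal i)ᗮ) R).indicator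
          (fun _ => C) q := by
  obtain ⟨C₁, hC₁, hb₁⟩ := exists_deriv_step_bound
  obtain ⟨C₂, hb₂⟩ := K.isCompact_carrier.exists_bound_of_continuousOn hg.continuousOn
  obtain ⟨R, hR⟩ := K.isCompact_carrier.isBounded.exists_norm_le
  refine ⟨C₁ * C₂, R + R, fun m hm q => ?_⟩
  by_cases h0 : K.layerCoords i g m q = 0
  · rw [h0, norm_zero]
    refine Set.indicator_nonneg (fun _ _ => mul_nonneg hC₁ ?_) _
    obtain ⟨x, hx⟩ := K.facet_nonempty i
    exact (norm_nonneg _).trans (hb₂ x hx.1)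
  · set x : Pt d := (K.offset i - m⁻¹ * q.1) • K.normal i + (q.2 : Pt d) with hx
    have hne : deriv step q.1 ≠ 0 ∧ (∏ j ∈ Finset.univ.erase i, step (m * K.slack j x)) ≠ 0 := by
      constructor <;> intro h <;> apply h0 <;> simp only [layerCoords, ← hx, h] <;> ring
    have hq1 : q.1 ∈ Set.Icc (0 : ℝ) 1 := support_deriv_step hne.1
    have hxK : x ∈ K.carrier := by
      rw [mem_carrier_iff_slack]
      intro j
      by_cases hj : j = i
      · rw [hj, hx, slack_normalCoords]
        have : 0 ≤ m⁻¹ * q.1 := mul_nonneg (inv_nonneg.2 hm.le) hq1.1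
        linarith
      · by_contra hneg
        refine Finset.prod_ne_zero_iff.1 hne.2 j (Finset.mem_erase.2 ⟨hj, Finset.mem_univ j⟩)
          (step_eq_zero ?_)
        have := mul_neg_of_pos_of_neg hm (not_le.1 hneg)
        linarith
    -- The tangential part is x minus its normal component, each of norm at most R.
    have hq2 : ‖q.2‖ ≤ R + R := by
      have h1 : (q.2 : Pt d) = x - inner ℝ (K.normal i) x • K.normal i := by
        rw [hx, inner_normal_add (K.norm_normal i)]
        abel
      have h2 : |inner ℝ (K.normal i) x| ≤ ‖x‖ := by
        have := abs_real_inner_le_norm (K.normal i) x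
        rwa [K.norm_normal, one_mul] at this
      calc ‖q.2‖ = ‖(q.2 : Pt d)‖ := rfl
        _ ≤ ‖x‖ + ‖inner ℝ (K.normal i) x • K.normal i‖ := by rw [h1]; exact norm_sub_le _ _
        _ ≤ R + R := by
          rw [norm_smul, K.norm_normal, mul_one, Real.norm_eq_abs]
          linarith [hR x hxK]
    rw [Set.indicator_of_mem (Set.mk_mem_prod hq1 (by simpa using hq2))]
    have hprod : |∏ j ∈ Finset.univ.erase i, step (m * K.slack j x)| ≤ 1 := by
      rw [abs_of_nonneg (Finset.prod_nonneg fun _ _ => step_nonneg _)]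
      exact Finset.prod_le_one (fun _ _ => step_nonneg _) fun _ _ => step_le_one _
    rw [layerCoords, ← hx, norm_mul, norm_mul]
    calc ‖deriv step q.1‖ * ‖∏ j ∈ Finset.univ.erase i, step (m * K.slack j x)‖ * ‖g x‖
        ≤ C₁ * 1 * C₂ := by
          gcongr
          exacts [hb₁ _, hprod, hb₂ x hxK]
      _ = C₁ * C₂ := by ring

theorem integrable_layerCoords_bound (i : Fin K.numFacets) (C R : ℝ) :
    Integrable ((Set.Icc (0 : ℝ) 1 ×ˢ Metric.closedBall (0 : (ℝ ∙ K.normal i)ᗮ) R).indicator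
      (fun _ => C)) (volume.prod volume) := by
  refine (integrable_indicator_iff (measurableSet_Icc.prod Metric.isClosed_closedBall.measurableSet)).2
    (integrableOn_const ?_)
  rw [Measure.prod_prod]
  exact (ENNReal.mul_lt_top (by simp)
    (ProperSpace.isCompact_closedBall _ _).measure_lt_top).ne

theorem integrable_layerCoords (i : Fin K.numFacets) {g : Pt d → ℝ} (hg : Continuous g) {m : ℝ}
    (hm : 0 < m) : Integrable (K.layerCoords i g m) (volume.prod volume) := by
  obtain ⟨C, R, hb⟩ := K.exists_layerCoords_bound i hg
  exact (K.integrable_layerCoords_bound i C R).mono'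
    (K.continuous_layerCoords i hg m).aestronglyMeasurable (Eventually.of_forall (hb m hm))

/-- The substitution t = b_i − s/m stretches the layer of thickness 1/m to unit thickness, and its
Jacobian cancels the factor m in `layer`. -/
theorem integral_layer_mul (i : Fin K.numFacets) {g : Pt d → ℝ} (hg : Continuous g) {m : ℝ}
    (hm : 0 < m) :
    ∫ x, K.layer m i x * g x = ∫ q, K.layerCoords i g m q ∂(volume.prod volume) := by
  have hn := K.norm_normal i
  have hint : Integrable (fun x => K.layer m i x * g x) :=
    K.integrable_mul_of_core hm (K.continuous_layer m i) (fun _ => K.layer_eq_zero)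
      hg.continuousOn
  have hmp := measurePreserving_normalCoords (K.normal i) hn
  rw [← hmp.integral_comp', Measure.volume_eq_prod,
    integral_prod_symm (fun q => K.layer m i (normalCoords (K.normal i) hn q)
      * g (normalCoords (K.normal i) hn q)) ((hmp.integrable_comp_emb (normalCoords _ hn).measurableEmbedding).2 hint),
    integral_prod_symm _ (K.integrable_layerCoords i hg hm)]
  refine integral_congr_ae (Eventually.of_forall fun z => ?_)
  simp only [normalCoords_apply]
  set f : ℝ → ℝ := fun t => K.layer m i (t • K.normal i + (z : Pt d))
    * g (t • K.normal i + (z : Pt d)) with hf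
  have h1 : ∫ s, f (K.offset i - m⁻¹ * s) = m * ∫ t, f t := by
    have := Measure.integral_comp_mul_left (fun t => f (K.offset i - t)) m⁻¹
    rw [this, inv_inv, abs_of_pos hm, smul_eq_mul, integral_sub_left_eq_self f volume]
  have h2 : ∀ s, K.layerCoords i g m (s, z) = m⁻¹ * f (K.offset i - m⁻¹ * s) := by
    intro s
    simp only [hf, layer, layerCoords, slack_normalCoords]
    have : m * (K.offset i - (K.offset i - m⁻¹ * s)) = s := by field_simp; ring
    rw [this]
    field_simp
  simp only [h2]
  rw [integral_const_mul, h1, ← mul_assoc, inv_mul_cancel₀ hm.ne', one_mul]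

/-- On the excluded null set the factors of the other facets need not tend to 0 or 1. -/
theorem ae_slack_ne_zero (i : Fin K.numFacets) :
    ∀ᵐ z : (ℝ ∙ K.normal i)ᗮ, ∀ j, j ≠ i →
      K.slack j (K.offset i • K.normal i + (z : Pt d)) ≠ 0 := by
  rw [ae_all_iff]
  intro j
  by_cases hj : j = i
  · exact Eventually.of_forall fun z h => absurd hj h
  · have h := K.surf_inter_hyperplanes_eq_zero hj
    rw [surf_apply_of_subset_hyperplane (K.norm_normal i) Set.inter_subset_left] at h
    rw [ae_iff]
    refine measure_mono_null (fun z hz => ?_) h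
    simp only [ne_eq, Classical.not_imp, not_not, Set.mem_ofPred_eq, slack, sub_eq_zero] at hz
    exact ⟨inner_normal_add (K.norm_normal i) _ z, hz.2.symm⟩

/-- The argument of the step is (m + 1)a plus a term independent of m, so for a ≠ 0 it eventually
leaves the transition zone. -/
theorem tendsto_step_slack (i j : Fin K.numFacets) (s : ℝ) (z : (ℝ ∙ K.normal i)ᗮ)
    (hpos : K.slack j (K.offset i • K.normal i + (z : Pt d)) ≠ 0) :
    ∀ᶠ m : ℕ in atTop, step (((m : ℝ) + 1) * K.slack j
      ((K.offset i - ((m : ℝ) + 1)⁻¹ * s) • K.normal i + (z : Pt d)))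
      = if 0 < K.slack j (K.offset i • K.normal i + (z : Pt d)) then 1 else 0 := by
  set a := K.slack j (K.offset i • K.normal i + (z : Pt d)) with ha
  have heq : ∀ m : ℕ, ((m : ℝ) + 1) * K.slack j
      ((K.offset i - ((m : ℝ) + 1)⁻¹ * s) • K.normal i + (z : Pt d))
      = ((m : ℝ) + 1) * a + s * inner ℝ (K.normal j) (K.normal i) := by
    intro m
    have hm : (m : ℝ) + 1 ≠ 0 := by positivity
    simp only [ha, slack, inner_add_right, inner_smul_right]
    field_simp
    ring
  simp only [heq]
  have ht : Tendsto (fun m : ℕ => (m : ℝ) + 1) atTop atTop :=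
    tendsto_atTop_add_const_right _ _ tendsto_natCast_atTop_atTop
  rcases lt_or_gt_of_ne hpos with h | h
  · rw [if_neg (not_lt.2 h.le)]
    have h1 : Tendsto (fun m : ℕ => ((m : ℝ) + 1) * a + s * inner ℝ (K.normal j) (K.normal i))
        atTop atBot := tendsto_atBot_add_const_right _ _ (ht.atTop_mul_const_of_neg h)
    filter_upwards [h1.eventually_le_atBot (1 / 2)] with m hm using step_eq_zero hm
  · rw [if_pos h]
    have h1 : Tendsto (fun m : ℕ => ((m : ℝ) + 1) * a + s * inner ℝ (K.normal j) (K.normal i))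
        atTop atTop := tendsto_atTop_add_const_right _ _ (ht.atTop_mul_const h)
    filter_upwards [h1.eventually_ge_atTop 1] with m hm using step_eq_one hm

theorem tendsto_layerCoords (i : Fin K.numFacets) {g : Pt d → ℝ} (hg : Continuous g) (s : ℝ)
    (z : (ℝ ∙ K.normal i)ᗮ)
    (hz : ∀ j, j ≠ i → K.slack j (K.offset i • K.normal i + (z : Pt d)) ≠ 0) :
    Tendsto (fun m : ℕ => K.layerCoords i g (m + 1) (s, z)) atTop
      (𝓝 (deriv step s *
        Set.indicator {z : (ℝ ∙ K.normal i)ᗮ | K.offset i • K.normal i + (z : Pt d) ∈ K.facet i} (fun z => g (K.offset i • K.normal i + (z : Pt d))) z)) := by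
  set y : Pt d := K.offset i • K.normal i + (z : Pt d) with hy
  have hyi : inner ℝ (K.normal i) y = K.offset i := inner_normal_add (K.norm_normal i) _ z
  have hprod : ∀ᶠ m : ℕ in atTop, (∏ j ∈ Finset.univ.erase i, step (((m : ℝ) + 1) * K.slack j
      ((K.offset i - ((m : ℝ) + 1)⁻¹ * s) • K.normal i + (z : Pt d))))
      = ∏ j ∈ Finset.univ.erase i, if 0 < K.slack j y then (1 : ℝ) else 0 := by
    have h1 : ∀ j, ∀ᶠ m : ℕ in atTop, j ≠ i → step (((m : ℝ) + 1) * K.slack j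
        ((K.offset i - ((m : ℝ) + 1)⁻¹ * s) • K.normal i + (z : Pt d)))
        = if 0 < K.slack j y then 1 else 0 := by
      intro j
      by_cases hj : j = i
      · exact Eventually.of_forall fun m h => absurd hj h
      · filter_upwards [K.tendsto_step_slack i j s z (hz j hj)] with m hm _ using hm
    filter_upwards [eventually_all.2 h1] with m hm
    exact Finset.prod_congr rfl fun j hj => hm j (Finset.ne_of_mem_erase hj)
  have hlim : Tendsto (fun m : ℕ => g ((K.offset i - ((m : ℝ) + 1)⁻¹ * s) • K.normal i
      + (z : Pt d))) atTop (𝓝 (g y)) := by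
    have h2 : Continuous fun t : ℝ => g ((K.offset i - t * s) • K.normal i + (z : Pt d)) := by
      fun_prop
    have h3 := (h2.tendsto 0).comp (tendsto_inv_atTop_zero.comp
      (tendsto_atTop_add_const_right _ (1 : ℝ) tendsto_natCast_atTop_atTop))
    simpa [hy, Function.comp_def] using h3
  -- By `hz` no other slack vanishes, so on the i-th hyperplane positivity of all other slacks is
  -- the same as membership in the facet.
  have hind : Set.indicator
      {z : (ℝ ∙ K.normal i)ᗮ | K.offset i • K.normal i + (z : Pt d) ∈ K.facet i} (fun z => g (K.offset i • K.normal i + (z : Pt d))) z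
      = (∏ j ∈ Finset.univ.erase i, if 0 < K.slack j y then (1 : ℝ) else 0) * g y := by
    by_cases h : y ∈ K.facet i
    · rw [Set.indicator_of_mem (by exact h), Finset.prod_eq_one, one_mul]
      intro j hj
      have h4 := K.mem_carrier_iff_slack.1 h.1 j
      exact if_pos (lt_of_le_of_ne h4 (hz j (Finset.ne_of_mem_erase hj)).symm)
    · rw [Set.indicator_of_notMem (by exact h)]
      have : ∃ j, j ≠ i ∧ ¬ 0 < K.slack j y := by
        by_contra! hcon
        refine h ⟨K.mem_carrier_iff_slack.2 fun j => ?_, hyi⟩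
        by_cases hj : j = i
        · rw [hj, slack, hyi, sub_self]
        · exact (hcon j hj).le
      obtain ⟨j, hj, hj'⟩ := this
      rw [Finset.prod_eq_zero (Finset.mem_erase.2 ⟨hj, Finset.mem_univ j⟩) (if_neg hj'), zero_mul]
  rw [hind, ← mul_assoc]
  refine Tendsto.mul ?_ hlim
  refine tendsto_const_nhds.congr' ?_
  filter_upwards [hprod] with m hm
  rw [hm]

/-- The limit integrand separates into `deriv step`, of integral 1, and `g` restricted to the facet.
-/
theorem tendsto_integral_layer_mul (i : Fin K.numFacets) {g : Pt d → ℝ} (hg : Continuous g) :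
    Tendsto (fun m : ℕ => ∫ x, K.layer (m + 1) i x * g x) atTop
      (𝓝 (∫ x in K.facet i, g x ∂(surf d))) := by
  have hmeas : MeasurableSet
      {z : (ℝ ∙ K.normal i)ᗮ | K.offset i • K.normal i + (z : Pt d) ∈ K.facet i} :=
    (measurableEmbedding_hyperplaneChart (K.normal i) (K.offset i)).measurable
      (K.measurableSet_facet i)
  rw [setIntegral_surf (K.norm_normal i) (K.facet_subset_hyperplane i), ← integral_indicator hmeas]
  have hprod := integral_prod_mul (μ := (volume : Measure ℝ))
    (ν := (volume : Measure (ℝ ∙ K.normal i)ᗮ)) (deriv step)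
    (Set.indicator {z : (ℝ ∙ K.normal i)ᗮ | K.offset i • K.normal i + (z : Pt d) ∈ K.facet i}
      (fun z => g (K.offset i • K.normal i + (z : Pt d))))
  rw [integral_deriv_step, one_mul] at hprod
  rw [← hprod]
  obtain ⟨C, R, hb⟩ := K.exists_layerCoords_bound i hg
  have hpos : ∀ m : ℕ, (0 : ℝ) < m + 1 := fun m => by positivity
  simp only [fun m : ℕ => K.integral_layer_mul i hg (hpos m)]
  refine tendsto_integral_of_dominated_convergence _
    (fun m => (K.continuous_layerCoords i hg _).aestronglyMeasurable)
    (K.integrable_layerCoords_bound i C R)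
    (fun m => Eventually.of_forall (hb _ (hpos m))) ?_
  filter_upwards [Measure.quasiMeasurePreserving_snd.ae (K.ae_slack_ne_zero i)] with q hq
  exact K.tendsto_layerCoords i hg q.1 q.2 hq

/-- **Divergence theorem** on a convex polytope, for fields that are continuous on the closed
polytope and continuously differentiable in its interior. -/
theorem integral_divergence {F : Pt d → Pt d} (hc : ContinuousOn F K.carrier)
    (hF : ContDiffOn ℝ 1 F (interior K.carrier)) (hint : IntegrableOn (divergence F) K.carrier) :
    ∫ x in K.carrier, divergence F x
      = K.bdryIntegral (fun i x => inner ℝ (F x) (K.normal i)) := by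
  -- Tietze extension: the layer limits are stated for functions continuous on the whole space,
  -- while `F` is continuous only on the polytope.
  obtain ⟨G, hG⟩ := ContinuousMap.exists_restrict_eq K.isClosed_carrier
    ⟨K.carrier.domRestrict F, hc.domRestrict⟩
  have hGF : ∀ x ∈ K.carrier, G x = F x := fun x hx => DFunLike.congr_fun hG ⟨x, hx⟩
  refine tendsto_nhds_unique (K.tendsto_integral_cutoff_mul hint) ?_
  have hpos : ∀ m : ℕ, (0 : ℝ) < m + 1 := fun m => by positivity
  have h1 : ∀ m : ℕ, ∫ x, K.cutoff (m + 1) x * divergence F x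
      = ∑ i, ∫ x, K.layer (m + 1) i x * inner ℝ (G x) (K.normal i) := by
    intro m
    rw [K.integral_cutoff_mul_divergence (hpos m) hF]
    refine Finset.sum_congr rfl fun i _ => integral_congr_ae (Eventually.of_forall fun x => ?_)
    by_cases hx : x ∈ K.core (m + 1)
    · simp only [hGF x (interior_subset (K.core_subset_interior (hpos m) hx))]
    · simp only [K.layer_eq_zero hx, zero_mul]
  simp only [h1]
  refine tendsto_finsetSum _ fun i _ => ?_
  have h2 : ∫ x in K.facet i, inner ℝ (F x) (K.normal i) ∂(surf d)
      = ∫ x in K.facet i, inner ℝ (G x) (K.normal i) ∂(surf d) :=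
    setIntegral_congr_fun (K.measurableSet_facet i) fun x hx => by simp only [hGF x hx.1]
  rw [h2]
  exact K.tendsto_integral_layer_mul i (by fun_prop)

end ConvexPolytope

/-! ### Sharp trace inequalities for polynomials in one variable -/

section OneVariable

open Polynomial

/-- The nodes `-(k + d)`, `k ≤ p`. -/
def traceNode (d : ℕ) (k : ℕ) : ℝ := -((k : ℝ) + d)

/-- `∏ (X + k + d) - ∏ (X - m)`, `k` and `m` running over `0, …, p`. -/
noncomputable def traceDiff (p d : ℕ) : ℝ[X] :=
  Lagrange.nodal (Finset.range (p + 1)) (traceNode d)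
    - Lagrange.nodal (Finset.range (p + 1)) (fun m : ℕ => (m : ℝ))

/-- The coefficients of the polynomial that represents evaluation at `1` with respect to the inner
product `∫₀¹ t^(d-1) f g`. -/
noncomputable def traceCoeff (p d k : ℕ) : ℝ :=
  (traceDiff p d).eval (traceNode d k)
    / ∏ j ∈ (Finset.range (p + 1)).erase k, (traceNode d k - traceNode d j)

theorem traceNode_injOn (p d : ℕ) : Set.InjOn (traceNode d) (Finset.range (p + 1)) := by
  intro a _ b _ h
  simpa [traceNode] using h

theorem degree_traceDiff_lt (p d : ℕ) :
    (traceDiff p d).degree < (Finset.range (p + 1)).card := by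
  have h := Polynomial.degree_sub_lt_left
    (p := Lagrange.nodal (Finset.range (p + 1)) (traceNode d))
    (q := Lagrange.nodal (Finset.range (p + 1)) (fun m : ℕ => (m : ℝ)))
    (by rw [Lagrange.degree_nodal, Lagrange.degree_nodal]) Lagrange.nodal_ne_zero
    (by rw [Lagrange.nodal_monic.leadingCoeff, Lagrange.nodal_monic.leadingCoeff])
  rwa [Lagrange.degree_nodal] at h

/-- Summing these quotients over the nodes extracts the coefficient of X^p in `traceDiff`, which by
Vieta is Σ(k + d) + Σm. -/
theorem sum_traceCoeff (p d : ℕ) :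
    ∑ k ∈ Finset.range (p + 1), traceCoeff p d k = ((p : ℝ) + 1) * (p + d) := by
  have h := Lagrange.coeff_eq_sum (traceNode_injOn p d) (degree_traceDiff_lt p d)
  have hc : 0 < (Finset.range (p + 1)).card := by simp
  simp only [traceCoeff]
  rw [← h, traceDiff, coeff_sub, Lagrange.nodal_eq, Lagrange.nodal_eq,
    prod_X_sub_C_coeff_card_pred _ _ hc, prod_X_sub_C_coeff_card_pred _ _ hc]
  have hs : (∑ i ∈ Finset.range (p + 1), (i : ℝ)) * 2 = (p + 1) * p := by
    have := Finset.sum_range_id_mul_two (p + 1)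
    have h2 : (((∑ i ∈ Finset.range (p + 1), i) * 2 : ℕ) : ℝ) = (((p + 1) * (p + 1 - 1) : ℕ) : ℝ) := by
      rw [this]
    push_cast at h2
    simpa using h2
  simp only [traceNode, Finset.sum_neg_distrib, Finset.sum_add_distrib, Finset.sum_const,
    Finset.card_range, nsmul_eq_mul]
  push_cast
  linarith

/-- Partial fractions: 1 − Σ c_k/(x + k + d) = ∏(x − m)/∏(x + k + d), and the right side vanishes at
x = 0, …, p. These equations say that Σ c_k t^k integrates against t^(d−1) t^m to 1. -/
theorem sum_traceCoeff_div (p : ℕ) {d : ℕ} (hd : 1 ≤ d) {m : ℕ} (hm : m ≤ p) :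
    ∑ k ∈ Finset.range (p + 1), traceCoeff p d k / ((m : ℝ) + k + d) = 1 := by
  have hd' : (1 : ℝ) ≤ d := by exact_mod_cast hd
  have hne : ∀ k ∈ Finset.range (p + 1), (m : ℝ) ≠ traceNode d k := by
    intro k _ h
    rw [traceNode] at h
    have h1 : (0 : ℝ) ≤ m := by positivity
    have h2 : (0 : ℝ) ≤ k := by positivity
    linarith
  have h1 := Lagrange.eq_interpolate (traceNode_injOn p d) (degree_traceDiff_lt p d)
  have h2 := congrArg (fun P => P.eval (m : ℝ)) h1
  rw [Lagrange.eval_interpolate_not_at_node _ hne, traceDiff, eval_sub,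
    Lagrange.eval_nodal_at_node (v := fun m : ℕ => (m : ℝ)) (i := m)
      (Finset.mem_range.2 (by omega)), sub_zero] at h2
  have hnz : (Lagrange.nodal (Finset.range (p + 1)) (traceNode d)).eval (m : ℝ) ≠ 0 :=
    Lagrange.eval_nodal_not_at_node hne
  have h3 := mul_left_cancel₀ hnz ((mul_one _).trans h2)
  rw [h3]
  refine Finset.sum_congr rfl fun k _ => ?_
  rw [traceCoeff, Lagrange.nodalWeight, traceDiff]
  simp only [traceNode, Finset.prod_inv_distrib]
  rw [div_eq_mul_inv, div_eq_mul_inv]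
  have : (m : ℝ) - -((k : ℝ) + d) = m + k + d := by ring
  rw [this]
  ring

/-- At the node −1 the numerator has modulus (p + 1)! and the denominator p!. The value controls the
interaction of the two end points of an interval. -/
theorem abs_traceCoeff_zero (p : ℕ) : |traceCoeff p 1 0| = (p : ℝ) + 1 := by
  have hmem : 0 ∈ Finset.range (p + 1) := by simp
  rw [traceCoeff, traceDiff, eval_sub, Lagrange.eval_nodal_at_node hmem, zero_sub,
    Lagrange.eval_nodal, abs_div, abs_neg, Finset.abs_prod, Finset.abs_prod]
  have h1 : ∏ i ∈ Finset.range (p + 1), |traceNode 1 0 - (i : ℝ)| = ((p + 1).factorial : ℝ) := by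
    rw [← Finset.prod_range_add_one_eq_factorial]
    push_cast
    refine Finset.prod_congr rfl fun i _ => ?_
    rw [traceNode, abs_of_nonpos]
    · push_cast; ring
    · have : (0 : ℝ) ≤ i := by positivity
      push_cast; linarith
  have h2 : ∏ j ∈ (Finset.range (p + 1)).erase 0, |traceNode 1 0 - traceNode 1 j|
      = (p.factorial : ℝ) := by
    have : (Finset.range (p + 1)).erase 0 = (Finset.range p).image (· + 1) := by
      ext j
      simp only [Finset.mem_erase, Finset.mem_range, Finset.mem_image]
      constructor
      · rintro ⟨h, h'⟩; exact ⟨j - 1, by omega, by omega⟩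
      · rintro ⟨a, ha, rfl⟩; omega
    rw [this, Finset.prod_image (by intro a _ b _ h; simpa using h),
      ← Finset.prod_range_add_one_eq_factorial]
    push_cast
    refine Finset.prod_congr rfl fun i _ => ?_
    rw [traceNode, traceNode, abs_of_nonneg]
    · push_cast; ring
    · have : (0 : ℝ) ≤ i := by positivity
      push_cast; linarith
  rw [h1, h2, Nat.factorial_succ]
  push_cast
  field_simp

/-- The polynomial that represents evaluation at `1`. -/
noncomputable def tracePoly (p d : ℕ) : ℝ[X] :=
  ∑ k ∈ Finset.range (p + 1), C (traceCoeff p d k) * X ^ k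

theorem eval_tracePoly (p d : ℕ) (t : ℝ) :
    (tracePoly p d).eval t = ∑ k ∈ Finset.range (p + 1), traceCoeff p d k * t ^ k := by
  simp [tracePoly, eval_finsetSum]

theorem natDegree_tracePoly_le (p d : ℕ) : (tracePoly p d).natDegree ≤ p := by
  refine natDegree_sum_le_of_forall_le _ _ fun k hk => ?_
  exact (natDegree_C_mul_X_pow_le _ _).trans (Nat.lt_succ_iff.1 (Finset.mem_range.1 hk))

theorem eval_one_tracePoly (p d : ℕ) : (tracePoly p d).eval 1 = ((p : ℝ) + 1) * (p + d) := by
  simp [eval_tracePoly, sum_traceCoeff]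

theorem eval_zero_tracePoly (p d : ℕ) : (tracePoly p d).eval 0 = traceCoeff p d 0 := by
  rw [eval_tracePoly, Finset.sum_eq_single 0]
  · simp
  · intro k _ hk; simp [hk]
  · simp

/-- On a monomial t^m the integral is Σ c_k/(m + k + d) = 1, the value of t^m at 1. -/
theorem integral_mul_tracePoly (p : ℕ) {d : ℕ} (hd : 1 ≤ d) {q : ℝ[X]} (hq : q.natDegree ≤ p) :
    ∫ t in (0 : ℝ)..1, t ^ (d - 1) * (q.eval t * (tracePoly p d).eval t) = q.eval 1 := by
  have hexp : ∀ t : ℝ, t ^ (d - 1) * (q.eval t * (tracePoly p d).eval t)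
      = ∑ m ∈ Finset.range (p + 1), ∑ k ∈ Finset.range (p + 1),
          q.coeff m * traceCoeff p d k * t ^ (m + k + (d - 1)) := by
    intro t
    rw [eval_tracePoly, eval_eq_sum_range' (n := p + 1) (by omega), Finset.sum_mul_sum,
      Finset.mul_sum]
    refine Finset.sum_congr rfl fun m _ => ?_
    rw [Finset.mul_sum]
    refine Finset.sum_congr rfl fun k _ => ?_
    rw [pow_add, pow_add]
    ring
  simp only [hexp]
  rw [intervalIntegral.integral_finsetSum fun m _ => Continuous.intervalIntegrable (by fun_prop) _ _]
  rw [eval_eq_sum_range' (n := p + 1) (by omega)]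
  refine Finset.sum_congr rfl fun m hm => ?_
  rw [intervalIntegral.integral_finsetSum fun k _ => Continuous.intervalIntegrable (by fun_prop) _ _]
  have hsum := sum_traceCoeff_div p hd (Nat.lt_succ_iff.1 (Finset.mem_range.1 hm))
  rw [one_pow, mul_one]
  refine Eq.trans ?_ ((congrArg (q.coeff m * ·) hsum).trans (mul_one _))
  rw [Finset.mul_sum]
  refine Finset.sum_congr rfl fun k _ => ?_
  rw [intervalIntegral.integral_const_mul, integral_pow]
  have : ((m + k + (d - 1) : ℕ) : ℝ) + 1 = m + k + d := by
    rw [Nat.cast_add, Nat.cast_add, Nat.cast_sub hd]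
    push_cast; ring
  rw [this, one_pow, zero_pow (by omega)]
  ring

/-- The sharp weighted trace inequality on the unit interval. -/
theorem sq_eval_one_le (p : ℕ) {d : ℕ} (hd : 1 ≤ d) {q : ℝ[X]} (hq : q.natDegree ≤ p) :
    q.eval 1 ^ 2 ≤ ((p : ℝ) + 1) * (p + d) * ∫ t in (0 : ℝ)..1, t ^ (d - 1) * q.eval t ^ 2 := by
  set R := tracePoly p d
  set N : ℝ := ((p : ℝ) + 1) * (p + d) with hN
  have hNpos : 0 < N := by
    have : (1 : ℝ) ≤ d := by exact_mod_cast hd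
    positivity
  -- Cauchy–Schwarz against the representing polynomial R, whose weighted squared norm is R(1) = N,
  -- written as the expansion of a square.
  have h0 : 0 ≤ ∫ t in (0 : ℝ)..1, t ^ (d - 1) * (N * q.eval t - q.eval 1 * R.eval t) ^ 2 :=
    intervalIntegral.integral_nonneg zero_le_one fun t ht =>
      mul_nonneg (pow_nonneg ht.1 _) (sq_nonneg _)
  have hexp : ∀ t : ℝ, t ^ (d - 1) * (N * q.eval t - q.eval 1 * R.eval t) ^ 2
      = N ^ 2 * (t ^ (d - 1) * q.eval t ^ 2)
        - 2 * N * q.eval 1 * (t ^ (d - 1) * (q.eval t * R.eval t))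
        + q.eval 1 ^ 2 * (t ^ (d - 1) * (R.eval t * R.eval t)) := fun t => by ring
  simp only [hexp] at h0
  rw [intervalIntegral.integral_add (Continuous.intervalIntegrable (by fun_prop) _ _)
      (Continuous.intervalIntegrable (by fun_prop) _ _),
    intervalIntegral.integral_sub (Continuous.intervalIntegrable (by fun_prop) _ _)
      (Continuous.intervalIntegrable (by fun_prop) _ _),
    intervalIntegral.integral_const_mul, intervalIntegral.integral_const_mul,
    intervalIntegral.integral_const_mul, integral_mul_tracePoly p hd hq,
    integral_mul_tracePoly p hd (natDegree_tracePoly_le p d), eval_one_tracePoly, ← hN] at h0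
  nlinarith [h0]

theorem integral_tracePoly_comp (p : ℕ) {q : ℝ[X]} (hq : q.natDegree ≤ p) :
    ∫ t in (0 : ℝ)..1, q.eval t * (tracePoly p 1).eval (1 - t) = q.eval 0 := by
  have h := integral_mul_tracePoly p le_rfl (q := q.comp (1 - X)) (by
    refine natDegree_comp_le.trans ?_
    have : (1 - X : ℝ[X]).natDegree ≤ 1 := by
      refine (natDegree_sub_le _ _).trans ?_
      simp
    nlinarith)
  simp only [Nat.sub_self, pow_zero, one_mul, eval_comp, eval_sub, eval_one, eval_X,
    sub_self] at h
  rw [← h]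
  have := intervalIntegral.integral_comp_sub_left
    (fun t => q.eval (1 - t) * (tracePoly p 1).eval t) (a := 0) (b := 1) 1
  simpa using this

/-- The sharp trace inequality for both end points of the unit interval. -/
theorem sq_eval_add_sq_eval_le (p : ℕ) {q : ℝ[X]} (hq : q.natDegree ≤ p) :
    q.eval 0 ^ 2 + q.eval 1 ^ 2
      ≤ ((p : ℝ) + 1) * (p + 2) * ∫ t in (0 : ℝ)..1, q.eval t ^ 2 := by
  set R := tracePoly p 1
  set N : ℝ := ((p : ℝ) + 1) * (p + 2) with hN
  have hNpos : 0 < N := by positivity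
  set a := q.eval 0
  set b := q.eval 1
  -- R(1 − t) represents evaluation at 0. The mixed integral of R(t)R(1 − t) is R(0), of modulus p +
  -- 1, and (p + 1)² + (p + 1) = N closes the estimate.
  have h0 : 0 ≤ ∫ t in (0 : ℝ)..1, (N * q.eval t - (b * R.eval t + a * R.eval (1 - t))) ^ 2 :=
    intervalIntegral.integral_nonneg zero_le_one fun t ht => sq_nonneg _
  have hexp : ∀ t : ℝ, (N * q.eval t - (b * R.eval t + a * R.eval (1 - t))) ^ 2
      = N ^ 2 * q.eval t ^ 2 - 2 * N * b * (q.eval t * R.eval t)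
        - 2 * N * a * (q.eval t * R.eval (1 - t)) + b ^ 2 * (R.eval t * R.eval t)
        + 2 * a * b * (R.eval t * R.eval (1 - t))
        + a ^ 2 * (R.eval (1 - t) * R.eval (1 - t)) := fun t => by ring
  have hR1 := fun {q : ℝ[X]} (hq : q.natDegree ≤ p) => integral_mul_tracePoly p le_rfl hq
  simp only [Nat.sub_self, pow_zero, one_mul] at hR1
  have hRR : ∫ t in (0 : ℝ)..1, R.eval (1 - t) * R.eval (1 - t) = R.eval 1 := by
    rw [intervalIntegral.integral_comp_sub_left (fun t => R.eval t * R.eval t)]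
    simpa using hR1 (natDegree_tracePoly_le p 1)
  simp only [hexp] at h0
  rw [intervalIntegral.integral_add (Continuous.intervalIntegrable (by fun_prop) _ _)
      (Continuous.intervalIntegrable (by fun_prop) _ _),
    intervalIntegral.integral_add (Continuous.intervalIntegrable (by fun_prop) _ _)
      (Continuous.intervalIntegrable (by fun_prop) _ _),
    intervalIntegral.integral_add (Continuous.intervalIntegrable (by fun_prop) _ _)
      (Continuous.intervalIntegrable (by fun_prop) _ _),
    intervalIntegral.integral_sub (Continuous.intervalIntegrable (by fun_prop) _ _)
      (Continuous.intervalIntegrable (by fun_prop) _ _),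
    intervalIntegral.integral_sub (Continuous.intervalIntegrable (by fun_prop) _ _)
      (Continuous.intervalIntegrable (by fun_prop) _ _)] at h0
  simp only [intervalIntegral.integral_const_mul] at h0
  rw [hR1 hq, hR1 (natDegree_tracePoly_le p 1), integral_tracePoly_comp p hq,
    integral_tracePoly_comp p (natDegree_tracePoly_le p 1), hRR, eval_one_tracePoly,
    eval_zero_tracePoly] at h0
  have hab : 2 * a * b * traceCoeff p 1 0 ≤ (a ^ 2 + b ^ 2) * (p + 1) := by
    calc 2 * a * b * traceCoeff p 1 0 ≤ |2 * a * b * traceCoeff p 1 0| := le_abs_self _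
      _ = |2 * a * b| * (p + 1) := by rw [abs_mul, abs_traceCoeff_zero]
      _ ≤ (a ^ 2 + b ^ 2) * (p + 1) := by
        gcongr
        exact abs_le.2 ⟨by nlinarith [sq_nonneg (a + b)], by nlinarith [sq_nonneg (a - b)]⟩
  set I := ∫ t in (0 : ℝ)..1, q.eval t ^ 2
  have h1 : N * (a ^ 2 + b ^ 2) ≤ N * (N * I) := by
    push_cast at h0
    have h2 : b ^ 2 * (((p : ℝ) + 1) * (p + 1)) + (a ^ 2 + b ^ 2) * (p + 1)
      + a ^ 2 * (((p : ℝ) + 1) * (p + 1)) = N * (a ^ 2 + b ^ 2) := by rw [hN]; ring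
    nlinarith [h0, h2, hab]
  exact le_of_mul_le_mul_left h1 hNpos

end OneVariable

/-! ### Polynomial functions and divergences -/

theorem contDiff_mvPolynomial_eval {d : ℕ} (n : ℕ∞) (q : MvPolynomial (Fin d) ℝ) :
    ContDiff ℝ n (fun x : Pt d => MvPolynomial.eval (fun i => x i) q) := by
  induction q using MvPolynomial.induction_on with
  | C a => simpa using contDiff_const
  | add p q hp hq => simpa using hp.add hq
  | mul_X p i hp =>
    simp only [map_mul, MvPolynomial.eval_X]
    exact hp.mul (EuclideanSpace.proj i : Pt d →L[ℝ] ℝ).contDiff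

namespace IsPoly

variable {d p : ℕ} {f : Pt d → ℝ}

theorem contDiff (hf : IsPoly p f) (n : ℕ∞) : ContDiff ℝ n f := by
  obtain ⟨q, -, hq⟩ := hf
  have : f = fun x : Pt d => MvPolynomial.eval (fun i => x i) q := funext hq
  rw [this]
  exact contDiff_mvPolynomial_eval n q

theorem continuous (hf : IsPoly p f) : Continuous f := (hf.contDiff 0).continuous

/-- The restriction of a polynomial to a line is a polynomial in one variable. -/
theorem exists_eval_line (hf : IsPoly p f) (x w : Pt d) :
    ∃ Q : Polynomial ℝ, Q.natDegree ≤ p ∧ ∀ t : ℝ, f (x + t • w) = Q.eval t := by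
  obtain ⟨q, hdeg, hq⟩ := hf
  refine ⟨MvPolynomial.aeval (fun i => Polynomial.C (x i) + Polynomial.C (w i) * Polynomial.X) q,
    ?_, fun t => ?_⟩
  · have := MvPolynomial.aeval_natDegree_le (m := p) (n := 1) q hdeg
      (fun i => Polynomial.C (x i) + Polynomial.C (w i) * Polynomial.X) (fun i => by
        refine (Polynomial.natDegree_add_le _ _).trans ?_
        simpa using Polynomial.natDegree_C_mul_X_pow_le (w i) 1)
    simpa using this
  · rw [hq, ← Polynomial.coe_evalRingHom, ← MvPolynomial.eval₂_id, MvPolynomial.aeval_def,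
      MvPolynomial.hom_eval₂]
    congr 1
    · ext a; simp
    · ext i
      simp
      ring

end IsPoly

theorem IsVecPoly.contDiff {d p : ℕ} {F : Pt d → Pt d} (hF : IsVecPoly p F) (n : ℕ∞) :
    ContDiff ℝ n F :=
  (contDiff_euclidean).2 fun i => (hF i).contDiff n

theorem IsVecPoly.continuous {d p : ℕ} {F : Pt d → Pt d} (hF : IsVecPoly p F) : Continuous F :=
  (hF.contDiff 0).continuous

theorem divergence_smul {d : ℕ} {v : Pt d → ℝ} {F : Pt d → Pt d} {x : Pt d}
    (hv : DifferentiableAt ℝ v x) (hF : DifferentiableAt ℝ F x) :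
    divergence (fun y => v y • F y) x = v x * divergence F x + fderiv ℝ v x (F x) := by
  have h : F x = ∑ i, F x i • EuclideanSpace.single i (1 : ℝ) := by
    ext j
    simp [Pi.single_apply]
  rw [divergence, fderiv_fun_smul hv hF]
  simp only [add_apply, smul_apply, ContinuousLinearMap.smulRight_apply, PiLp.add_apply,
    PiLp.smul_apply, smul_eq_mul, Finset.sum_add_distrib]
  rw [divergence, Finset.mul_sum]
  congr 1
  conv_rhs => rw [h, map_sum]
  refine Finset.sum_congr rfl fun i _ => ?_
  rw [map_smul, smul_eq_mul, mul_comm]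

theorem divergence_sub_const {d : ℕ} (x₀ x : Pt d) :
    divergence (fun y : Pt d => y - x₀) x = d := by
  rw [divergence]
  have : fderiv ℝ (fun y : Pt d => y - x₀) x = ContinuousLinearMap.id ℝ _ := by
    rw [fderiv_sub_const]; exact fderiv_id
  simp [this]

theorem continuous_divergence {d : ℕ} {F : Pt d → Pt d} (hF : ContDiff ℝ 1 F) :
    Continuous (divergence F) := by
  unfold divergence
  refine continuous_finsetSum _ fun i _ => ?_
  exact (EuclideanSpace.proj i : Pt d →L[ℝ] ℝ).continuous.comp
    ((hF.continuous_fderiv (by simp)).clm_apply continuous_const)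

/-! ### Boundary integrals and inscribed balls -/

namespace ConvexPolytope

variable {d : ℕ} (K : ConvexPolytope d)

theorem integrableOn_carrier {f : Pt d → ℝ} (hf : Continuous f) : IntegrableOn f K.carrier :=
  hf.continuousOn.integrableOn_compact K.isCompact_carrier

theorem integrableOn_facet (i : Fin K.numFacets) {f : Pt d → ℝ}
    (hf : ContinuousOn f (K.facet i)) : IntegrableOn f (K.facet i) (surf d) :=
  hf.integrableOn_of_subset_isCompact (K.isCompact_facet i) (K.measurableSet_facet i)
    subset_rfl (K.surf_facet_lt_top i).ne

theorem bdryIntegral_mono {f g : Fin K.numFacets → Pt d → ℝ}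
    (hf : ∀ i, IntegrableOn (f i) (K.facet i) (surf d))
    (hg : ∀ i, IntegrableOn (g i) (K.facet i) (surf d))
    (h : ∀ i, ∀ x ∈ K.facet i, f i x ≤ g i x) : K.bdryIntegral f ≤ K.bdryIntegral g :=
  Finset.sum_le_sum fun i _ => setIntegral_mono_on (hf i) (hg i) (K.measurableSet_facet i) (h i)

theorem bdryIntegral_nonneg {f : Fin K.numFacets → Pt d → ℝ}
    (h : ∀ i, ∀ x ∈ K.facet i, 0 ≤ f i x) : 0 ≤ K.bdryIntegral f :=
  Finset.sum_nonneg fun i _ => setIntegral_nonneg (K.measurableSet_facet i) (h i)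

theorem bdryIntegral_const_mul (c : ℝ) (f : Fin K.numFacets → Pt d → ℝ) :
    K.bdryIntegral (fun i x => c * f i x) = c * K.bdryIntegral f := by
  simp only [bdryIntegral, integral_const_mul, Finset.mul_sum]

theorem bdryIntegral_add {f g : Fin K.numFacets → Pt d → ℝ}
    (hf : ∀ i, IntegrableOn (f i) (K.facet i) (surf d))
    (hg : ∀ i, IntegrableOn (g i) (K.facet i) (surf d)) :
    K.bdryIntegral (fun i x => f i x + g i x) = K.bdryIntegral f + K.bdryIntegral g := by
  simp only [bdryIntegral, ← Finset.sum_add_distrib]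
  exact Finset.sum_congr rfl fun i _ => integral_add (hf i) (hg i)

/-- The divergence theorem for continuously differentiable fields on the whole space. -/
theorem integral_divergence_of_contDiff {F : Pt d → Pt d} (hF : ContDiff ℝ 1 F) :
    ∫ x in K.carrier, divergence F x
      = K.bdryIntegral (fun i x => inner ℝ (F x) (K.normal i)) :=
  K.integral_divergence hF.continuous.continuousOn hF.contDiffOn
    (K.integrableOn_carrier (continuous_divergence hF))

/-- The distance of the centre of an inscribed ball to the facets. -/
theorem inner_add_le_offset {x₀ : Pt d} {r : ℝ} (hball : Metric.ball x₀ r ⊆ K.carrier)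
    (hr : 0 < r) (i : Fin K.numFacets) : inner ℝ (K.normal i) x₀ + r ≤ K.offset i := by
  -- The ball is open, so only shifts s < r are available; the bound for r itself follows by
  -- density.
  have h : ∀ s : ℝ, s < r → s ≤ K.offset i - inner ℝ (K.normal i) x₀ := by
    intro s hs
    rcases le_or_gt 0 s with h0 | h0
    · have hmem : x₀ + s • K.normal i ∈ K.carrier := by
        apply hball
        rw [Metric.mem_ball, dist_eq_norm, add_sub_cancel_left, norm_smul, K.norm_normal, mul_one,
          Real.norm_eq_abs, abs_of_nonneg h0]
        exact hs
      have := hmem i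
      rw [inner_add_smul_normal] at this
      linarith
    · have := hball (Metric.mem_ball_self hr) i
      linarith
  have := le_of_forall_lt_imp_le_of_dense h
  linarith

end ConvexPolytope

theorem integrable_prod_of_continuous {d : ℕ} {μ : Measure (Pt d)} [IsFiniteMeasure μ]
    {S : Set (Pt d)} (hS : IsCompact S) (hμ : ∀ᵐ x ∂μ, x ∈ S) {f : Pt d → ℝ → ℝ}
    (hf : Continuous (Function.uncurry f)) :
    Integrable (Function.uncurry f) (μ.prod (volume.restrict (Set.Ioc (0 : ℝ) 1))) := by
  obtain ⟨C, hC⟩ := (hS.prod (isCompact_Icc (a := (0 : ℝ)) (b := 1))).exists_bound_of_continuousOn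
    hf.continuousOn
  refine Integrable.of_bound hf.aestronglyMeasurable C ?_
  filter_upwards [Measure.quasiMeasurePreserving_fst.ae hμ,
    Measure.quasiMeasurePreserving_snd.ae (ae_restrict_mem measurableSet_Ioc)] with q h1 h2
  exact hC q ⟨h1, Set.Ioc_subset_Icc_self h2⟩

theorem integral_intervalIntegral_swap {d : ℕ} {μ : Measure (Pt d)} [IsFiniteMeasure μ]
    {S : Set (Pt d)} (hS : IsCompact S) (hμ : ∀ᵐ x ∂μ, x ∈ S) {f : Pt d → ℝ → ℝ}
    (hf : Continuous (Function.uncurry f)) :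
    ∫ x, (∫ t in (0 : ℝ)..1, f x t) ∂μ = ∫ t in (0 : ℝ)..1, (∫ x, f x t ∂μ) := by
  simp only [intervalIntegral.integral_of_le zero_le_one]
  exact integral_integral_swap (integrable_prod_of_continuous hS hμ hf)

theorem continuous_intervalIntegral {d : ℕ} {f : Pt d → ℝ → ℝ}
    (hf : Continuous (Function.uncurry f)) : Continuous fun x => ∫ t in (0 : ℝ)..1, f x t :=
  intervalIntegral.continuous_parametric_intervalIntegral_of_continuous' hf 0 1

/-! ### The discrete trace inequality -/

namespace ConvexPolytope

variable {d : ℕ} (K : ConvexPolytope d)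

/-- The field `u(x₀ + t (x - x₀))² (x - x₀)`. -/
def coneField (u : Pt d → ℝ) (x₀ : Pt d) (t : ℝ) (x : Pt d) : Pt d :=
  u (x₀ + t • (x - x₀)) ^ 2 • (x - x₀)

theorem continuous_coneField {u : Pt d → ℝ} (hu : Continuous u) (x₀ : Pt d) :
    Continuous fun q : Pt d × ℝ => coneField u x₀ q.2 q.1 := by
  unfold coneField
  fun_prop

theorem contDiff_coneField {u : Pt d → ℝ} (hu : ContDiff ℝ 1 u) (x₀ : Pt d) (t : ℝ) :
    ContDiff ℝ 1 (coneField u x₀ t) := by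
  unfold coneField
  fun_prop

theorem divergence_coneField {u : Pt d → ℝ} (hu : ContDiff ℝ 1 u) (x₀ : Pt d) (t : ℝ)
    (x : Pt d) : divergence (coneField u x₀ t) x = d * u (x₀ + t • (x - x₀)) ^ 2
      + t * (2 * u (x₀ + t • (x - x₀)) * fderiv ℝ u (x₀ + t • (x - x₀)) (x - x₀)) := by
  have hd : Differentiable ℝ u := hu.differentiable (by simp)
  have h1 : HasFDerivAt (fun y : Pt d => x₀ + t • (y - x₀)) (t • ContinuousLinearMap.id ℝ _) x :=
    (((hasFDerivAt_id x).sub_const x₀).const_smul t).const_add x₀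
  have h2 : HasFDerivAt (fun y : Pt d => u (x₀ + t • (y - x₀)) ^ 2) _ x :=
    ((hd (x₀ + t • (x - x₀))).hasFDerivAt.comp x h1).pow 2
  have h3 := divergence_smul (v := fun y => u (x₀ + t • (y - x₀)) ^ 2)
    (F := fun y => y - x₀) h2.differentiableAt (by fun_prop)
  unfold coneField
  rw [h3, divergence_sub_const, h2.fderiv]
  simp only [smul_apply, ContinuousLinearMap.comp_apply, ContinuousLinearMap.id_apply, map_smul,
    smul_eq_mul]
  ring

/-- The integrand is the t-derivative of t^d u(x₀ + t(x − x₀))², and d ≥ 1 makes the value at t = 0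
vanish. -/
theorem integral_pow_mul_divergence_coneField (hd : 1 ≤ d) {u : Pt d → ℝ} (hu : ContDiff ℝ 1 u)
    (x₀ x : Pt d) :
    ∫ t in (0 : ℝ)..1, t ^ (d - 1) * divergence (coneField u x₀ t) x = u x ^ 2 := by
  have hdu : Differentiable ℝ u := hu.differentiable (by simp)
  have hcd : Continuous (fderiv ℝ u) := hu.continuous_fderiv (by simp)
  have hcu : Continuous u := hu.continuous
  have hderiv : ∀ t : ℝ, HasDerivAt (fun t : ℝ => t ^ d * u (x₀ + t • (x - x₀)) ^ 2)
      (t ^ (d - 1) * divergence (coneField u x₀ t) x) t := by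
    intro t
    have h1 : HasDerivAt (fun t : ℝ => x₀ + t • (x - x₀)) (x - x₀) t := by
      simpa using ((hasDerivAt_id t).smul_const (x - x₀)).const_add x₀
    have h2 := ((hdu (x₀ + t • (x - x₀))).hasFDerivAt.comp_hasDerivAt t h1).pow 2
    have h3 := (hasDerivAt_pow d t).mul h2
    refine h3.congr_deriv ?_
    rw [divergence_coneField hu]
    have hp : t ^ d = t ^ (d - 1) * t := by rw [← pow_succ, Nat.sub_add_cancel hd]
    simp only [hp, Function.comp_apply, Pi.pow_apply]
    push_cast
    ring
  rw [intervalIntegral.integral_eq_sub_of_hasDerivAt (fun t _ => hderiv t)]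
  · simp [show d ≠ 0 by omega]
  · refine Continuous.intervalIntegrable ?_ _ _
    simp only [divergence_coneField hu]
    fun_prop

theorem continuous_divergence_coneField {u : Pt d → ℝ} (hu : ContDiff ℝ 1 u) (x₀ : Pt d) :
    Continuous fun q : Pt d × ℝ => divergence (coneField u x₀ q.2) q.1 := by
  have hcd : Continuous (fderiv ℝ u) := hu.continuous_fderiv (by simp)
  have hcu : Continuous u := hu.continuous
  simp only [divergence_coneField hu]
  fun_prop

/-- Trace inequality on polytopes that contain a ball of radius `r`. -/
theorem mul_bdryIntegral_sq_le (hd : 1 ≤ d) {p : ℕ} {u : Pt d → ℝ} (hu : IsPoly p u)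
    {x₀ : Pt d} {r : ℝ} (hball : Metric.ball x₀ r ⊆ K.carrier) (hr : 0 < r) :
    r * K.bdryIntegral (fun _ x => u x ^ 2)
      ≤ ((p : ℝ) + 1) * (p + d) * ∫ x in K.carrier, u x ^ 2 := by
  have hcu : Continuous u := hu.continuous
  have hu1 : ContDiff ℝ 1 u := hu.contDiff 1
  set N : ℝ := ((p : ℝ) + 1) * (p + d)
  have hflux : ∀ i, Continuous (Function.uncurry fun (x : Pt d) (t : ℝ) =>
      t ^ (d - 1) * inner ℝ (coneField u x₀ t x) (K.normal i)) := fun i =>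
    (continuous_snd.pow _).mul ((continuous_coneField hcu x₀).inner continuous_const)
  -- On a facet (y − x₀)·n is at least r, and along the ray from x₀ to y the function u is a
  -- one-variable polynomial to which the weighted inequality applies.
  have hpt : ∀ i, ∀ y ∈ K.facet i, r * u y ^ 2
      ≤ N * ∫ t in (0 : ℝ)..1, t ^ (d - 1) * inner ℝ (coneField u x₀ t y) (K.normal i) := by
    intro i y hy
    obtain ⟨Q, hQ, hQu⟩ := hu.exists_eval_line x₀ (y - x₀)
    have h1 := sq_eval_one_le p hd hQ
    simp only [← hQu, one_smul, add_sub_cancel] at h1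
    have hdist : r ≤ inner ℝ (y - x₀) (K.normal i) := by
      have h2 := K.inner_add_le_offset hball hr i
      rw [real_inner_comm, inner_sub_right, hy.2]
      linarith
    have h3 : ∀ t : ℝ, t ^ (d - 1) * inner ℝ (coneField u x₀ t y) (K.normal i)
        = inner ℝ (y - x₀) (K.normal i) * (t ^ (d - 1) * u (x₀ + t • (y - x₀)) ^ 2) := by
      intro t
      rw [coneField, inner_smul_left]
      simp only [conj_trivial]
      ring
    simp only [h3]
    rw [intervalIntegral.integral_const_mul]
    calc r * u y ^ 2 ≤ inner ℝ (y - x₀) (K.normal i) * u y ^ 2 := by gcongr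
      _ ≤ inner ℝ (y - x₀) (K.normal i)
          * (N * ∫ t in (0 : ℝ)..1, t ^ (d - 1) * u (x₀ + t • (y - x₀)) ^ 2) := by
        have : 0 ≤ inner ℝ (y - x₀) (K.normal i) := hr.le.trans hdist
        gcongr
      _ = _ := by ring
  have hbdry : r * K.bdryIntegral (fun _ x => u x ^ 2) ≤ N * K.bdryIntegral (fun i x =>
      ∫ t in (0 : ℝ)..1, t ^ (d - 1) * inner ℝ (coneField u x₀ t x) (K.normal i)) := by
    rw [← bdryIntegral_const_mul, ← bdryIntegral_const_mul]
    exact K.bdryIntegral_mono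
      (fun i => K.integrableOn_facet i (by fun_prop))
      (fun i => K.integrableOn_facet i
        (continuous_const.mul (continuous_intervalIntegral (hflux i))).continuousOn) hpt
  refine hbdry.trans_eq (congrArg (N * ·) ?_)
  -- The divergence theorem is applied for each fixed t, then averaged with weight t^(d−1); Fubini
  -- on both sides moves the t-integral inside, where it yields u².
  calc K.bdryIntegral (fun i x =>
        ∫ t in (0 : ℝ)..1, t ^ (d - 1) * inner ℝ (coneField u x₀ t x) (K.normal i))
      = ∑ i, ∫ t in (0 : ℝ)..1, ∫ x in K.facet i,
          t ^ (d - 1) * inner ℝ (coneField u x₀ t x) (K.normal i) ∂(surf d) := by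
        refine Finset.sum_congr rfl fun i _ => ?_
        exact integral_intervalIntegral_swap (K.isCompact_facet i)
          (ae_restrict_mem (K.measurableSet_facet i)) (hflux i)
    _ = ∫ t in (0 : ℝ)..1, ∑ i, ∫ x in K.facet i,
          t ^ (d - 1) * inner ℝ (coneField u x₀ t x) (K.normal i) ∂(surf d) := by
        rw [intervalIntegral.integral_finsetSum]
        intro i _
        rw [intervalIntegrable_iff_integrableOn_Ioc_of_le zero_le_one]
        exact (integrable_prod_of_continuous (K.isCompact_facet i)
          (ae_restrict_mem (K.measurableSet_facet i)) (hflux i)).integral_prod_right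
    _ = ∫ t in (0 : ℝ)..1, ∫ x in K.carrier, t ^ (d - 1) * divergence (coneField u x₀ t) x := by
        congr 1
        ext t
        simp only [integral_const_mul]
        rw [← Finset.mul_sum, K.integral_divergence_of_contDiff (contDiff_coneField hu1 x₀ t)]
        rfl
    _ = ∫ x in K.carrier, ∫ t in (0 : ℝ)..1, t ^ (d - 1) * divergence (coneField u x₀ t) x := by
        have : IsFiniteMeasure (volume.restrict K.carrier) :=
          ⟨by rw [Measure.restrict_apply_univ]; exact K.isCompact_carrier.measure_lt_top⟩
        exact (integral_intervalIntegral_swap K.isCompact_carrier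
          (ae_restrict_mem K.isClosed_carrier.measurableSet)
          ((continuous_snd.pow _).mul (continuous_divergence_coneField hu1 x₀))).symm
    _ = ∫ x in K.carrier, u x ^ 2 := by
        simp only [integral_pow_mul_divergence_coneField hd hu1]

end ConvexPolytope

/-! ### The trace inequality on intervals -/

section Interval

/-- The unit vector of `ℝ¹`. -/
noncomputable def unitVec : Pt 1 := EuclideanSpace.single 0 1

theorem inner_unitVec (x : Pt 1) : inner ℝ unitVec x = x 0 := by
  simp [unitVec, EuclideanSpace.inner_single_left]

theorem smul_unitVec (x : Pt 1) : x 0 • unitVec = x := by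
  ext i
  fin_cases i
  simp [unitVec]

theorem eq_unitVec_or_neg {n : Pt 1} (hn : ‖n‖ = 1) : n = unitVec ∨ n = -unitVec := by
  have h : |n 0| = 1 := by
    rw [← hn, ← smul_unitVec n, norm_smul]
    simp [unitVec]
  rcases (abs_eq zero_le_one).1 h with h1 | h1
  · left; rw [← smul_unitVec n, h1, one_smul]
  · right; rw [← smul_unitVec n, h1, neg_smul, one_smul]

theorem pt_one_ext {x y : Pt 1} (h : x 0 = y 0) : x = y := by
  rw [← smul_unitVec x, h, smul_unitVec]

theorem surf_one_singleton (x : Pt 1) : surf 1 {x} = 1 := by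
  rw [surf, Nat.sub_self, Measure.euclideanHausdorffMeasure_zero, Measure.hausdorffMeasure_zero_singleton]

namespace ConvexPolytope

variable (K : ConvexPolytope 1)

theorem facet_eq_singleton_of_isMax {b : Pt 1} (hb : b ∈ K.carrier)
    (hmax : ∀ x ∈ K.carrier, x 0 ≤ b 0) {i : Fin K.numFacets} (hi : K.normal i = unitVec) :
    K.facet i = {b} := by
  refine (K.facet_nonempty i).subset_singleton_iff.1 fun x hx => pt_one_ext ?_
  have h1 := hx.2
  have h2 := hb i
  rw [hi, inner_unitVec] at h1 h2
  exact le_antisymm (hmax x hx.1) (h1 ▸ h2)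

theorem facet_eq_singleton_of_isMin {a : Pt 1} (ha : a ∈ K.carrier)
    (hmin : ∀ x ∈ K.carrier, a 0 ≤ x 0) {i : Fin K.numFacets} (hi : K.normal i = -unitVec) :
    K.facet i = {a} := by
  refine (K.facet_nonempty i).subset_singleton_iff.1 fun x hx => pt_one_ext ?_
  have h1 := hx.2
  have h2 := ha i
  rw [hi, inner_neg_left, inner_unitVec] at h1 h2
  exact le_antisymm (by linarith) (hmin x hx.1)

/-- A one-dimensional polytope is an interval: its boundary consists of the two end points. -/
theorem exists_endpoints : ∃ a b : Pt 1,
    ∃ ia ib : Fin K.numFacets, a ∈ K.facet ia ∧ b ∈ K.facet ib ∧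
      K.normal ia = -unitVec ∧ K.normal ib = unitVec ∧
      ∀ g : Fin K.numFacets → Pt 1 → ℝ, K.bdryIntegral g = g ia a + g ib b := by
  have hne : K.carrier.Nonempty := K.interior_carrier_nonempty.mono interior_subset
  have hc : ContinuousOn (fun x : Pt 1 => x 0) K.carrier := by fun_prop
  obtain ⟨a, ha, hmin⟩ := K.isCompact_carrier.exists_isMinOn hne hc
  obtain ⟨b, hb, hmax⟩ := K.isCompact_carrier.exists_isMaxOn hne hc
  have hmin' : ∀ x ∈ K.carrier, a 0 ≤ x 0 := fun x hx => hmin hx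
  have hmax' : ∀ x ∈ K.carrier, x 0 ≤ b 0 := fun x hx => hmax hx
  -- If the extreme points coincided, the polytope would be a single point without interior.
  have hab : a 0 < b 0 := by
    refine lt_of_le_of_ne (hmin' b hb) fun h => ?_
    obtain ⟨y, hy⟩ := K.interior_carrier_nonempty
    have h1 : ∀ x ∈ K.carrier, x = a := fun x hx =>
      pt_one_ext (le_antisymm (h ▸ hmax' x hx) (hmin' x hx))
    have h2 : K.carrier ⊆ {a} := fun x hx => h1 x hx
    have h3 := interior_mono h2 hy
    rw [interior_singleton] at h3
    exact h3
  have hnormal : ∀ i, K.normal i = unitVec ∨ K.normal i = -unitVec := fun i =>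
    eq_unitVec_or_neg (K.norm_normal i)
  -- The sign of s covers both ends at once: s = 1 for the maximum, s = −1 for the minimum of the
  -- coordinate.
  have hnotint : ∀ y ∈ K.carrier, (∃ s : ℝ, s ≠ 0 ∧ ∀ x ∈ K.carrier, s * x 0 ≤ s * y 0) →
      y ∉ interior K.carrier := by
    rintro y - ⟨s, hs, hmaxy⟩ hint
    have hcont : Continuous fun t : ℝ => y + (t * s) • unitVec := by fun_prop
    have hnhds : ∀ᶠ t : ℝ in 𝓝 0, y + (t * s) • unitVec ∈ interior K.carrier := by
      refine hcont.continuousAt.eventually_mem ?_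
      simpa using isOpen_interior.mem_nhds hint
    obtain ⟨t, ht, ht0⟩ := ((hnhds.filter_mono nhdsWithin_le_nhds).and
      (self_mem_nhdsWithin (s := Set.Ioi (0 : ℝ)))).exists
    have h1 := hmaxy _ (interior_subset ht)
    have h2 : (y + (t * s) • unitVec) 0 = y 0 + t * s := by simp [unitVec]
    rw [h2] at h1
    have h3 : 0 < t * (s * s) := mul_pos ht0 (mul_self_pos.2 hs)
    nlinarith
  obtain ⟨ib, hib⟩ := K.mem_facet_of_mem_carrier hb
    (hnotint b hb ⟨1, one_ne_zero, fun x hx => by simpa using hmax' x hx⟩)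
  obtain ⟨ia, hia⟩ := K.mem_facet_of_mem_carrier ha
    (hnotint a ha ⟨-1, by norm_num, fun x hx => by simpa using hmin' x hx⟩)
  have hnb : K.normal ib = unitVec := by
    refine (hnormal ib).resolve_right fun h => ?_
    have := K.facet_eq_singleton_of_isMin ha hmin' h ▸ hib
    rw [Set.mem_singleton_iff] at this
    rw [this] at hab
    exact lt_irrefl _ hab
  have hna : K.normal ia = -unitVec := by
    refine (hnormal ia).resolve_left fun h => ?_
    have := K.facet_eq_singleton_of_isMax hb hmax' h ▸ hia
    rw [Set.mem_singleton_iff] at this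
    rw [this] at hab
    exact lt_irrefl _ hab
  refine ⟨a, b, ia, ib, hia, hib, hna, hnb, fun g => ?_⟩
  -- Facets with the same normal share an end point, which irredundancy forbids; so there are
  -- exactly two facets.
  have huniq : ∀ i j, K.normal i = K.normal j → i = j := by
    intro i j hij
    by_contra hne
    rcases hnormal i with h | h
    · have h1 : b ∈ K.facet i := by rw [K.facet_eq_singleton_of_isMax hb hmax' h]; rfl
      have h2 : b ∈ K.facet j := by rw [K.facet_eq_singleton_of_isMax hb hmax' (hij ▸ h)]; rfl
      exact (K.normal_ne_of_inner_eq hne h2.2 h1.2).1 hij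
    · have h1 : a ∈ K.facet i := by rw [K.facet_eq_singleton_of_isMin ha hmin' h]; rfl
      have h2 : a ∈ K.facet j := by rw [K.facet_eq_singleton_of_isMin ha hmin' (hij ▸ h)]; rfl
      exact (K.normal_ne_of_inner_eq hne h2.2 h1.2).1 hij
  have hab' : ia ≠ ib := by
    rintro rfl
    have h1 : (unitVec : Pt 1) 0 = (-unitVec : Pt 1) 0 := congrArg (· 0) (hnb.symm.trans hna)
    simp [unitVec] at h1
    linarith
  have huniv : (Finset.univ : Finset (Fin K.numFacets)) = {ia, ib} := by
    ext i
    simp only [Finset.mem_univ, Finset.mem_insert, Finset.mem_singleton, true_iff]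
    rcases hnormal i with h | h
    · exact Or.inr (huniq _ _ (h.trans hnb.symm))
    · exact Or.inl (huniq _ _ (h.trans hna.symm))
  rw [bdryIntegral, huniv, Finset.sum_pair hab', K.facet_eq_singleton_of_isMin ha hmin' hna,
    K.facet_eq_singleton_of_isMax hb hmax' hnb]
  simp [surf_one_singleton]

/-- The divergence theorem for w(x)e, with w an antiderivative of f along the line, turns the volume
integral into the difference of w at the end points. -/
theorem integral_carrier_eq_intervalIntegral {a b : Pt 1} {ia ib : Fin K.numFacets}
    (hia : K.normal ia = -unitVec) (hib : K.normal ib = unitVec)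
    (hbdry : ∀ g : Fin K.numFacets → Pt 1 → ℝ, K.bdryIntegral g = g ia a + g ib b)
    {f : Pt 1 → ℝ} (hf : Continuous f) :
    ∫ x in K.carrier, f x = ∫ s in (a 0)..(b 0), f (s • unitVec) := by
  have hfs : Continuous fun s : ℝ => f (s • unitVec) := by fun_prop
  set w : ℝ → ℝ := fun t => ∫ s in (a 0)..t, f (s • unitVec) with hw
  have hderiv : ∀ t, HasDerivAt w (f (t • unitVec)) t := fun t =>
    intervalIntegral.integral_hasDerivAt_right (hfs.intervalIntegrable _ _)
      hfs.aestronglyMeasurable.stronglyMeasurableAtFilter hfs.continuousAt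
  have hw1 : ContDiff ℝ 1 w := by
    rw [contDiff_one_iff_deriv]
    refine ⟨fun t => (hderiv t).differentiableAt, ?_⟩
    rw [show deriv w = fun t => f (t • unitVec) from funext fun t => (hderiv t).deriv]
    exact hfs
  have hW : ContDiff ℝ 1 fun x : Pt 1 => w (x 0) • unitVec :=
    (hw1.comp (EuclideanSpace.proj 0 : Pt 1 →L[ℝ] ℝ).contDiff).smul contDiff_const
  have hdiv : ∀ x, divergence (fun x : Pt 1 => w (x 0) • unitVec) x = f x := by
    intro x
    have h1 : HasFDerivAt (fun x : Pt 1 => w (x 0))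
        (f (x 0 • unitVec) • (EuclideanSpace.proj 0 : Pt 1 →L[ℝ] ℝ)) x :=
      HasDerivAt.comp_hasFDerivAt (h₂ := w) (f := fun x : Pt 1 => x 0) x (hderiv (x 0))
        (EuclideanSpace.proj 0 : Pt 1 →L[ℝ] ℝ).hasFDerivAt
    rw [divergence, (h1.smul_const unitVec).fderiv]
    simp [unitVec]
    rw [← unitVec, smul_unitVec]
  have h := K.integral_divergence_of_contDiff hW
  simp only [hdiv] at h
  rw [h, hbdry, hia, hib]
  simp [hw, inner_smul_left, unitVec]

/-- Trace inequality on intervals of length at least `2 r`. -/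
theorem mul_bdryIntegral_sq_le_one {p : ℕ} {u : Pt 1 → ℝ} (hu : IsPoly p u)
    {x₀ : Pt 1} {r : ℝ} (hball : Metric.ball x₀ r ⊆ K.carrier) (hr : 0 < r) :
    r * K.bdryIntegral (fun _ x => u x ^ 2)
      ≤ ((p : ℝ) + 1) * (p + 2) / 2 * ∫ x in K.carrier, u x ^ 2 := by
  obtain ⟨a, b, ia, ib, ha, hb, hia, hib, hbdry⟩ := K.exists_endpoints
  have hcu := hu.continuous
  have hlen : 2 * r ≤ b 0 - a 0 := by
    have h1 := K.inner_add_le_offset hball hr ib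
    have h2 := K.inner_add_le_offset hball hr ia
    rw [← hb.2, hib, inner_unitVec, inner_unitVec] at h1
    rw [← ha.2, hia, inner_neg_left, inner_neg_left, inner_unitVec, inner_unitVec] at h2
    linarith
  obtain ⟨Q, hQ, hQu⟩ := hu.exists_eval_line a ((b 0 - a 0) • unitVec)
  have hline : ∀ t : ℝ, a + t • (b 0 - a 0) • unitVec
      = (a 0 + (b 0 - a 0) * t) • unitVec := by
    intro t
    rw [add_smul, smul_unitVec, smul_smul, mul_comm]
  have h1 := sq_eval_add_sq_eval_le p hQ
  simp only [← hQu, hline] at h1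
  rw [mul_zero, mul_one, add_zero, add_sub_cancel, smul_unitVec, smul_unitVec] at h1
  have h2 := intervalIntegral.smul_integral_comp_add_mul (fun s : ℝ => u (s • unitVec) ^ 2)
    (a := 0) (b := 1) (b 0 - a 0) (a 0)
  rw [mul_zero, mul_one, add_zero, add_sub_cancel, smul_eq_mul] at h2
  rw [hbdry, K.integral_carrier_eq_intervalIntegral hia hib hbdry (by fun_prop), ← h2]
  set I := ∫ t in (0 : ℝ)..1, u ((a 0 + (b 0 - a 0) * t) • unitVec) ^ 2
  have hI : 0 ≤ I := intervalIntegral.integral_nonneg zero_le_one fun _ _ => sq_nonneg _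
  calc r * (u a ^ 2 + u b ^ 2) ≤ r * (((p : ℝ) + 1) * (p + 2) * I) := by gcongr
    _ = ((p : ℝ) + 1) * (p + 2) / 2 * (2 * r * I) := by ring
    _ ≤ ((p : ℝ) + 1) * (p + 2) / 2 * ((b 0 - a 0) * I) := by gcongr

end ConvexPolytope

end Interval

/-- **Discrete trace inequality**: `2 r / (d (p + 1) (p + 2)) ‖u‖²_{∂K} ≤ ‖u‖²_K` for polynomials of
degree at most `p` on a polytope that contains a ball of radius `r`. -/
theorem ConvexPolytope.trace_inequality {d : ℕ} (K : ConvexPolytope d) (hd : 1 ≤ d) {p : ℕ}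
    {u : Pt d → ℝ} (hu : IsPoly p u) {x₀ : Pt d} {r : ℝ}
    (hball : Metric.ball x₀ r ⊆ K.carrier) :
    2 * r / ((d : ℝ) * ((p : ℝ) + 1) * ((p : ℝ) + 2)) * K.bdryIntegral (fun _ x => u x ^ 2)
      ≤ ∫ x in K.carrier, u x ^ 2 := by
  have hI : 0 ≤ ∫ x in K.carrier, u x ^ 2 := integral_nonneg fun _ => sq_nonneg _
  have hb : 0 ≤ K.bdryIntegral (fun _ x => u x ^ 2) :=
    K.bdryIntegral_nonneg fun _ _ _ => sq_nonneg _
  have hd0 : (0 : ℝ) < d := by exact_mod_cast hd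
  have hN : 0 < (d : ℝ) * ((p : ℝ) + 1) * ((p : ℝ) + 2) := by positivity
  rcases le_or_gt r 0 with hr | hr
  · refine le_trans (mul_nonpos_of_nonpos_of_nonneg ?_ hb) hI
    exact div_nonpos_of_nonpos_of_nonneg (by linarith) hN.le
  · have key : r * K.bdryIntegral (fun _ x => u x ^ 2)
        ≤ (d : ℝ) * ((p : ℝ) + 1) * ((p : ℝ) + 2) / 2 * ∫ x in K.carrier, u x ^ 2 := by
      -- For d ≥ 2 the ray estimate suffices, since 2(p + d) ≤ d(p + 2). For d = 1 its constant (p +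
      -- 1)² exceeds (p + 1)(p + 2)/2 once p ≥ 1, so the two-point inequality takes over.
      rcases Nat.lt_or_ge d 2 with h | h
      · obtain rfl : d = 1 := by omega
        simpa using K.mul_bdryIntegral_sq_le_one hu hball hr
      · refine (K.mul_bdryIntegral_sq_le hd hu hball hr).trans ?_
        have h2 : (2 : ℝ) ≤ d := by exact_mod_cast h
        have hp : (0 : ℝ) ≤ p := by positivity
        gcongr
        nlinarith [mul_nonneg hp (sub_nonneg.2 h2), mul_nonneg (mul_nonneg hp hp) (sub_nonneg.2 h2)]
    rw [div_mul_eq_mul_div, div_le_iff₀ hN]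
    linarith

/-! ### Bounded measurable functions on facets -/

/-- Bounded measurable functions on the `i`-th facet. -/
def ConvexPolytope.FacetBounded {d : ℕ} (K : ConvexPolytope d) (i : Fin K.numFacets)
    (f : Pt d → ℝ) : Prop :=
  AEStronglyMeasurable f ((surf d).restrict (K.facet i)) ∧ ∃ C, ∀ x ∈ K.facet i, |f x| ≤ C

namespace ConvexPolytope.FacetBounded

variable {d : ℕ} {K : ConvexPolytope d} {i : Fin K.numFacets} {f g : Pt d → ℝ}

theorem of_continuousOn (hf : ContinuousOn f (K.facet i)) : K.FacetBounded i f :=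
  ⟨hf.aestronglyMeasurable (K.measurableSet_facet i),
    (K.isCompact_facet i).exists_bound_of_continuousOn hf⟩

theorem add (hf : K.FacetBounded i f) (hg : K.FacetBounded i g) :
    K.FacetBounded i (fun x => f x + g x) := by
  obtain ⟨hf, C, hC⟩ := hf
  obtain ⟨hg, D, hD⟩ := hg
  exact ⟨hf.add hg, C + D, fun x hx => (abs_add_le _ _).trans (add_le_add (hC x hx) (hD x hx))⟩

theorem neg (hf : K.FacetBounded i f) : K.FacetBounded i (fun x => -f x) := by
  obtain ⟨hf, C, hC⟩ := hf
  exact ⟨hf.neg, C, fun x hx => by rw [abs_neg]; exact hC x hx⟩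

theorem sub (hf : K.FacetBounded i f) (hg : K.FacetBounded i g) :
    K.FacetBounded i (fun x => f x - g x) := by
  simpa only [sub_eq_add_neg] using hf.add hg.neg

theorem mul (hf : K.FacetBounded i f) (hg : K.FacetBounded i g) :
    K.FacetBounded i (fun x => f x * g x) := by
  obtain ⟨hf, C, hC⟩ := hf
  obtain ⟨hg, D, hD⟩ := hg
  refine ⟨hf.mul hg, C * D, fun x hx => ?_⟩
  rw [abs_mul]
  exact mul_le_mul (hC x hx) (hD x hx) (abs_nonneg _) ((abs_nonneg _).trans (hC x hx))

theorem const_mul (hf : K.FacetBounded i f) (c : ℝ) : K.FacetBounded i (fun x => c * f x) :=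
  (of_continuousOn continuousOn_const).mul hf

theorem sq (hf : K.FacetBounded i f) : K.FacetBounded i (fun x => f x ^ 2) := by
  simpa only [pow_two] using hf.mul hf

theorem sum {ι : Type*} {s : Finset ι} {f : ι → Pt d → ℝ}
    (hf : ∀ a ∈ s, K.FacetBounded i (f a)) : K.FacetBounded i (fun x => ∑ a ∈ s, f a x) := by
  classical
  induction s using Finset.induction_on with
  | empty => simpa using of_continuousOn continuousOn_const
  | insert a s ha ih =>
    simp only [Finset.sum_insert ha]
    exact (hf a (Finset.mem_insert_self a s)).add
      (ih fun b hb => hf b (Finset.mem_insert_of_mem hb))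

theorem indicator (hf : K.FacetBounded i f) {S : Set (Pt d)} (hS : MeasurableSet S) :
    K.FacetBounded i (S.indicator f) := by
  obtain ⟨hf, C, hC⟩ := hf
  refine ⟨hf.indicator hS, C, fun x hx => ?_⟩
  by_cases h : x ∈ S
  · rw [Set.indicator_of_mem h]; exact hC x hx
  · rw [Set.indicator_of_notMem h, abs_zero]
    exact (abs_nonneg _).trans (hC x hx)

/-- Facets have finite surface measure. Unlike integrable functions, this class is closed under
products, and it contains the exterior traces, which jump between neighbouring elements. -/
theorem integrableOn (hf : K.FacetBounded i f) : IntegrableOn f (K.facet i) (surf d) := by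
  obtain ⟨hf, C, hC⟩ := hf
  refine Integrable.of_bound hf C ?_
  filter_upwards [ae_restrict_mem (K.measurableSet_facet i)] with x hx using hC x hx

end ConvexPolytope.FacetBounded

/-! ### Exterior traces -/

namespace Mesh

variable {d : ℕ} (M : Mesh d)

/-- This form makes measurability visible: Ω is open and the elements are closed. -/
theorem extTrace_eq_indicator (w : M.ScalarField) (j : Fin M.numElems) :
    M.extTrace w j = M.Ω.indicator (fun x => ∑ j' ∈ Finset.univ.erase j,
      (M.elem j').carrier.indicator (w j') x) := by
  classical
  ext x
  rw [extTrace, Set.indicator]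
  congr 1
  simp only [Set.indicator, Finset.sum_ite, Finset.sum_const_zero, add_zero]
  refine Finset.sum_congr ?_ fun _ _ => rfl
  ext j'
  simp

theorem facetBounded_extTrace {w : M.ScalarField} (hw : ∀ j, Continuous (w j))
    (j : Fin M.numElems) (i : Fin (M.elem j).numFacets) :
    (M.elem j).FacetBounded i (M.extTrace w j) := by
  rw [extTrace_eq_indicator]
  refine ConvexPolytope.FacetBounded.indicator (.sum fun j' _ => ?_) M.isOpen_Ω.measurableSet
  exact (ConvexPolytope.FacetBounded.of_continuousOn (hw j').continuousOn).indicator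
    (M.elem j').isClosed_carrier.measurableSet

theorem inner_extTrace (σ : M.VectorField) (j : Fin M.numElems) (n x : Pt d) :
    inner ℝ (M.extTrace σ j x) n = M.extTrace (fun j' y => inner ℝ (σ j' y) n) j x := by
  rw [extTrace, extTrace]
  split_ifs
  · rw [sum_inner]
  · rw [inner_zero_left]

theorem facetBounded_inner_extTrace {σ : M.VectorField} (hσ : ∀ j, Continuous (σ j))
    (j : Fin M.numElems) (i : Fin (M.elem j).numFacets) (n : Pt d) :
    (M.elem j).FacetBounded i (fun x => inner ℝ (M.extTrace σ j x) n) := by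
  simp only [inner_extTrace]
  exact M.facetBounded_extTrace (fun j => (hσ j).inner continuous_const) j i

/-! ### Points of the skeleton -/

/-- All facets of all elements. -/
abbrev Face : Type := (j : Fin M.numElems) × Fin (M.elem j).numFacets

/-- The point set of a facet. -/
abbrev faceSet (a : M.Face) : Set (Pt d) := (M.elem a.1).facet a.2

/-- The outward unit normal of a facet. -/
abbrev faceNormal (a : M.Face) : Pt d := (M.elem a.1).normal a.2

/-- The points that lie in two non-parallel facet hyperplanes. -/
def ridges : Set (Pt d) :=
  {x | ∃ a b : M.Face, inner ℝ (M.faceNormal a) x = (M.elem a.1).offset a.2 ∧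
    inner ℝ (M.faceNormal b) x = (M.elem b.1).offset b.2 ∧
    M.faceNormal b ≠ M.faceNormal a ∧ M.faceNormal b ≠ -M.faceNormal a}

theorem surf_ridges : surf d M.ridges = 0 := by
  have h : M.ridges ⊆ ⋃ a : M.Face, ⋃ b : M.Face,
      {x | x ∈ ({x | inner ℝ (M.faceNormal a) x = (M.elem a.1).offset a.2}
        ∩ {x | inner ℝ (M.faceNormal b) x = (M.elem b.1).offset b.2} : Set (Pt d)) ∧
        M.faceNormal b ≠ M.faceNormal a ∧ M.faceNormal b ≠ -M.faceNormal a} := by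
    rintro x ⟨a, b, h1, h2, h3⟩
    exact Set.mem_iUnion.2 ⟨a, Set.mem_iUnion.2 ⟨b, ⟨⟨h1, h2⟩, h3⟩⟩⟩
  refine measure_mono_null h (measure_iUnion_null fun a => measure_iUnion_null fun b => ?_)
  by_cases hab : M.faceNormal b ≠ M.faceNormal a ∧ M.faceNormal b ≠ -M.faceNormal a
  · refine measure_mono_null (fun x hx => hx.1)
      (surf_inter_hyperplane_eq_zero ((M.elem a.1).norm_normal a.2) ((M.elem b.1).norm_normal b.2)
        hab.1 hab.2 _ _)
  · exact measure_mono_null (fun x hx => absurd hx.2 hab) measure_empty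

variable {M}

/-- Two facets of one element through x would have non-parallel normals and make x a ridge point. -/
theorem fst_ne_of_mem_faceSet {x : Pt d} (hx : x ∉ M.ridges) {a b : M.Face} (hab : a ≠ b)
    (ha : x ∈ M.faceSet a) (hb : x ∈ M.faceSet b) : a.1 ≠ b.1 := by
  obtain ⟨j, i⟩ := a
  obtain ⟨j', i'⟩ := b
  rintro h
  obtain rfl : j = j' := h
  have hne : i' ≠ i := fun h => hab (by rw [h])
  obtain ⟨h1, h2⟩ := (M.elem j).normal_ne_of_inner_eq hne ha.2 hb.2
  exact hx ⟨⟨j, i⟩, ⟨j, i'⟩, ha.2, hb.2, h1, h2⟩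

/-- Near a point of a single facet an element contains all points on the inner side. -/
theorem eventually_sub_smul_mem_interior {x : Pt d} (hx : x ∉ M.ridges) {a : M.Face}
    (ha : x ∈ M.faceSet a) :
    ∀ᶠ t : ℝ in 𝓝[>] 0, x - t • M.faceNormal a ∈ interior (M.elem a.1).carrier := by
  rw [ConvexPolytope.interior_carrier]
  simp only [Set.mem_ofPred_eq]
  rw [eventually_all]
  intro i
  by_cases hi : i = a.2
  · filter_upwards [self_mem_nhdsWithin] with t ht
    have h := (M.elem a.1).inner_add_smul_normal a.2 x (-t)
    rw [neg_smul, ← sub_eq_add_neg] at h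
    rw [hi, h, ha.2]
    have : 0 < t := ht
    linarith
  · have hne : (⟨a.1, i⟩ : M.Face) ≠ a := by
      obtain ⟨j, i'⟩ := a
      intro h
      exact hi (by simpa using h)
    have hlt : inner ℝ ((M.elem a.1).normal i) x < (M.elem a.1).offset i := by
      refine lt_of_le_of_ne (ha.1 i) fun h => ?_
      exact fst_ne_of_mem_faceSet (a := ⟨a.1, i⟩) hx hne ⟨ha.1, h⟩ ha rfl
    have hc : Continuous fun t : ℝ =>
        inner ℝ ((M.elem a.1).normal i) (x - t • M.faceNormal a) := by fun_prop
    refine (hc.continuousAt.eventually_lt continuousAt_const ?_).filter_mono nhdsWithin_le_nhds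
    simpa using hlt

/-- Off the ridges the normals are parallel; were they equal, both elements would contain the
interior points just behind x, against non-overlap. -/
theorem faceNormal_eq_neg {x : Pt d} (hx : x ∉ M.ridges) {a b : M.Face} (hab : a ≠ b)
    (ha : x ∈ M.faceSet a) (hb : x ∈ M.faceSet b) : M.faceNormal b = -M.faceNormal a := by
  by_contra hneg
  by_cases heq : M.faceNormal b = M.faceNormal a
  · obtain ⟨t, h1, h2⟩ := ((eventually_sub_smul_mem_interior hx ha).and
      (eventually_sub_smul_mem_interior hx hb)).exists
    rw [heq] at h2
    exact Set.disjoint_left.1 (M.nonoverlapping _ _ (fst_ne_of_mem_faceSet hx hab ha hb)) h1 h2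
  · exact hx ⟨a, b, ha.2, hb.2, heq, hneg⟩

/-- Three unit vectors cannot be pairwise opposite. The argument is local, so hanging nodes do no
harm. -/
theorem not_three_faces {x : Pt d} (hx : x ∉ M.ridges) {a b c : M.Face} (hab : a ≠ b)
    (hac : a ≠ c) (hbc : b ≠ c) (ha : x ∈ M.faceSet a) (hb : x ∈ M.faceSet b)
    (hc : x ∈ M.faceSet c) : False := by
  have h1 := faceNormal_eq_neg hx hab ha hb
  have h2 := faceNormal_eq_neg hx hac ha hc
  have h3 := faceNormal_eq_neg hx hbc hb hc
  rw [h1, h2, neg_neg] at h3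
  have h4 : M.faceNormal a = 0 := by
    have h6 : (2 : ℝ) • M.faceNormal a = 0 := by
      rw [two_smul]
      nth_rewrite 1 [← h3]
      exact neg_add_cancel _
    exact (smul_eq_zero.1 h6).resolve_left two_ne_zero
  have h5 := (M.elem a.1).norm_normal a.2
  rw [show (M.elem a.1).normal a.2 = 0 from h4, norm_zero] at h5
  exact zero_ne_one h5

/-- If x were interior to the second element, interior points of the first, which accumulate at x,
would lie in both interiors. -/
theorem exists_face_of_mem {x : Pt d} {j j' : Fin M.numElems} (hj : x ∈ (M.elem j).carrier)
    (hj' : x ∈ (M.elem j').carrier) (hne : j' ≠ j) : ∃ i', x ∈ (M.elem j').facet i' := by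
  refine (M.elem j').mem_facet_of_mem_carrier hj' fun hint => ?_
  rw [← (M.elem j).closure_interior] at hj
  obtain ⟨y, hy, hy'⟩ := mem_closure_iff.1 hj _ isOpen_interior hint
  exact Set.disjoint_left.1 (M.nonoverlapping _ _ hne) hy hy'

variable (M)

/-- The squared traces from inside on a facet. -/
noncomputable def intSq (σ : M.VectorField) (u : M.ScalarField) (a : M.Face) (x : Pt d) : ℝ :=
  inner ℝ (σ a.1 x) (M.faceNormal a) ^ 2 + u a.1 x ^ 2

/-- The squared traces from outside on a facet. -/
noncomputable def extSq (σ : M.VectorField) (u : M.ScalarField) (a : M.Face) (x : Pt d) : ℝ :=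
  inner ℝ (M.extTrace σ a.1 x) (M.faceNormal a) ^ 2 + M.extTrace u a.1 x ^ 2

theorem intSq_nonneg (σ : M.VectorField) (u : M.ScalarField) (a : M.Face) (x : Pt d) :
    0 ≤ M.intSq σ u a x := add_nonneg (sq_nonneg _) (sq_nonneg _)

-- The exterior trace is zero or comes from the only other element through x. The facet of that
-- element has the opposite normal, a sign that the squares do not see.
open Classical in
theorem extSq_le_sum (σ : M.VectorField) (u : M.ScalarField) {x : Pt d} (hx : x ∉ M.ridges)
    {a : M.Face} (ha : x ∈ M.faceSet a) :
    M.extSq σ u a x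
      ≤ ∑ b ∈ (Finset.univ.filter fun b => x ∈ M.faceSet b).erase a, M.intSq σ u b x := by
  have hnonneg : 0 ≤ ∑ b ∈ (Finset.univ.filter fun b => x ∈ M.faceSet b).erase a,
      M.intSq σ u b x := Finset.sum_nonneg fun b _ => M.intSq_nonneg σ u b x
  by_cases hΩ : x ∈ M.Ω
  · by_cases hex : ∃ j', j' ≠ a.1 ∧ x ∈ (M.elem j').carrier
    · obtain ⟨j', hj', hxj'⟩ := hex
      obtain ⟨i', hi'⟩ := exists_face_of_mem ha.1 hxj' hj'
      have hne : a ≠ ⟨j', i'⟩ := fun h => hj' (by rw [h])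
      have hfilter : (Finset.univ.filter fun k => k ≠ a.1 ∧ x ∈ (M.elem k).carrier) = {j'} := by
        ext k
        simp only [Finset.mem_filter, Finset.mem_univ, true_and, Finset.mem_singleton]
        constructor
        · rintro ⟨hk, hxk⟩
          by_contra hkj
          obtain ⟨ik, hik⟩ := exists_face_of_mem ha.1 hxk hk
          refine not_three_faces hx hne (c := ⟨k, ik⟩) (fun h => hk (by rw [h]))
            (fun h => hkj (congrArg Sigma.fst h).symm) ha hi' hik
        · rintro rfl
          exact ⟨hj', hxj'⟩
      have hext : M.extSq σ u a x = M.intSq σ u ⟨j', i'⟩ x := by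
        have h1 := faceNormal_eq_neg hx hne ha hi'
        rw [extSq, intSq, h1, inner_neg_right, neg_sq]
        unfold extTrace
        rw [if_pos hΩ, if_pos hΩ]
        rw [hfilter, Finset.sum_singleton, Finset.sum_singleton]
      rw [hext]
      refine Finset.single_le_sum (f := fun b => M.intSq σ u b x)
        (fun b _ => M.intSq_nonneg σ u b x) ?_
      simp only [Finset.mem_erase, Finset.mem_filter, Finset.mem_univ, true_and]
      exact ⟨hne.symm, hi'⟩
    · push Not at hex
      have hfilter : (Finset.univ.filter fun k => k ≠ a.1 ∧ x ∈ (M.elem k).carrier) = ∅ := by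
        ext k
        simpa using hex k
      have : M.extSq σ u a x = 0 := by
        rw [extSq]
        unfold extTrace
        rw [if_pos hΩ, if_pos hΩ, hfilter]
        simp
      rw [this]; exact hnonneg
  · have : M.extSq σ u a x = 0 := by
      rw [extSq]
      unfold extTrace
      rw [if_neg hΩ, if_neg hΩ]
      simp
    rw [this]; exact hnonneg

-- After exchanging the sums, an interior trace is counted once for every other facet through x,
-- hence at most once.
open Classical in
theorem sum_extSq_le (σ : M.VectorField) (u : M.ScalarField) {x : Pt d} (hx : x ∉ M.ridges) :
    ∑ a, (M.faceSet a).indicator (M.extSq σ u a) x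
      ≤ ∑ a, (M.faceSet a).indicator (M.intSq σ u a) x := by
  simp only [Set.indicator_apply, ← Finset.sum_filter]
  set P := Finset.univ.filter fun b => x ∈ M.faceSet b with hP
  have hmem : ∀ a, a ∈ P ↔ x ∈ M.faceSet a := by simp [hP]
  have hcard : P.card ≤ 2 := by
    by_contra h
    obtain ⟨a, b, c, ha, hb, hc, hab, hac, hbc⟩ := Finset.two_lt_card_iff.1 (not_le.1 h)
    exact not_three_faces hx hab hac hbc ((hmem a).1 ha) ((hmem b).1 hb) ((hmem c).1 hc)
  calc ∑ a ∈ P, M.extSq σ u a x ≤ ∑ a ∈ P, ∑ b ∈ P.erase a, M.intSq σ u b x :=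
        Finset.sum_le_sum fun a ha => M.extSq_le_sum σ u hx ((hmem a).1 ha)
    _ = ∑ b ∈ P, ∑ a ∈ P.erase b, M.intSq σ u b x := by
        refine Finset.sum_comm' fun a b => ?_
        simp only [Finset.mem_erase]
        tauto
    _ ≤ ∑ b ∈ P, M.intSq σ u b x := by
        refine Finset.sum_le_sum fun b hb => ?_
        rw [Finset.sum_const, nsmul_eq_mul]
        refine mul_le_of_le_one_left (M.intSq_nonneg σ u b x) ?_
        rw [Finset.card_erase_of_mem hb]
        exact_mod_cast (by omega : P.card - 1 ≤ 1)

theorem skelNormSq_eq {σ : M.VectorField} {u : M.ScalarField} (hσ : ∀ j, Continuous (σ j))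
    (hu : ∀ j, Continuous (u j)) :
    skelNormSq M σ u = ∑ j, (M.elem j).bdryIntegral (fun i x => M.intSq σ u ⟨j, i⟩ x) := by
  refine Finset.sum_congr rfl fun j _ => ?_
  refine ((M.elem j).bdryIntegral_add (fun i => (M.elem j).integrableOn_facet i ?_)
    (fun i => (M.elem j).integrableOn_facet i ?_)).symm
  · exact (((hσ j).inner continuous_const).pow 2).continuousOn
  · exact ((hu j).pow 2).continuousOn

/-- The traces from outside are controlled by the traces from inside. -/
theorem sum_bdryIntegral_extSq_le {σ : M.VectorField} {u : M.ScalarField}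
    (hσ : ∀ j, Continuous (σ j)) (hu : ∀ j, Continuous (u j)) :
    ∑ j, (M.elem j).bdryIntegral (fun i x => M.extSq σ u ⟨j, i⟩ x) ≤ skelNormSq M σ u := by
  have hint : ∀ a : M.Face, Integrable ((M.faceSet a).indicator (M.intSq σ u a)) (surf d) := by
    intro a
    rw [integrable_indicator_iff ((M.elem a.1).measurableSet_facet a.2)]
    refine (M.elem a.1).integrableOn_facet a.2 (Continuous.continuousOn ?_)
    exact (((hσ a.1).inner continuous_const).pow 2).add ((hu a.1).pow 2)
  have hext : ∀ a : M.Face, Integrable ((M.faceSet a).indicator (M.extSq σ u a)) (surf d) := by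
    intro a
    rw [integrable_indicator_iff ((M.elem a.1).measurableSet_facet a.2)]
    exact ((M.facetBounded_inner_extTrace hσ a.1 a.2 _).sq.add
      (M.facetBounded_extTrace hu a.1 a.2).sq).integrableOn
  -- All facets are merged into a single integral against surface measure, so that the pointwise
  -- comparison off the null set of ridges applies.
  have hsum : ∀ f : M.Face → Pt d → ℝ,
      (∀ a, Integrable ((M.faceSet a).indicator (f a)) (surf d)) →
      ∑ j, (M.elem j).bdryIntegral (fun i x => f ⟨j, i⟩ x)
        = ∫ x, ∑ a, (M.faceSet a).indicator (f a) x ∂(surf d) := by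
    intro f hf
    rw [integral_finsetSum _ fun a _ => hf a, Fintype.sum_sigma]
    refine Finset.sum_congr rfl fun j _ => Finset.sum_congr rfl fun i _ => ?_
    exact (integral_indicator ((M.elem j).measurableSet_facet i)).symm
  rw [M.skelNormSq_eq hσ hu, hsum _ hint, hsum _ hext]
  refine integral_mono_ae (integrable_finsetSum _ fun a _ => hext a)
    (integrable_finsetSum _ fun a _ => hint a) ?_
  have h : ∀ᵐ x ∂(surf d), x ∉ M.ridges := measure_eq_zero_iff_ae_notMem.1 M.surf_ridges
  filter_upwards [h] with x hx using M.sum_extSq_le σ u hx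

end Mesh

/-! ### The constants -/

theorem alpha_sq (b : ℝ) : alpha b ^ 2 = b ^ 2 + 4 := by
  rw [alpha, Real.sq_sqrt (by positivity), sq_abs]

theorem two_le_alpha (b : ℝ) : 2 ≤ alpha b := by
  rw [alpha]
  exact Real.le_sqrt_of_sq_le (by nlinarith [sq_nonneg |b|])

theorem alpha_pos (b : ℝ) : 0 < alpha b := two_pos.trans_le (two_le_alpha b)

theorem alpha_neg (b : ℝ) : alpha (-b) = alpha b := by rw [alpha, alpha, abs_neg]

theorem tau_pos (b : ℝ) : 0 < tau b := by
  have h1 : |b| < alpha b :=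
    abs_lt_of_sq_lt_sq (by rw [alpha_sq]; linarith) (alpha_pos b).le
  rw [tau]
  linarith [le_abs_self b]

theorem tau_neg (b : ℝ) : tau (-b) = tau b + b := by
  rw [tau, tau, alpha_neg]; ring

/-- This is τ⁻τ⁺ = 1, that is (α − b)(α + b) = 4; it is the reason for the 4 under the root. -/
theorem tau_mul_tau_add (b : ℝ) : tau b * (tau b + b) = 1 := by
  have := alpha_sq b
  rw [tau]
  nlinarith

theorem alpha_eq (b : ℝ) : alpha b = 2 * tau b + b := by
  rw [tau]; ring

@[fun_prop]
theorem continuous_alpha : Continuous alpha := by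
  unfold alpha; fun_prop

@[fun_prop]
theorem continuous_tau : Continuous tau := by
  unfold tau; fun_prop

section Bounds

variable {d : ℕ} (M : Mesh d) {β : Pt d → Pt d}

theorem Mesh.carrier_subset_closure (j : Fin M.numElems) : (M.elem j).carrier ⊆ closure M.Ω := by
  rw [M.closure_Ω]
  exact Set.subset_iUnion (fun j => (M.elem j).carrier) j

theorem continuousOn_normalFlux (hβ : ContinuousOn β (closure M.Ω)) (j : Fin M.numElems)
    (i : Fin (M.elem j).numFacets) :
    ContinuousOn (fun x => inner ℝ (β x) ((M.elem j).normal i)) ((M.elem j).facet i) :=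
  (hβ.mono (((M.elem j).facet_subset_carrier i).trans (M.carrier_subset_closure j))).inner
    continuousOn_const

/-- Finitely many compact facets and a continuous flux. Without boundedness `sSup` would take its
default value 0 and bound nothing. -/
theorem exists_traceValues_bound (hβ : ContinuousOn β (closure M.Ω)) {g : ℝ → ℝ}
    (hg : Continuous g) : ∃ C, ∀ r ∈ traceValues M β g, |r| ≤ C := by
  have h : ∀ a : M.Face, ∃ C, ∀ x ∈ M.faceSet a,
      ‖g (inner ℝ (β x) (M.faceNormal a))‖ ≤ C := fun a =>
    ((M.elem a.1).isCompact_facet a.2).exists_bound_of_continuousOn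
      (hg.comp_continuousOn (continuousOn_normalFlux M hβ a.1 a.2))
  choose C hC using h
  refine ⟨∑ a, |C a|, ?_⟩
  rintro r ⟨j, i, x, hx, rfl⟩
  exact (hC ⟨j, i⟩ x hx).trans ((le_abs_self _).trans
    (Finset.single_le_sum (f := fun a => |C a|) (fun _ _ => abs_nonneg _)
      (Finset.mem_univ (⟨j, i⟩ : M.Face))))

theorem le_sSup_traceValues (hβ : ContinuousOn β (closure M.Ω)) {g : ℝ → ℝ}
    (hg : Continuous g) {j : Fin M.numElems} {i : Fin (M.elem j).numFacets} {x : Pt d}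
    (hx : x ∈ (M.elem j).facet i) :
    g (inner ℝ (β x) ((M.elem j).normal i)) ≤ sSup (traceValues M β g) := by
  obtain ⟨C, hC⟩ := exists_traceValues_bound M hβ hg
  exact le_csSup ⟨C, fun r hr => (le_abs_self r).trans (hC r hr)⟩ ⟨j, i, x, hx, rfl⟩

theorem alphaStar_le {j : Fin M.numElems} {i : Fin (M.elem j).numFacets} {x : Pt d}
    (hx : x ∈ (M.elem j).facet i) :
    alphaStar M β ≤ alpha (inner ℝ (β x) ((M.elem j).normal i)) := by
  refine csInf_le ⟨0, ?_⟩ ⟨j, i, x, hx, rfl⟩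
  rintro r ⟨j, i, x, hx, rfl⟩
  exact (alpha_pos _).le

/-- The facet point makes the set of values nonempty; the infimum of the empty set would be 0. -/
theorem alphaStar_pos {j : Fin M.numElems} {i : Fin (M.elem j).numFacets} {x : Pt d}
    (hx : x ∈ (M.elem j).facet i) : 0 < alphaStar M β := by
  refine two_pos.trans_le (le_csInf ⟨_, j, i, x, hx, rfl⟩ ?_)
  rintro r ⟨j, i, x, hx, rfl⟩
  exact two_le_alpha _

end Bounds

/-! ### The boundary terms of the energy identity -/

/-- The pointwise estimate of the boundary terms: `q`, `u` are the new interior traces, `s`, `w` the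
old exterior ones. -/
theorem neg_flux_le {b q u s w ε B T A₀ A₁ : ℝ} (hε : 0 < ε) (hB : |b| ≤ B) (hT : tau b ≤ T)
    (hA₀ : 0 < A₀) (hA₀' : A₀ ≤ alpha b) (hA₁ : alpha b ≤ A₁) :
    -(((q + s) + (b * u - b * w)) / alpha b * (q - tau b * u)
        + (tau b * u + (tau b + b) * w) / alpha b * (q - tau b * u) + (b / 2 + tau b) * u ^ 2)
      ≤ (T + 1) / (2 * ε * A₀) * s ^ 2 + (B + T) * (T + 1) / (2 * ε * A₀) * w ^ 2
        + (ε * (1 + T + B) / (2 * A₀) - 1 / (2 * A₁)) * q ^ 2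
        + (ε * T * (1 + T + B) / (2 * A₀) - 1 / A₁) * u ^ 2 := by
  have ha := alpha_pos b
  have hτ := tau_pos b
  have hBn : 0 ≤ B := (abs_nonneg b).trans hB
  have hTn : 0 < T := hτ.trans_le hT
  have hmul := tau_mul_tau_add b
  have hae := alpha_eq b
  set α := alpha b
  set τ := tau b
  -- Each of the four products is split by Young's inequality with the same ε.
  have hcross : -((q - τ * u) * (s + τ * w)) ≤ ε * (1 + τ) / 2 * q ^ 2
      + ε * τ * (1 + τ) / 2 * u ^ 2 + (1 + τ) / (2 * ε) * s ^ 2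
      + τ * (1 + τ) / (2 * ε) * w ^ 2 := by
    have hy : ∀ y z : ℝ, y * z ≤ ε / 2 * y ^ 2 + 1 / (2 * ε) * z ^ 2 := by
      intro y z
      have h : ε / 2 * y ^ 2 + 1 / (2 * ε) * z ^ 2 - y * z = (ε * y - z) ^ 2 / (2 * ε) := by
        field_simp
        ring
      have h2 : 0 ≤ (ε * y - z) ^ 2 / (2 * ε) := by positivity
      linarith
    have h1 := hy (-q) s
    have h2 := mul_le_mul_of_nonneg_left (hy (-q) w) hτ.le
    have h3 := mul_le_mul_of_nonneg_left (hy u s) hτ.le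
    have h4 := mul_le_mul_of_nonneg_left (hy u w) (mul_pos hτ hτ).le
    have hid : ε * (1 + τ) / 2 * q ^ 2
      + ε * τ * (1 + τ) / 2 * u ^ 2 + (1 + τ) / (2 * ε) * s ^ 2
      + τ * (1 + τ) / (2 * ε) * w ^ 2
      = (ε / 2 * (-q) ^ 2 + 1 / (2 * ε) * s ^ 2) + τ * (ε / 2 * (-q) ^ 2 + 1 / (2 * ε) * w ^ 2)
        + τ * (ε / 2 * u ^ 2 + 1 / (2 * ε) * s ^ 2)
        + τ * τ * (ε / 2 * u ^ 2 + 1 / (2 * ε) * w ^ 2) := by ring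
    rw [hid]
    linarith
  -- By b/2 + τ = α/2, τ(τ + b) = 1 and α² = b² + 4, the terms in the new traces form a sum of
  -- squares, of which (q + bu)² is dropped below.
  have hlhs : -(((q + s) + (b * u - b * w)) / α * (q - τ * u)
        + (τ * u + (τ + b) * w) / α * (q - τ * u) + (b / 2 + τ) * u ^ 2)
      = (-((q + b * u) ^ 2 / 2 + q ^ 2 / 2 + u ^ 2) + -((q - τ * u) * (s + τ * w))) / α := by
    have h1 : α ^ 2 = b ^ 2 + 4 := alpha_sq b
    have h2 : b / 2 + τ = α / 2 := by linarith
    rw [h2, eq_div_iff ha.ne']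
    have h3 : -(((q + s) + (b * u - b * w)) / α * (q - τ * u)
        + (τ * u + (τ + b) * w) / α * (q - τ * u) + α / 2 * u ^ 2) * α
        = -((q + (τ + b) * u + s + τ * w) * (q - τ * u) + α ^ 2 / 2 * u ^ 2) := by
      field_simp
      ring
    rw [h3, h1]
    linear_combination (u ^ 2) * hmul
  have hq : q ^ 2 / (2 * A₁) ≤ q ^ 2 / (2 * α) := by gcongr
  have hu : u ^ 2 / A₁ ≤ u ^ 2 / α := by gcongr
  have hA₁n : 0 < A₁ := ha.trans_le hA₁
  -- In `c1` to `c4`, τ is replaced by its bound and α by its lower bound; the surplus B in τ ≤ B +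
  -- T and 1 + τ ≤ 1 + T + B only matches the form of the constants.
  have c1 : (1 + τ) / (2 * ε) / α ≤ (T + 1) / (2 * ε * A₀) := by
    rw [div_div]
    apply div_le_div₀ <;> first | positivity | nlinarith
  have c2 : τ * (1 + τ) / (2 * ε) / α ≤ (B + T) * (T + 1) / (2 * ε * A₀) := by
    rw [div_div]
    apply div_le_div₀
    · positivity
    · apply mul_le_mul <;> linarith
    · positivity
    · gcongr
  have c3 : ε * (1 + τ) / 2 / α ≤ ε * (1 + T + B) / (2 * A₀) := by
    rw [div_div]
    apply div_le_div₀
    · positivity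
    · exact mul_le_mul_of_nonneg_left (by linarith) hε.le
    · positivity
    · gcongr
  have c4 : ε * τ * (1 + τ) / 2 / α ≤ ε * T * (1 + T + B) / (2 * A₀) := by
    rw [div_div]
    apply div_le_div₀
    · positivity
    · apply mul_le_mul
      · gcongr
      · linarith
      · positivity
      · positivity
    · positivity
    · gcongr
  rw [hlhs]
  calc (-((q + b * u) ^ 2 / 2 + q ^ 2 / 2 + u ^ 2) + -((q - τ * u) * (s + τ * w))) / α
      ≤ (-(q ^ 2 / 2 + u ^ 2) + (ε * (1 + τ) / 2 * q ^ 2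
      + ε * τ * (1 + τ) / 2 * u ^ 2 + (1 + τ) / (2 * ε) * s ^ 2
      + τ * (1 + τ) / (2 * ε) * w ^ 2)) / α := by
        apply div_le_div_of_nonneg_right _ ha.le
        nlinarith [sq_nonneg (q + b * u)]
    _ = -(q ^ 2 / (2 * α)) - u ^ 2 / α + ε * (1 + τ) / 2 / α * q ^ 2
      + ε * τ * (1 + τ) / 2 / α * u ^ 2 + (1 + τ) / (2 * ε) / α * s ^ 2
      + τ * (1 + τ) / (2 * ε) / α * w ^ 2 := by
        field_simp
        ring
    _ ≤ -(q ^ 2 / (2 * A₁)) - u ^ 2 / A₁ + ε * (1 + T + B) / (2 * A₀) * q ^ 2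
      + ε * T * (1 + T + B) / (2 * A₀) * u ^ 2 + (T + 1) / (2 * ε * A₀) * s ^ 2
      + (B + T) * (T + 1) / (2 * ε * A₀) * w ^ 2 := by
        have e1 := mul_le_mul_of_nonneg_right c1 (sq_nonneg s)
        have e2 := mul_le_mul_of_nonneg_right c2 (sq_nonneg w)
        have e3 := mul_le_mul_of_nonneg_right c3 (sq_nonneg q)
        have e4 := mul_le_mul_of_nonneg_right c4 (sq_nonneg u)
        linarith
    _ = _ := by ring

/-! ### The energy identity -/

theorem inner_gradient {d : ℕ} (v : Pt d → ℝ) (x w : Pt d) :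
    inner ℝ w (gradient v x) = fderiv ℝ v x w := by
  rw [gradient, real_inner_comm, InnerProductSpace.toDual_symm_apply]

namespace ConvexPolytope

variable {d : ℕ} (K : ConvexPolytope d)

/-- Integration by parts for smooth functions. -/
theorem integral_mul_divergence_add {s : Pt d → Pt d} {v : Pt d → ℝ} (hs : ContDiff ℝ 1 s)
    (hv : ContDiff ℝ 1 v) :
    (∫ x in K.carrier, v x * divergence s x) + ∫ x in K.carrier, inner ℝ (s x) (gradient v x)
      = K.bdryIntegral (fun i x => v x * inner ℝ (s x) (K.normal i)) := by
  have hc1 : Continuous (divergence s) := continuous_divergence hs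
  have hc2 : Continuous (fderiv ℝ v) := hv.continuous_fderiv (by simp)
  have hcs := hs.continuous
  have hcv := hv.continuous
  have h := K.integral_divergence_of_contDiff (F := fun y => v y • s y) (hv.smul hs)
  have h1 : ∀ x, divergence (fun y => v y • s y) x
      = v x * divergence s x + inner ℝ (s x) (gradient v x) := fun x => by
    rw [divergence_smul (hv.differentiable (by simp) x) (hs.differentiable (by simp) x),
      inner_gradient]
  rw [← integral_add (K.integrableOn_carrier (by fun_prop))
    (K.integrableOn_carrier (by simp only [inner_gradient]; fun_prop))]
  refine (integral_congr_ae (Eventually.of_forall fun x => (h1 x).symm)).trans (h.trans ?_)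
  simp only [real_inner_smul_left]

/-- The convection term, integrated by parts. -/
theorem integral_mul_divergence_smul {β : Pt d → Pt d} {v : Pt d → ℝ}
    (hβ : ContinuousOn β K.carrier) (hβ' : ContDiffOn ℝ 1 β (interior K.carrier))
    (hdiv : IntegrableOn (divergence β) K.carrier) (hv : ContDiff ℝ 1 v) :
    IntegrableOn (fun x => v x * divergence (fun y => v y • β y) x) K.carrier ∧
    ∫ x in K.carrier, v x * divergence (fun y => v y • β y) x
      = (∫ x in K.carrier, divergence β x / 2 * v x ^ 2)
        + K.bdryIntegral (fun i x => inner ℝ (β x) (K.normal i) / 2 * v x ^ 2) := by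
  have hcv := hv.continuous
  have hcd : Continuous (fderiv ℝ v) := hv.continuous_fderiv (by simp)
  have hvd := hv.differentiable (by simp)
  have hae : ∀ᵐ x ∂(volume.restrict K.carrier), x ∈ interior K.carrier := by
    rw [← Measure.restrict_congr_set K.interior_ae_eq]
    exact ae_restrict_mem isOpen_interior.measurableSet
  have hβd : ∀ x ∈ interior K.carrier, DifferentiableAt ℝ β x := fun x hx =>
    (hβ'.differentiableOn (by simp)).differentiableAt (isOpen_interior.mem_nhds hx)
  have hint1 : IntegrableOn (fun x => divergence β x * v x ^ 2) K.carrier :=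
    hdiv.mul_continuousOn (hcv.pow 2).continuousOn K.isCompact_carrier
  have hint2 : IntegrableOn (fun x => v x * fderiv ℝ v x (β x)) K.carrier :=
    (hcv.continuousOn.mul (hcd.continuousOn.clm_apply hβ)).integrableOn_compact
      K.isCompact_carrier
  -- `h1` and `h2` together give v ∇·(vβ) = ½∇·(v²β) + ½v²∇·β. They hold in the interior, where β is
  -- differentiable, hence almost everywhere.
  have h1 : (fun x => v x * divergence (fun y => v y • β y) x)
      =ᵐ[volume.restrict K.carrier] fun x =>
        divergence β x * v x ^ 2 + v x * fderiv ℝ v x (β x) := by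
    filter_upwards [hae] with x hx
    rw [divergence_smul (hvd x) (hβd x hx)]
    ring
  have h2 : divergence (fun y => v y ^ 2 • β y)
      =ᵐ[volume.restrict K.carrier] fun x =>
        divergence β x * v x ^ 2 + 2 * (v x * fderiv ℝ v x (β x)) := by
    filter_upwards [hae] with x hx
    have h3 : HasFDerivAt (fun y => v y ^ 2) _ x := (hvd x).hasFDerivAt.pow 2
    rw [divergence_smul h3.differentiableAt (hβd x hx), h3.fderiv]
    simp only [smul_apply, smul_eq_mul, nsmul_eq_mul]
    push_cast
    ring
  have hF := K.integral_divergence (F := fun y => v y ^ 2 • β y)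
    ((hcv.pow 2).continuousOn.smul hβ) ((hv.pow 2).contDiffOn.smul hβ')
    (IntegrableOn.congr_fun_ae (hint1.add (hint2.const_mul 2)) h2.symm)
  rw [integral_congr_ae h2, integral_add hint1 (hint2.const_mul 2), integral_const_mul] at hF
  refine ⟨IntegrableOn.congr_fun_ae (hint1.add hint2) h1.symm, ?_⟩
  rw [integral_congr_ae h1, integral_add hint1 hint2]
  have h4 : ∀ x, divergence β x / 2 * v x ^ 2 = (1 / 2) * (divergence β x * v x ^ 2) :=
    fun x => by ring
  have h5 : ∀ (i : Fin K.numFacets) (x : Pt d), inner ℝ (β x) (K.normal i) / 2 * v x ^ 2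
      = (1 / 2) * inner ℝ (v x ^ 2 • β x) (K.normal i) := fun i x => by
    rw [real_inner_smul_left]; ring
  simp only [h4, h5]
  rw [integral_const_mul, K.bdryIntegral_const_mul, ← hF]
  ring

end ConvexPolytope

section Energy

variable {d : ℕ} {M : Mesh d} {p : ℕ} {κ lam : ℝ} {β : Pt d → Pt d} {ν : Pt d → ℝ}
  {σ σ' : M.VectorField} {u u' : M.ScalarField}

/-- The boundary terms of the energy identity. -/
noncomputable def flux (M : Mesh d) (β : Pt d → Pt d) (σ : M.VectorField) (u : M.ScalarField)
    (σ' : M.VectorField) (u' : M.ScalarField) (j : Fin M.numElems)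
    (i : Fin (M.elem j).numFacets) (x : Pt d) : ℝ :=
  uHat M β σ u σ' u' j i x * (inner ℝ (σ' j x) ((M.elem j).normal i)
      - tau (inner ℝ (β x) ((M.elem j).normal i)) * u' j x)
    + (inner ℝ (β x) ((M.elem j).normal i) / 2
      + tau (inner ℝ (β x) ((M.elem j).normal i))) * u' j x ^ 2

theorem facetBounded_uHat (hβ : ContinuousOn β (closure M.Ω)) (hσ : ∀ j, Continuous (σ j))
    (hu : ∀ j, Continuous (u j)) (hσ' : ∀ j, Continuous (σ' j)) (hu' : ∀ j, Continuous (u' j))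
    (j : Fin M.numElems) (i : Fin (M.elem j).numFacets) :
    (M.elem j).FacetBounded i (uHat M β σ u σ' u' j i) := by
  have hb := continuousOn_normalFlux M hβ j i
  have hb' : ContinuousOn (fun x => inner ℝ (β x) (-(M.elem j).normal i))
      ((M.elem j).facet i) := by
    simp only [inner_neg_right]
    exact hb.neg
  have h1 : (M.elem j).FacetBounded i
      (fun x => (alpha (inner ℝ (β x) ((M.elem j).normal i)))⁻¹) :=
    .of_continuousOn ((continuous_alpha.comp_continuousOn hb).inv₀ fun x _ => (alpha_pos _).ne')
  have h2 : (M.elem j).FacetBounded i (fun x => inner ℝ (σ' j x) ((M.elem j).normal i)) :=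
    .of_continuousOn ((hσ' j).inner continuous_const).continuousOn
  have h3 : (M.elem j).FacetBounded i (u' j) := .of_continuousOn (hu' j).continuousOn
  have h4 := M.facetBounded_inner_extTrace hσ j i (-(M.elem j).normal i)
  have h5 := M.facetBounded_extTrace hu j i
  have h6 := ConvexPolytope.FacetBounded.of_continuousOn hb
  have h7 := ConvexPolytope.FacetBounded.of_continuousOn hb'
  have h8 := ConvexPolytope.FacetBounded.of_continuousOn (continuous_tau.comp_continuousOn hb)
  have h9 := ConvexPolytope.FacetBounded.of_continuousOn (continuous_tau.comp_continuousOn hb')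
  unfold uHat
  simp only [div_eq_mul_inv]
  exact ((((h2.add h4).add ((h6.mul h3).add (h7.mul h5))).mul h1)).add
    (((h8.mul h3).add (h9.mul h5)).mul h1)

/-- The new iterate serves as its own test function. Integration by parts turns the mixed terms of
σ' and u' into a boundary term, and the convection term into half the divergence of β plus half its
boundary flux. -/
theorem IsIHDGStep.energy_identity (hstep : IsIHDGStep M p κ β ν σ u σ' u')
    (hσ : ∀ j, Continuous (σ j)) (hu : ∀ j, Continuous (u j))
    (hβ_cont : ContinuousOn β (closure M.Ω))
    (hβ_diff : ∀ j, ContDiffOn ℝ 1 β (interior (M.elem j).carrier))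
    (hβ_div : IntegrableOn (divergence β) M.Ω) (hν : IntegrableOn ν M.Ω) (j : Fin M.numElems) :
    κ⁻¹ * (∫ x in (M.elem j).carrier, ‖σ' j x‖ ^ 2)
      + (∫ x in (M.elem j).carrier, (ν x - divergence β x / 2) * u' j x ^ 2)
      = -(M.elem j).bdryIntegral (flux M β σ u σ' u' j) := by
  set K := M.elem j with hK
  -- Only the interior of an element is known to lie in Ω; the rest of the element is null.
  have hsub : ∀ f : Pt d → ℝ, IntegrableOn f M.Ω → IntegrableOn f K.carrier := fun f hf =>
    (hf.mono_set (M.interior_subset j)).congr_set_ae K.interior_ae_eq.symm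
  have hσ' : ∀ j, Continuous (σ' j) := fun j => (hstep.poly_σ j).continuous
  have hu' : ∀ j, Continuous (u' j) := fun j => (hstep.poly_u j).continuous
  have hs1 : ContDiff ℝ 1 (σ' j) := (hstep.poly_σ j).contDiff 1
  have hv1 : ContDiff ℝ 1 (u' j) := (hstep.poly_u j).contDiff 1
  have hU := facetBounded_uHat hβ_cont hσ hu hσ' hu' j
  have hb := fun i => ConvexPolytope.FacetBounded.of_continuousOn
    (continuousOn_normalFlux M hβ_cont j i)
  have hτ := fun i => ConvexPolytope.FacetBounded.of_continuousOn
    (continuous_tau.comp_continuousOn (continuousOn_normalFlux M hβ_cont j i))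
  have hq : ∀ i, K.FacetBounded i (fun x => inner ℝ (σ' j x) (K.normal i)) := fun i =>
    .of_continuousOn ((hσ' j).inner continuous_const).continuousOn
  have hv : ∀ i, K.FacetBounded i (u' j) := fun i => .of_continuousOn (hu' j).continuousOn
  have e1 := hstep.eq_σ j (σ' j) (hstep.poly_σ j)
  have e2 := hstep.eq_u j (u' j) (hstep.poly_u j)
  have e3 := K.integral_mul_divergence_add hs1 hv1
  obtain ⟨i4, e4⟩ := K.integral_mul_divergence_smul
    (hβ_cont.mono (M.carrier_subset_closure j)) (hβ_diff j) (hsub _ hβ_div) hv1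
  have hνv : IntegrableOn (fun x => ν x * u' j x ^ 2) K.carrier :=
    (hsub _ hν).mul_continuousOn ((hu' j).pow 2).continuousOn K.isCompact_carrier
  have hβv : IntegrableOn (fun x => divergence β x / 2 * u' j x ^ 2) K.carrier :=
    IntegrableOn.mul_continuousOn ((hsub _ hβ_div).div_const 2) ((hu' j).pow 2).continuousOn
      K.isCompact_carrier
  have h5 : (∫ x in K.carrier,
      u' j x * (divergence (fun y => u' j y • β y) x - ν x * u' j x))
      = (∫ x in K.carrier, u' j x * divergence (fun y => u' j y • β y) x)
        - ∫ x in K.carrier, ν x * u' j x ^ 2 := by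
    rw [← integral_sub i4 hνv]
    refine integral_congr_ae (Eventually.of_forall fun x => ?_)
    simp only
    ring
  have h6 : (∫ x in K.carrier, (ν x - divergence β x / 2) * u' j x ^ 2)
      = (∫ x in K.carrier, ν x * u' j x ^ 2)
        - ∫ x in K.carrier, divergence β x / 2 * u' j x ^ 2 := by
    rw [← integral_sub hνv hβv]
    refine integral_congr_ae (Eventually.of_forall fun x => ?_)
    simp only
    ring
  have i1 : ∀ i, K.FacetBounded i
      (fun x => uHat M β σ u σ' u' j i x * inner ℝ (σ' j x) (K.normal i)) := fun i =>
    (hU i).mul (hq i)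
  have i2 : ∀ i, K.FacetBounded i (fun x =>
      (inner ℝ (β x) (K.normal i) * u' j x + inner ℝ (σ' j x) (K.normal i)
        + tau (inner ℝ (β x) (K.normal i)) * (u' j x - uHat M β σ u σ' u' j i x)) * u' j x) :=
    fun i => ((((hb i).mul (hv i)).add (hq i)).add ((hτ i).mul ((hv i).sub (hU i)))).mul (hv i)
  have i3 : ∀ i, K.FacetBounded i (fun x => -1 * (u' j x * inner ℝ (σ' j x) (K.normal i))) :=
    fun i => ((hv i).mul (hq i)).const_mul (-1)
  have i5 : ∀ i, K.FacetBounded i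
      (fun x => -1 * (inner ℝ (β x) (K.normal i) / 2 * u' j x ^ 2)) := fun i => by
    have := ((hb i).const_mul (2⁻¹)).mul (hv i).sq
    refine ConvexPolytope.FacetBounded.const_mul ?_ (-1)
    simpa only [div_eq_inv_mul] using this
  have hflux : K.bdryIntegral (flux M β σ u σ' u' j)
      = K.bdryIntegral (fun i x => uHat M β σ u σ' u' j i x * inner ℝ (σ' j x) (K.normal i))
        + K.bdryIntegral (fun i x =>
          (inner ℝ (β x) (K.normal i) * u' j x + inner ℝ (σ' j x) (K.normal i)
            + tau (inner ℝ (β x) (K.normal i)) * (u' j x - uHat M β σ u σ' u' j i x)) * u' j x)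
        + -1 * K.bdryIntegral (fun i x => u' j x * inner ℝ (σ' j x) (K.normal i))
        + -1 * K.bdryIntegral (fun i x => inner ℝ (β x) (K.normal i) / 2 * u' j x ^ 2) := by
    rw [← K.bdryIntegral_const_mul, ← K.bdryIntegral_const_mul,
      ← K.bdryIntegral_add (fun i => (i1 i).integrableOn) (fun i => (i2 i).integrableOn),
      ← K.bdryIntegral_add (fun i => ((i1 i).add (i2 i)).integrableOn)
        (fun i => (i3 i).integrableOn),
      ← K.bdryIntegral_add (fun i => (((i1 i).add (i2 i)).add (i3 i)).integrableOn)
        (fun i => (i5 i).integrableOn)]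
    congr 1
    ext i x
    rw [flux]
    ring
  have hnorm : (∫ x in K.carrier, ‖σ' j x‖ ^ 2)
      = ∫ x in K.carrier, inner ℝ (σ' j x) (σ' j x) := by
    simp only [real_inner_self_eq_norm_sq]
  rw [hflux, hnorm, h6]
  rw [h5, e4] at e2
  linarith

end Energy

/-! ### The estimate for one step -/

section Constants

variable {d : ℕ} (M : Mesh d) (β : Pt d → Pt d)

theorem betaBar_nonneg : 0 ≤ betaBar M β :=
  Real.sSup_nonneg (by rintro r ⟨j, i, x, -, rfl⟩; exact abs_nonneg _)

theorem tauBar_nonneg : 0 ≤ tauBar M β :=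
  Real.sSup_nonneg (by rintro r ⟨j, i, x, -, rfl⟩; exact (tau_pos _).le)

theorem alphaBar_nonneg : 0 ≤ alphaBar M β :=
  Real.sSup_nonneg (by rintro r ⟨j, i, x, -, rfl⟩; exact (alpha_pos _).le)

theorem alphaStar_nonneg : 0 ≤ alphaStar M β :=
  Real.sInf_nonneg (by rintro r ⟨j, i, x, -, rfl⟩; exact (alpha_pos _).le)

theorem constC2_nonneg {ε : ℝ} (hε : 0 < ε) : 0 ≤ constC2 M β ε := by
  have h1 := tauBar_nonneg M β
  have h2 := alphaStar_nonneg M β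
  unfold constC2
  positivity

theorem constA_nonneg {ε : ℝ} (hε : 0 < ε) : 0 ≤ constA M β ε :=
  (constC2_nonneg M β hε).trans (le_max_right _ _)

theorem constC4_nonneg {ε : ℝ} (hε : 0 < ε) : 0 ≤ constC4 M β ε := by
  have h1 := tauBar_nonneg M β
  have h2 := alphaStar_nonneg M β
  have h3 := betaBar_nonneg M β
  unfold constC4
  positivity

theorem Mesh.h_nonneg : 0 ≤ M.h := Real.iSup_nonneg fun _ => Metric.diam_nonneg

end Constants

/-- The squared `L²` norm of the normal traces. -/
noncomputable def normalSkelSq {d : ℕ} (M : Mesh d) (σ : M.VectorField) : ℝ :=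
  ∑ j, (M.elem j).bdryIntegral (fun i x => inner ℝ (σ j x) ((M.elem j).normal i) ^ 2)

/-- The squared `L²` norm of the scalar traces. -/
noncomputable def scalarSkelSq {d : ℕ} (M : Mesh d) (u : M.ScalarField) : ℝ :=
  ∑ j, (M.elem j).bdryIntegral (fun _ x => u j x ^ 2)

/-- The squared `L²` norm of a piecewise vector field. -/
noncomputable def vectorVolSq {d : ℕ} (M : Mesh d) (σ : M.VectorField) : ℝ :=
  ∑ j, ∫ x in (M.elem j).carrier, ‖σ j x‖ ^ 2

/-- The squared `L²` norm of a piecewise scalar field. -/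
noncomputable def scalarVolSq {d : ℕ} (M : Mesh d) (u : M.ScalarField) : ℝ :=
  ∑ j, ∫ x in (M.elem j).carrier, u j x ^ 2

section Norms

variable {d : ℕ} (M : Mesh d)

theorem skelNormSq_eq_add (σ : M.VectorField) (u : M.ScalarField) :
    skelNormSq M σ u = normalSkelSq M σ + scalarSkelSq M u := Finset.sum_add_distrib

theorem volNormSq_eq_add (σ : M.VectorField) (u : M.ScalarField) :
    volNormSq M σ u = vectorVolSq M σ + scalarVolSq M u := Finset.sum_add_distrib

theorem normalSkelSq_nonneg (σ : M.VectorField) : 0 ≤ normalSkelSq M σ :=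
  Finset.sum_nonneg fun _ _ => ConvexPolytope.bdryIntegral_nonneg _ fun _ _ _ => sq_nonneg _

theorem scalarSkelSq_nonneg (u : M.ScalarField) : 0 ≤ scalarSkelSq M u :=
  Finset.sum_nonneg fun _ _ => ConvexPolytope.bdryIntegral_nonneg _ fun _ _ _ => sq_nonneg _

theorem vectorVolSq_nonneg (σ : M.VectorField) : 0 ≤ vectorVolSq M σ :=
  Finset.sum_nonneg fun _ _ => integral_nonneg fun _ => sq_nonneg _

theorem scalarVolSq_nonneg (u : M.ScalarField) : 0 ≤ scalarVolSq M u :=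
  Finset.sum_nonneg fun _ _ => integral_nonneg fun _ => sq_nonneg _

theorem skelNormSq_nonneg (σ : M.VectorField) (u : M.ScalarField) : 0 ≤ skelNormSq M σ u := by
  rw [skelNormSq_eq_add]
  exact add_nonneg (normalSkelSq_nonneg M σ) (scalarSkelSq_nonneg M u)

theorem volNormSq_nonneg (σ : M.VectorField) (u : M.ScalarField) : 0 ≤ volNormSq M σ u := by
  rw [volNormSq_eq_add]
  exact add_nonneg (vectorVolSq_nonneg M σ) (scalarVolSq_nonneg M u)

end Norms

section Step

variable {d : ℕ} {M : Mesh d} {p : ℕ} {κ lam c ε : ℝ} {β : Pt d → Pt d} {ν : Pt d → ℝ}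
  {σ σ' : M.VectorField} {u u' : M.ScalarField}

/-- |F·n|² ≤ |F|² = ΣF_k², and the scalar inequality applies to each component; no factor is lost.
-/
theorem ConvexPolytope.trace_inequality_normal (K : ConvexPolytope d) (hd : 1 ≤ d)
    {F : Pt d → Pt d} (hF : IsVecPoly p F) {x₀ : Pt d} {r : ℝ}
    (hball : Metric.ball x₀ r ⊆ K.carrier) (hr : 0 ≤ r) :
    2 * r / ((d : ℝ) * ((p : ℝ) + 1) * ((p : ℝ) + 2))
        * K.bdryIntegral (fun i x => inner ℝ (F x) (K.normal i) ^ 2)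
      ≤ ∫ x in K.carrier, ‖F x‖ ^ 2 := by
  have hc : ∀ k, Continuous fun x => F x k := fun k => (hF k).continuous
  have hnorm : ∀ x, ‖F x‖ ^ 2 = ∑ k, F x k ^ 2 := fun x => EuclideanSpace.real_norm_sq_eq _
  have h1 : K.bdryIntegral (fun i x => inner ℝ (F x) (K.normal i) ^ 2)
      ≤ ∑ k, K.bdryIntegral (fun _ x => F x k ^ 2) := by
    have h2 : ∑ k, K.bdryIntegral (fun _ x => F x k ^ 2)
        = K.bdryIntegral (fun _ x => ‖F x‖ ^ 2) := by
      simp only [bdryIntegral, hnorm]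
      rw [Finset.sum_comm]
      refine Finset.sum_congr rfl fun i _ => (integral_finsetSum _ fun k _ => ?_).symm
      exact K.integrableOn_facet i ((hc k).pow 2).continuousOn
    rw [h2]
    refine K.bdryIntegral_mono
      (fun i => K.integrableOn_facet i ((hF.continuous.inner continuous_const).pow 2).continuousOn)
      (fun i => K.integrableOn_facet i (hF.continuous.norm.pow 2).continuousOn) fun i x _ => ?_
    rw [← sq_abs]
    have := abs_real_inner_le_norm (F x) (K.normal i)
    rw [K.norm_normal, mul_one] at this
    gcongr
  have hγ : 0 ≤ 2 * r / ((d : ℝ) * ((p : ℝ) + 1) * ((p : ℝ) + 2)) := by positivity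
  refine (mul_le_mul_of_nonneg_left h1 hγ).trans ?_
  simp only [hnorm]
  have hint : ∀ k, IntegrableOn (fun x => F x k ^ 2) K.carrier := fun k =>
    K.integrableOn_carrier ((hc k).pow 2)
  rw [Finset.mul_sum, integral_finsetSum _ fun k _ => hint k]
  exact Finset.sum_le_sum fun k _ => K.trace_inequality hd (hF k) hball

theorem neg_flux_le_extSq (hε : 0 < ε) (hβ_cont : ContinuousOn β (closure M.Ω))
    (σ σ' : M.VectorField) (u u' : M.ScalarField) (j : Fin M.numElems)
    (i : Fin (M.elem j).numFacets) {x : Pt d} (hx : x ∈ (M.elem j).facet i) :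
    -flux M β σ u σ' u' j i x ≤ constA M β ε * M.extSq σ u ⟨j, i⟩ x
      + (constC4 M β ε - 1 / (2 * alphaBar M β)) * inner ℝ (σ' j x) ((M.elem j).normal i) ^ 2
      + (constC3 M β ε - 1 / alphaBar M β) * u' j x ^ 2 := by
  have h := neg_flux_le (b := inner ℝ (β x) ((M.elem j).normal i))
    (q := inner ℝ (σ' j x) ((M.elem j).normal i)) (u := u' j x)
    -- The old flux is taken against n⁺ = −n, hence the sign.
    (s := -inner ℝ (M.extTrace σ j x) ((M.elem j).normal i)) (w := M.extTrace u j x) hε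
    (le_sSup_traceValues M hβ_cont continuous_abs hx)
    (le_sSup_traceValues M hβ_cont continuous_tau hx)
    (alphaStar_pos M hx) (alphaStar_le M hx)
    (le_sSup_traceValues M hβ_cont continuous_alpha hx)
  rw [neg_sq] at h
  have h1 : constC2 M β ε * inner ℝ (M.extTrace σ j x) ((M.elem j).normal i) ^ 2
      ≤ constA M β ε * inner ℝ (M.extTrace σ j x) ((M.elem j).normal i) ^ 2 :=
    mul_le_mul_of_nonneg_right (le_max_right _ _) (sq_nonneg _)
  have h2 : constC1 M β ε * M.extTrace u j x ^ 2 ≤ constA M β ε * M.extTrace u j x ^ 2 :=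
    mul_le_mul_of_nonneg_right (le_max_left _ _) (sq_nonneg _)
  have hflux : flux M β σ u σ' u' j i x
      = ((inner ℝ (σ' j x) ((M.elem j).normal i)
            + -inner ℝ (M.extTrace σ j x) ((M.elem j).normal i))
          + (inner ℝ (β x) ((M.elem j).normal i) * u' j x
            - inner ℝ (β x) ((M.elem j).normal i) * M.extTrace u j x))
          / alpha (inner ℝ (β x) ((M.elem j).normal i))
          * (inner ℝ (σ' j x) ((M.elem j).normal i)
            - tau (inner ℝ (β x) ((M.elem j).normal i)) * u' j x)
        + (tau (inner ℝ (β x) ((M.elem j).normal i)) * u' j x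
          + (tau (inner ℝ (β x) ((M.elem j).normal i)) + inner ℝ (β x) ((M.elem j).normal i))
            * M.extTrace u j x) / alpha (inner ℝ (β x) ((M.elem j).normal i))
          * (inner ℝ (σ' j x) ((M.elem j).normal i)
            - tau (inner ℝ (β x) ((M.elem j).normal i)) * u' j x)
        + (inner ℝ (β x) ((M.elem j).normal i) / 2
          + tau (inner ℝ (β x) ((M.elem j).normal i))) * u' j x ^ 2 := by
    simp only [flux, uHat, inner_neg_right, tau_neg]
    ring
  rw [hflux, Mesh.extSq, mul_add]
  simp only [constC1, constC2, betaBar, tauBar, alphaBar, constC3, constC4] at h h1 h2 ⊢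
  linarith

/-- Coercivity bounds the left side of the energy identity and the pointwise flux estimate its right
side. The skeleton coefficients may have either sign; only 𝓐 ≥ 0 matters, for replacing exterior by
interior traces. -/
theorem IsIHDGStep.energy_estimate (hε : 0 < ε) (hstep : IsIHDGStep M p κ β ν σ u σ' u')
    (hσ : ∀ j, Continuous (σ j)) (hu : ∀ j, Continuous (u j))
    (hβ_cont : ContinuousOn β (closure M.Ω))
    (hβ_diff : ∀ j, ContDiffOn ℝ 1 β (interior (M.elem j).carrier))
    (hβ_div : IntegrableOn (divergence β) M.Ω) (hν : IntegrableOn ν M.Ω)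
    (hcoer : ∀ᵐ x ∂(volume.restrict M.Ω), lam ≤ ν x - divergence β x / 2) :
    κ⁻¹ * vectorVolSq M σ' + lam * scalarVolSq M u'
        + (1 / (2 * alphaBar M β) - constC4 M β ε) * normalSkelSq M σ'
        + (1 / alphaBar M β - constC3 M β ε) * scalarSkelSq M u'
      ≤ constA M β ε * skelNormSq M σ u := by
  have hσ' : ∀ j, Continuous (σ' j) := fun j => (hstep.poly_σ j).continuous
  have hu' : ∀ j, Continuous (u' j) := fun j => (hstep.poly_u j).continuous
  have hloc : ∀ j, κ⁻¹ * (∫ x in (M.elem j).carrier, ‖σ' j x‖ ^ 2)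
      + lam * (∫ x in (M.elem j).carrier, u' j x ^ 2)
      ≤ constA M β ε * (M.elem j).bdryIntegral (fun i x => M.extSq σ u ⟨j, i⟩ x)
      + (constC4 M β ε - 1 / (2 * alphaBar M β))
        * (M.elem j).bdryIntegral (fun i x => inner ℝ (σ' j x) ((M.elem j).normal i) ^ 2)
      + (constC3 M β ε - 1 / alphaBar M β)
        * (M.elem j).bdryIntegral (fun _ x => u' j x ^ 2) := by
    intro j
    set K := M.elem j
    have hint : IntegrableOn (fun x => ν x - divergence β x / 2) K.carrier := by
      have h : IntegrableOn (fun x => ν x - divergence β x / 2) M.Ω :=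
        hν.sub (hβ_div.div_const 2)
      exact (h.mono_set (M.interior_subset j)).congr_set_ae K.interior_ae_eq.symm
    have hae : ∀ᵐ x ∂(volume.restrict K.carrier), lam ≤ ν x - divergence β x / 2 := by
      rw [← Measure.restrict_congr_set K.interior_ae_eq]
      exact ae_restrict_of_ae_restrict_of_subset (M.interior_subset j) hcoer
    have hvol : lam * (∫ x in K.carrier, u' j x ^ 2)
        ≤ ∫ x in K.carrier, (ν x - divergence β x / 2) * u' j x ^ 2 := by
      rw [← integral_const_mul]
      refine integral_mono_ae (K.integrableOn_carrier (continuous_const.mul ((hu' j).pow 2)))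
        (hint.mul_continuousOn ((hu' j).pow 2).continuousOn K.isCompact_carrier) ?_
      filter_upwards [hae] with x hx
      exact mul_le_mul_of_nonneg_right hx (sq_nonneg _)
    have hid := hstep.energy_identity hσ hu hβ_cont hβ_diff hβ_div hν j
    have hq : ∀ i, K.FacetBounded i (fun x => inner ℝ (σ' j x) (K.normal i)) := fun i =>
      .of_continuousOn ((hσ' j).inner continuous_const).continuousOn
    have hv : ∀ i, K.FacetBounded i (u' j) := fun i => .of_continuousOn (hu' j).continuousOn
    have hb := fun i => ConvexPolytope.FacetBounded.of_continuousOn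
      (continuousOn_normalFlux M hβ_cont j i)
    have hτ := fun i => ConvexPolytope.FacetBounded.of_continuousOn
      (continuous_tau.comp_continuousOn (continuousOn_normalFlux M hβ_cont j i))
    have hflux : ∀ i, K.FacetBounded i (flux M β σ u σ' u' j i) := fun i => by
      have hb2 := (hb i).const_mul 2⁻¹
      simp only [← div_eq_inv_mul] at hb2
      exact ((facetBounded_uHat hβ_cont hσ hu hσ' hu' j i).mul
        ((hq i).sub ((hτ i).mul (hv i)))).add ((hb2.add (hτ i)).mul (hv i).sq)
    have hext : ∀ i, K.FacetBounded i (M.extSq σ u ⟨j, i⟩) := fun i =>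
      (M.facetBounded_inner_extTrace hσ j i _).sq.add (M.facetBounded_extTrace hu j i).sq
    have hA : ∀ i, K.FacetBounded i (fun x => constA M β ε * M.extSq σ u ⟨j, i⟩ x) :=
      fun i => (hext i).const_mul _
    have hQ : ∀ i, K.FacetBounded i (fun x => (constC4 M β ε - 1 / (2 * alphaBar M β))
        * inner ℝ (σ' j x) (K.normal i) ^ 2) := fun i => (hq i).sq.const_mul _
    have hW : ∀ i, K.FacetBounded i (fun x => (constC3 M β ε - 1 / alphaBar M β)
        * u' j x ^ 2) := fun i => (hv i).sq.const_mul _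
    have hbd : -1 * K.bdryIntegral (flux M β σ u σ' u' j)
        ≤ constA M β ε * K.bdryIntegral (fun i x => M.extSq σ u ⟨j, i⟩ x)
          + (constC4 M β ε - 1 / (2 * alphaBar M β))
            * K.bdryIntegral (fun i x => inner ℝ (σ' j x) (K.normal i) ^ 2)
          + (constC3 M β ε - 1 / alphaBar M β) * K.bdryIntegral (fun _ x => u' j x ^ 2) := by
      rw [← K.bdryIntegral_const_mul, ← K.bdryIntegral_const_mul, ← K.bdryIntegral_const_mul,
        ← K.bdryIntegral_const_mul,
        ← K.bdryIntegral_add (fun i => (hA i).integrableOn) (fun i => (hQ i).integrableOn),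
        ← K.bdryIntegral_add (fun i => ((hA i).add (hQ i)).integrableOn)
          (fun i => (hW i).integrableOn)]
      refine K.bdryIntegral_mono (fun i => ((hflux i).const_mul (-1)).integrableOn)
        (fun i => (((hA i).add (hQ i)).add (hW i)).integrableOn) fun i x hx => ?_
      rw [neg_one_mul]
      exact neg_flux_le_extSq hε hβ_cont σ σ' u u' j i hx
    linarith
  have hsum := Finset.sum_le_sum fun j (_ : j ∈ Finset.univ) => hloc j
  simp only [Finset.sum_add_distrib, ← Finset.mul_sum] at hsum
  have hext := mul_le_mul_of_nonneg_left (M.sum_bdryIntegral_extSq_le hσ hu)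
    (constA_nonneg M β hε)
  simp only [vectorVolSq, scalarVolSq, normalSkelSq, scalarSkelSq]
  linarith

/-- One step contracts the skeleton norm. -/
theorem constB_mul_skelNormSq_le (hd : 1 ≤ d) (hκ : 0 < κ) (hlam : 0 < lam) (hc0 : 0 < c)
    (hreg : ∀ j, ∃ x₀ : Pt d, Metric.ball x₀ (c * M.h) ⊆ (M.elem j).carrier)
    (hσ' : ∀ j, IsVecPoly p (σ' j)) (hu' : ∀ j, IsPoly p (u' j)) :
    constB M p κ lam β c ε * skelNormSq M σ' u'
      ≤ κ⁻¹ * vectorVolSq M σ' + lam * scalarVolSq M u'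
        + (1 / (2 * alphaBar M β) - constC4 M β ε) * normalSkelSq M σ'
        + (1 / alphaBar M β - constC3 M β ε) * scalarSkelSq M u' := by
  choose x₀ hx₀ using hreg
  have hr : 0 ≤ c * M.h := mul_nonneg hc0.le M.h_nonneg
  set γ := 2 * (c * M.h) / ((d : ℝ) * ((p : ℝ) + 1) * ((p : ℝ) + 2)) with hγ
  have h1 : γ * normalSkelSq M σ' ≤ vectorVolSq M σ' := by
    rw [normalSkelSq, Finset.mul_sum]
    exact Finset.sum_le_sum fun j _ =>
      (M.elem j).trace_inequality_normal hd (hσ' j) (hx₀ j) hr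
  have h2 : γ * scalarSkelSq M u' ≤ scalarVolSq M u' := by
    rw [scalarSkelSq, Finset.mul_sum]
    exact Finset.sum_le_sum fun j _ => (M.elem j).trace_inequality hd (hu' j) (hx₀ j)
  have h3 := mul_le_mul_of_nonneg_left h1 (inv_pos.2 hκ).le
  have h4 := mul_le_mul_of_nonneg_left h2 hlam.le
  -- 𝓑₁ and 𝓑₂ are the trace-inequality gain plus the skeleton coefficients of the energy estimate.
  have hB1 : constB1 M p κ β c ε = κ⁻¹ * γ + (1 / (2 * alphaBar M β) - constC4 M β ε) := by
    rw [constB1, hγ]; ring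
  have hB2 : constB2 M p lam β c ε = lam * γ + (1 / alphaBar M β - constC3 M β ε) := by
    rw [constB2, hγ]; ring
  have h5 : constB M p κ lam β c ε * normalSkelSq M σ'
      ≤ constB1 M p κ β c ε * normalSkelSq M σ' :=
    mul_le_mul_of_nonneg_right (min_le_left _ _) (normalSkelSq_nonneg M σ')
  have h6 : constB M p κ lam β c ε * scalarSkelSq M u'
      ≤ constB2 M p lam β c ε * scalarSkelSq M u' :=
    mul_le_mul_of_nonneg_right (min_le_right _ _) (scalarSkelSq_nonneg M u')
  rw [hB1] at h5
  rw [hB2] at h6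
  rw [skelNormSq_eq_add, mul_add]
  linarith

/-- The energy controls the volume norm up to skeleton terms. -/
theorem min_mul_volNormSq_le (κ lam : ℝ) (β : Pt d → Pt d) (ε : ℝ) (σ' : M.VectorField)
    (u' : M.ScalarField) :
    min κ⁻¹ lam * volNormSq M σ' u'
      ≤ (κ⁻¹ * vectorVolSq M σ' + lam * scalarVolSq M u'
        + (1 / (2 * alphaBar M β) - constC4 M β ε) * normalSkelSq M σ'
        + (1 / alphaBar M β - constC3 M β ε) * scalarSkelSq M u')
        + max (constC3 M β ε) (constC4 M β ε) * skelNormSq M σ' u' := by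
  have ha := alphaBar_nonneg M β
  have h1 := mul_le_mul_of_nonneg_right (min_le_left κ⁻¹ lam) (vectorVolSq_nonneg M σ')
  have h2 := mul_le_mul_of_nonneg_right (min_le_right κ⁻¹ lam) (scalarVolSq_nonneg M u')
  have h3 := mul_le_mul_of_nonneg_right (le_max_right (constC3 M β ε) (constC4 M β ε))
    (normalSkelSq_nonneg M σ')
  have h4 := mul_le_mul_of_nonneg_right (le_max_left (constC3 M β ε) (constC4 M β ε))
    (scalarSkelSq_nonneg M u')
  -- The nonnegative 1/ᾱ terms are discarded; only −𝒞₃ and −𝒞₄ have to be compensated.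
  have h5 : 0 ≤ 1 / (2 * alphaBar M β) * normalSkelSq M σ' :=
    mul_nonneg (by positivity) (normalSkelSq_nonneg M σ')
  have h6 : 0 ≤ 1 / alphaBar M β * scalarSkelSq M u' :=
    mul_nonneg (by positivity) (scalarSkelSq_nonneg M u')
  rw [skelNormSq_eq_add, volNormSq_eq_add]
  linarith

end Step

end IHDG

/-! ### Geometric decay of the iterates -/

theorem mainTheorem3 (d : ℕ) (hd : 1 ≤ d) (M : IHDG.Mesh d) (p : ℕ)
    (κ lam ε c : ℝ) (hκ : 0 < κ) (hlam : 0 < lam) (hε : 0 < ε) (hc0 : 0 < c) (hc1 : c ≤ 1)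
    -- every element contains a ball of radius `c h`
    (hreg : ∀ j, ∃ x₀ : IHDG.Pt d, Metric.ball x₀ (c * M.h) ⊆ (M.elem j).carrier)
    (β : IHDG.Pt d → IHDG.Pt d) (ν : IHDG.Pt d → ℝ)
    (hβ_cont : ContinuousOn β (closure M.Ω))
    (hβ_diff : ∀ j, ContDiffOn ℝ 1 β (interior (M.elem j).carrier))
    (hβ_div : IntegrableOn (IHDG.divergence β) M.Ω)
    (hν : IntegrableOn ν M.Ω)
    (hcoer : ∀ᵐ x ∂(volume.restrict M.Ω), lam ≤ ν x - IHDG.divergence β x / 2)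
    -- the iterates, started from an arbitrary discrete initial guess
    (σ : ℕ → M.VectorField) (u : ℕ → M.ScalarField)
    (hσ0 : ∀ j, IHDG.IsVecPoly p (σ 0 j)) (hu0 : ∀ j, IHDG.IsPoly p (u 0 j))
    (hstep : ∀ k, IHDG.IsIHDGStep M p κ β ν (σ k) (u k) (σ (k + 1)) (u (k + 1)))
    (hB : 0 < IHDG.constB M p κ lam β c ε)
    (hD : IHDG.constD M p κ lam β c ε < 1) :
    (∀ k : ℕ, IHDG.skelNormSq M (σ k) (u k) ≤
        IHDG.constD M p κ lam β c ε ^ k * IHDG.skelNormSq M (σ 0) (u 0)) ∧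
    (∀ k : ℕ, 1 ≤ k → IHDG.volNormSq M (σ k) (u k) ≤
        (IHDG.constE M κ lam β ε * IHDG.constD M p κ lam β c ε + IHDG.constF M κ lam β ε)
          * IHDG.constD M p κ lam β c ε ^ (k - 1) * IHDG.skelNormSq M (σ 0) (u 0)) ∧
    Tendsto (fun k => IHDG.skelNormSq M (σ k) (u k)) atTop (𝓝 0) ∧
    Tendsto (fun k => IHDG.volNormSq M (σ k) (u k)) atTop (𝓝 0) := by
  have hpoly : ∀ k, (∀ j, IHDG.IsVecPoly p (σ k j)) ∧ ∀ j, IHDG.IsPoly p (u k j) := by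
    intro k
    cases k with
    | zero => exact ⟨hσ0, hu0⟩
    | succ k => exact ⟨(hstep k).poly_σ, (hstep k).poly_u⟩
  have henergy := fun k => (hstep k).energy_estimate (lam := lam) hε
    (fun j => ((hpoly k).1 j).continuous) (fun j => ((hpoly k).2 j).continuous)
    hβ_cont hβ_diff hβ_div hν hcoer
  have hA := IHDG.constA_nonneg M β hε
  set D := IHDG.constD M p κ lam β c ε with hDdef
  have hD0 : 0 ≤ D := div_nonneg hA hB.le
  have hm : 0 < min κ⁻¹ lam := lt_min (inv_pos.2 hκ) hlam
  -- The energy lies between 𝓑 times the new and 𝓐 times the old skeleton norm; division by 𝓑 > 0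
  -- gives the contraction.
  have hskel1 : ∀ k, IHDG.skelNormSq M (σ (k + 1)) (u (k + 1))
      ≤ D * IHDG.skelNormSq M (σ k) (u k) := by
    intro k
    have h := (IHDG.constB_mul_skelNormSq_le hd hκ hlam hc0 hreg (hstep k).poly_σ
      (hstep k).poly_u).trans (henergy k)
    rw [hDdef, IHDG.constD, div_mul_eq_mul_div, le_div_iff₀ hB]
    linarith
  have hskel : ∀ k, IHDG.skelNormSq M (σ k) (u k) ≤ D ^ k * IHDG.skelNormSq M (σ 0) (u 0) := by
    intro k
    induction k with
    | zero => simp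
    | succ k ih =>
      calc IHDG.skelNormSq M (σ (k + 1)) (u (k + 1)) ≤ D * IHDG.skelNormSq M (σ k) (u k) :=
            hskel1 k
        _ ≤ D * (D ^ k * IHDG.skelNormSq M (σ 0) (u 0)) := by gcongr
        _ = D ^ (k + 1) * IHDG.skelNormSq M (σ 0) (u 0) := by ring
  -- The index starts at 1 because the initial guess solves no local problem. The new skeleton norm
  -- contributes 𝓔𝓓, the old one 𝓕.
  have hvol : ∀ k, IHDG.volNormSq M (σ (k + 1)) (u (k + 1))
      ≤ (IHDG.constE M κ lam β ε * D + IHDG.constF M κ lam β ε) * D ^ k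
        * IHDG.skelNormSq M (σ 0) (u 0) := by
    intro k
    have h1 := (IHDG.min_mul_volNormSq_le κ lam β ε (σ (k + 1)) (u (k + 1))).trans
      (add_le_add_left (henergy k) _)
    have h2 := mul_le_mul_of_nonneg_left (hskel k) hA
    have h3 := mul_le_mul_of_nonneg_left (hskel (k + 1))
      ((IHDG.constC4_nonneg M β hε).trans (le_max_right (IHDG.constC3 M β ε) _))
    have h4 : (IHDG.constE M κ lam β ε * D + IHDG.constF M κ lam β ε) * D ^ k
        * IHDG.skelNormSq M (σ 0) (u 0)
        = (IHDG.constA M β ε * (D ^ k * IHDG.skelNormSq M (σ 0) (u 0))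
          + max (IHDG.constC3 M β ε) (IHDG.constC4 M β ε)
            * (D ^ (k + 1) * IHDG.skelNormSq M (σ 0) (u 0))) / min κ⁻¹ lam := by
      rw [IHDG.constE, IHDG.constF]
      ring
    rw [h4, le_div_iff₀ hm]
    linarith
  have hpow := tendsto_pow_atTop_nhds_zero_of_lt_one hD0 hD
  refine ⟨hskel, ?_, ?_, ?_⟩
  · intro k hk
    obtain ⟨k, rfl⟩ : ∃ l, k = l + 1 := ⟨k - 1, by omega⟩
    exact hvol k
  · refine squeeze_zero (fun k => IHDG.skelNormSq_nonneg M _ _) hskel ?_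
    simpa using hpow.mul_const (IHDG.skelNormSq M (σ 0) (u 0))
  · rw [← tendsto_add_atTop_iff_nat 1]
    refine squeeze_zero (fun k => IHDG.volNormSq_nonneg M _ _) hvol ?_
    simpa using (hpow.const_mul (IHDG.constE M κ lam β ε * D + IHDG.constF M κ lam β ε)).mul_const
      (IHDG.skelNormSq M (σ 0) (u 0))
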